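/- Let $\Sigma$ be a many-sorted signature with equality whose function symbols are all unary and whose relation symbols have arbitrary finite arities, and let $T$ be the empty $\Sigma$-theory (EUF). Let $\exists \underline e\,\phi(\underline e,\underline y)$ be a (well-sorted) primitive formula, i.e. $\phi$ is a conjunction of literals; its size $n$ is the number of its symbols, the quantified variables included (so $n\ge 1$). A *cover* of $\exists\underline e\,\phi$ is a quantifier-free formula $\psi(\underline y)$ such that $T\models \phi(\underline e,\underline y)\to\psi(\underline y)$ and such that $T\models\psi(\underline y)\to\theta(\underline y,\underline z)$ for every quantifier-free $\theta(\underline y,\underline z)$ with $T\models\phi(\underline e,\underline y)\to\theta(\underline y,\underline z)$. A formula is in *dag-format* if it has the form $\exists \underline e'\,(\bigwedge_i e'_i=t_i\wedge\chi(\underline e',\underline y))$, where $\chi$ is quantifier-free, the $e'_i$ are distinct and each $t_i$ is a flat term (see below) containing only variables from $e'_1,\dots,e'_{i-1},\underline y$; it is a cover in dag-format if it is $T$-equivalent to a cover. A term is $\underline e$-flat if it does not contain the $\underline e$, or is one of the $\underline e$, or is $f(e_i)$. The $\underline e$-flat literals are $t=a$, $a\ne b$, $R(a_1,\dots,a_m)$,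 $\neg R(a_1,\dots,a_m)$, where $t$ is $\underline e$-flat and $a,b,a_j$ are $\underline e$-free terms or variables from $\underline e$. A set $S$ of $\underline e$-flat literals is RS-closed if (i) $f(e_i)=t,\ f(e_i)=v\in S$ imply $t=v\in S$, and (ii) $e_i=e_j,\ L\in S$, $e_i>e_j$ and $L_{|p}\equiv e_i$ imply $L[e_j]_p\in S$, where $>$ is a total ordering of the $\underline e$; equations are unordered. For a set of marked variables, call an $\underline e$-free term or a marked variable a parameter; for terms $a,b$ that are parameters or unmarked variables, $E(a,b)$ is $\emptyset$ if $a\equiv b$, is $\{a=b\}$ if $a\not\equiv b$ are parameters, and fails otherwise. Consider the following procedure, with input $\exists \underline e\,\phi$. 1. Abstract subterms of $\phi$ by fresh existential variables to obtain $\underline e$-flat literals, and apply congruence closure (merging the classes of variables equated, deducing $a=b$ whenever $f(e_i)=a$ and $f(e_j)=b$ with $e_i,e_j$ in the same class, and rewriting variables to representatives), to obtain a set $S$ of $\underline e$-flat literals. 2. (Marking/Demodulation) Initially all existential variables are unmarked. Scan $S$, and mark $e_i$ as soon as an equation $e_i=t$ is found such that all existential variables of $t$ are marked; repeat until no more variable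 gets marked. 3. (Reflexion) If $S$ contains a literal $e_i\neq e_i$, output $\bot$ and exit. 4. Let $OUT$ be the conjunction of the literals of $S$ all of whose existential variables are marked. 5. (Resolution) For every literal $R(a_1,\dots,a_m)\in S$ containing an unmarked variable and every literal $\neg R(b_1,\dots,b_m)\in S$, if no $E(a_j,b_j)$ fails, conjoin $\bigvee\{u\neq u'\mid u=u'\in\bigcup_j E(a_j,b_j)\}$ to $OUT$. 6. Output $\exists\underline e'\,(\mathit{Def}\wedge OUT)$, where $\underline e'$ are the marked variables and $\mathit{Def}$ consists of the equations $e_i=t$ by which they were marked. Then, for every input, the set $S$ of step 1 is RS-closed, and the procedure returns a cover of $\exists\underline e\,\phi(\underline e,\underline y)$ in dag-format. Implemented with lists and arrays, it does so in time $O(n^2)$: there is a constant $C$ such that the number of steps is at most $C n^2$ for every input of size $n$. Steps are counted on a random access machine with unit costs: each recursive call and each loop iteration costs one step and performs a bounded number of elementary operations (comparing two symbols or variables, inspecting or building one node of a list, term or formula, accessing one array cell); allocating, or passing over, an array of length $N$ costs $N$ steps. -/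

import Mathlib

universe u v w

/-! ## Many-sorted signatures with unary functions, terms, formulas, structures -/

/-- A many-sorted signature all of whose function symbols are unary and whose relation symbols have
arbitrary finite arities (equality on every sort is part of the logic).  Constants are not symbols of
the signature. -/
structure Signature where
  Srt : Type u
  Fn : Type u
  Rel : Type u
  dom : Fn → Srt
  cod : Fn → Srt
  relSorts : Rel → List Srt

/-- Terms over the variables `V`; all function symbols are unary. -/
inductive Term (σ : Signature.{u}) (V : Type v) : Type (max u v)
  | var (x : V) : Term σ V
  | app (f : σ.Fn) (t : Term σ V) : Term σ V

/-- A structure: a many-sorted universe, given as the disjoint union `carrier` of its (nonempty) sorts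
with the map `sort` telling the sort of every element.  The value of `fn f` outside the domain sort of
`f`, and that of `rel R` on wrongly sorted tuples, are never used by well-sorted formulas. -/
structure Model (σ : Signature.{u}) where
  carrier : Type u
  sort : carrier → σ.Srt
  sort_surjective : Function.Surjective sort
  fn : σ.Fn → carrier → carrier
  sort_fn : ∀ f x, sort x = σ.dom f → sort (fn f x) = σ.cod f
  rel : σ.Rel → List carrier → Prop

namespace Term

variable {σ : Signature.{u}} {V : Type v}

/-- The value of a term. -/
def eval (M : Model σ) (ρ : V → M.carrier) : Term σ V → M.carrier
  | var x => ρ x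
  | app f t => M.fn f (eval M ρ t)

/-- The sort of a term, for a given sorting of the variables. -/
def sortOf (s : V → σ.Srt) : Term σ V → σ.Srt
  | var x => s x
  | app f _ => σ.cod f

def WellSorted (s : V → σ.Srt) : Term σ V → Prop
  | var _ => True
  | app f t => t.sortOf s = σ.dom f ∧ WellSorted s t

/-- The variable of a term (there is exactly one, all function symbols being unary). -/
def head : Term σ V → V
  | var x => x
  | app _ t => head t

/-- The number of symbols of a term. -/
def size : Term σ V → ℕ
  | var _ => 1
  | app _ t => size t + 1

end Term

/-- Well-sortedness of an equation and of a relational atom. -/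
def EqSorted {σ : Signature.{u}} {V : Type v} (s : V → σ.Srt) (t t' : Term σ V) : Prop :=
  t.WellSorted s ∧ t'.WellSorted s ∧ t.sortOf s = t'.sortOf s

def RelSorted {σ : Signature.{u}} {V : Type v} (s : V → σ.Srt) (R : σ.Rel)
    (ts : List (Term σ V)) : Prop :=
  (∀ t ∈ ts, t.WellSorted s) ∧ ts.map (Term.sortOf s) = σ.relSorts R

/-- Quantifier-free formulas. -/
inductive QF (σ : Signature.{u}) (V : Type v) : Type (max u v)
  | bot : QF σ V
  | eq (t t' : Term σ V) : QF σ V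
  | rel (R : σ.Rel) (ts : List (Term σ V)) : QF σ V
  | neg (φ : QF σ V) : QF σ V
  | and (φ ψ : QF σ V) : QF σ V
  | or (φ ψ : QF σ V) : QF σ V

namespace QF

variable {σ : Signature.{u}} {V : Type v}

def top : QF σ V := neg bot

def Realize (M : Model σ) (ρ : V → M.carrier) : QF σ V → Prop
  | bot => False
  | eq t t' => t.eval M ρ = t'.eval M ρ
  | rel R ts => M.rel R (ts.map (Term.eval M ρ))
  | neg φ => ¬ Realize M ρ φ
  | and φ ψ => Realize M ρ φ ∧ Realize M ρ ψ
  | or φ ψ => Realize M ρ φ ∨ Realize M ρ ψ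

def WellSorted (s : V → σ.Srt) : QF σ V → Prop
  | bot => True
  | eq t t' => EqSorted s t t'
  | rel R ts => RelSorted s R ts
  | neg φ => WellSorted s φ
  | and φ ψ => WellSorted s φ ∧ WellSorted s ψ
  | or φ ψ => WellSorted s φ ∧ WellSorted s ψ

/-- All variables of the formula satisfy `p`. -/
def VarsIn (p : V → Prop) : QF σ V → Prop
  | bot => True
  | eq t t' => p t.head ∧ p t'.head
  | rel _ ts => ∀ t ∈ ts, p t.head
  | neg φ => VarsIn p φ
  | and φ ψ => VarsIn p φ ∧ VarsIn p ψ
  | or φ ψ => VarsIn p φ ∧ VarsIn p ψ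

end QF

/-- Literals. -/
inductive Literal (σ : Signature.{u}) (V : Type v) : Type (max u v)
  | eq (t t' : Term σ V) : Literal σ V
  | ne (t t' : Term σ V) : Literal σ V
  | pos (R : σ.Rel) (ts : List (Term σ V)) : Literal σ V
  | neg (R : σ.Rel) (ts : List (Term σ V)) : Literal σ V

namespace Literal

variable {σ : Signature.{u}} {V : Type v}

def toQF : Literal σ V → QF σ V
  | eq t t' => .eq t t'
  | ne t t' => .neg (.eq t t')
  | pos R ts => .rel R ts
  | neg R ts => .neg (.rel R ts)

/-- The number of symbols of a literal. -/
def size : Literal σ V → ℕ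
  | eq t t' => t.size + t'.size + 1
  | ne t t' => t.size + t'.size + 1
  | pos _ ts => (ts.map Term.size).sum + 1
  | neg _ ts => (ts.map Term.size).sum + 2

end Literal

/-- Primitive formulas `∃ e₀ … e_{k-1}, ⋀ lits`, where `k = exNum`.  A variable `Sum.inl p` is a parameter
(one of the `y`), `Sum.inr i` is the existential variable `e_i`.  The values of `exSort` at
indices `≥ exNum` play no role. -/
structure Primitive (σ : Signature.{u}) (P : Type u) where
  exNum : ℕ
  exSort : ℕ → σ.Srt
  lits : List (Literal σ (P ⊕ ℕ))

namespace Primitive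

variable {σ : Signature.{u}} {P : Type u}

/-- The formula is well-sorted, and its free variables are parameters. -/
def WellFormed (psort : P → σ.Srt) (φ : Primitive σ P) : Prop :=
  ∀ L ∈ φ.lits, L.toQF.WellSorted (Sum.elim psort φ.exSort) ∧
    L.toQF.VarsIn (fun x => ∀ i, x = Sum.inr i → i < φ.exNum)

/-- Truth of `∃ e, φ(e, y)` under an assignment `ρ` of the parameters. -/
def Realize (M : Model σ) (ρ : P → M.carrier) (φ : Primitive σ P) : Prop :=
  ∃ ε : ℕ → M.carrier, (∀ i < φ.exNum, M.sort (ε i) = φ.exSort i) ∧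
    ∀ L ∈ φ.lits, L.toQF.Realize M (Sum.elim ρ ε)

/-- The size of the formula: the number of its symbols (the empty conjunction is one symbol). -/
def size (φ : Primitive σ P) : ℕ :=
  φ.exNum + (φ.lits.map Literal.size).sum + 1

end Primitive

/-- A sort-respecting assignment. -/
def Respects {σ : Signature.{u}} {V : Type v} (s : V → σ.Srt) (M : Model σ)
    (ρ : V → M.carrier) : Prop :=
  ∀ x, M.sort (ρ x) = s x

/-- `θ(y, z)` is a residue of `∃ e, φ(e, y)` in the theory (EUF), i.e. the empty theory: it is a
quantifier-free formula with `⊨ φ(e, y) → θ(y, z)`.  The additional variables `z` are the elements of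
`Z`, of sorts `zsort`. -/
def IsResidue {σ : Signature.{u}} {P Z : Type u} (psort : P → σ.Srt) (zsort : Z → σ.Srt)
    (φ : Primitive σ P) (θ : QF σ (P ⊕ Z)) : Prop :=
  θ.WellSorted (Sum.elim psort zsort) ∧
    ∀ (M : Model σ) (ρ : P → M.carrier) (ζ : Z → M.carrier), Respects psort M ρ →
      Respects zsort M ζ → φ.Realize M ρ → θ.Realize M (Sum.elim ρ ζ)

/-- `ψ(y)` is a cover of `∃ e, φ(e, y)` in (EUF): it is a residue, and it implies all the residues. -/
def IsCover {σ : Signature.{u}} {P : Type u} (psort : P → σ.Srt)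
    (φ : Primitive σ P) (ψ : QF σ P) : Prop :=
  ψ.WellSorted psort ∧
  (∀ (M : Model σ) (ρ : P → M.carrier), Respects psort M ρ → φ.Realize M ρ → ψ.Realize M ρ) ∧
  ∀ (Z : Type u) (zsort : Z → σ.Srt) (θ : QF σ (P ⊕ Z)), IsResidue psort zsort φ θ →
    ∀ (M : Model σ) (ρ : P → M.carrier) (ζ : Z → M.carrier), Respects psort M ρ →
      Respects zsort M ζ → ψ.Realize M ρ → θ.Realize M (Sum.elim ρ ζ)

/-! ## Flat terms, flat literals, closed sets of flat literals, dag-format -/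

/-- An existential variable or an `e`-free term. -/
inductive Atm (σ : Signature.{u}) (P : Type u) : Type u
  | ex (i : ℕ) : Atm σ P
  | free (t : Term σ P) : Atm σ P

/-- The `e`-flat terms: existential variables, `e`-free terms, and `f(e_i)`. -/
inductive FlatTerm (σ : Signature.{u}) (P : Type u) : Type u
  | atm (a : Atm σ P) : FlatTerm σ P
  | app (f : σ.Fn) (i : ℕ) : FlatTerm σ P

/-- The `e`-flat literals: `a = b`, `f(e_i) = a`, `a ≠ b`, `R(a₁, …, a_m)`, `¬ R(a₁, …, a_m)`. -/
inductive FlatLit (σ : Signature.{u}) (P : Type u) : Type u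
  | eq (a b : Atm σ P) : FlatLit σ P
  | app (f : σ.Fn) (i : ℕ) (a : Atm σ P) : FlatLit σ P
  | ne (a b : Atm σ P) : FlatLit σ P
  | pos (R : σ.Rel) (as : List (Atm σ P)) : FlatLit σ P
  | neg (R : σ.Rel) (as : List (Atm σ P)) : FlatLit σ P

/-- Primitive flat formulas, with existential variables `e_i`, `i < exNum`. -/
structure FlatFormula (σ : Signature.{u}) (P : Type u) where
  exNum : ℕ
  exSort : ℕ → σ.Srt
  lits : List (FlatLit σ P)

section Flat

variable {σ : Signature.{u}} {P : Type u}

def Term.lift : Term σ P → Term σ (P ⊕ ℕ)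
  | .var p => .var (Sum.inl p)
  | .app f t => .app f t.lift

def Atm.toTerm : Atm σ P → Term σ (P ⊕ ℕ)
  | .ex i => .var (Sum.inr i)
  | .free t => t.lift

def FlatTerm.toTerm : FlatTerm σ P → Term σ (P ⊕ ℕ)
  | .atm a => a.toTerm
  | .app f i => .app f (.var (Sum.inr i))

/-- `OneRewrite i j L L'`: the literal `L'` is `L[e_j]_p` for a position `p` with `L|_p ≡ e_i`. -/
inductive OneRewrite (i j : ℕ) : FlatLit σ P → FlatLit σ P → Prop
  | eq_left (b : Atm σ P) : OneRewrite i j (.eq (.ex i) b) (.eq (.ex j) b)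
  | eq_right (a : Atm σ P) : OneRewrite i j (.eq a (.ex i)) (.eq a (.ex j))
  | app_arg (f : σ.Fn) (a : Atm σ P) : OneRewrite i j (.app f i a) (.app f j a)
  | app_right (f : σ.Fn) (k : ℕ) : OneRewrite i j (.app f k (.ex i)) (.app f k (.ex j))
  | ne_left (b : Atm σ P) : OneRewrite i j (.ne (.ex i) b) (.ne (.ex j) b)
  | ne_right (a : Atm σ P) : OneRewrite i j (.ne a (.ex i)) (.ne a (.ex j))
  | pos (R : σ.Rel) (as bs : List (Atm σ P)) :
      OneRewrite i j (.pos R (as ++ .ex i :: bs)) (.pos R (as ++ .ex j :: bs))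
  | neg (R : σ.Rel) (as bs : List (Atm σ P)) :
      OneRewrite i j (.neg R (as ++ .ex i :: bs)) (.neg R (as ++ .ex j :: bs))

/-- Membership of a literal in a set of literals; an equation is a multiset of two terms. -/
def Holds (S : List (FlatLit σ P)) : FlatLit σ P → Prop
  | .eq a b => .eq a b ∈ S ∨ .eq b a ∈ S
  | .ne a b => .ne a b ∈ S ∨ .ne b a ∈ S
  | L => L ∈ S

/-- Sets of `e`-flat literals closed under restricted superposition.  The ordering of the
existential variables is that of their indices. -/
def RSClosed (S : List (FlatLit σ P)) : Prop :=
  (∀ f i a b, Holds S (.app f i a) → Holds S (.app f i b) → Holds S (.eq a b)) ∧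
  ∀ i j L L', Holds S (.eq (.ex i) (.ex j)) → j < i → Holds S L → OneRewrite i j L L' → Holds S L'

end Flat

/-- Formulas `∃ e' (⋀ (x, t) ∈ defs, e_x = t  ∧ matrix)`, where `e'` consists of the variables `e_x` with
`(x, t) ∈ defs`. -/
structure DagFormula (σ : Signature.{u}) (P : Type u) where
  exSort : ℕ → σ.Srt
  defs : List (ℕ × FlatTerm σ P)
  matrix : QF σ (P ⊕ ℕ)

namespace DagFormula

variable {σ : Signature.{u}} {P : Type u}

/-- The definitions are those of distinct variables not in `seen`, each definiens containing, besides
parameters, only variables in `seen` or defined earlier. -/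
def Acyclic : List ℕ → List (ℕ × FlatTerm σ P) → Prop
  | _, [] => True
  | seen, (x, t) :: ds =>
      x ∉ seen ∧ (∀ i, t.toTerm.head = Sum.inr i → i ∈ seen) ∧ Acyclic (x :: seen) ds

/-- The formula is in dag-format: the flat definitions are acyclic, and the quantifier-free matrix
contains only parameters and defined variables.  Everything is well-sorted. -/
def IsDag (psort : P → σ.Srt) (D : DagFormula σ P) : Prop :=
  Acyclic [] D.defs ∧
  D.matrix.VarsIn (fun x => ∀ i, x = Sum.inr i → i ∈ D.defs.map Prod.fst) ∧
  (∀ d ∈ D.defs, EqSorted (Sum.elim psort D.exSort) (.var (Sum.inr d.1)) d.2.toTerm) ∧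
  D.matrix.WellSorted (Sum.elim psort D.exSort)

def Realize (M : Model σ) (ρ : P → M.carrier) (D : DagFormula σ P) : Prop :=
  ∃ ε : ℕ → M.carrier, (∀ d ∈ D.defs, M.sort (ε d.1) = D.exSort d.1) ∧
    (∀ d ∈ D.defs, ε d.1 = d.2.toTerm.eval M (Sum.elim ρ ε)) ∧
    D.matrix.Realize M (Sum.elim ρ ε)

end DagFormula

/-- `D` is a cover of `∃ e, φ(e, y)` in dag-format: it is in dag-format and (EUF)-equivalent to a
quantifier-free formula in the parameters which is a cover of `∃ e, φ(e, y)`. -/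
def IsCoverInDagFormat {σ : Signature.{u}} {P : Type u} (psort : P → σ.Srt)
    (φ : Primitive σ P) (D : DagFormula σ P) : Prop :=
  D.IsDag psort ∧ ∃ ψ : QF σ P, IsCover psort φ ψ ∧
    ∀ (M : Model σ) (ρ : P → M.carrier), Respects psort M ρ → (D.Realize M ρ ↔ ψ.Realize M ρ)

/-! ## Computations with a step count

The model is a random access machine with unit costs.  Every call of a recursive function, and every
iteration of a loop, is charged one step; besides its calls of other charged functions it performs only a
bounded number of elementary operations: inspecting or building one node of a list, term or formula
(terms are shared, not copied), comparing two symbols, variables or indices, reading or writing one cell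
of an array.  Arrays of length `N` are functions on `ℕ`; allocating one, or one pass over all its cells,
is charged `N` steps.  Comparing or writing out terms is charged symbol by symbol. -/

/-- A result together with the number of steps spent on it. -/
structure Timed (α : Type v) where
  val : α
  cost : ℕ

namespace Timed

variable {α : Type v} {β : Type w}

def ret (a : α) : Timed α := ⟨a, 0⟩

def bind (x : Timed α) (f : α → Timed β) : Timed β :=
  ⟨(f x.val).val, x.cost + (f x.val).cost⟩

/-- Spend `n` steps. -/
def tick (n : ℕ) (x : Timed α) : Timed α := ⟨x.val, n + x.cost⟩

/-- The loop over a list: one step per iteration, plus the cost of the body. -/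
def loop (body : β → α → Timed β) : β → List α → Timed β
  | b, [] => tick 1 (ret b)
  | b, x :: xs => tick 1 ((body b x).bind fun b' => loop body b' xs)

end Timed

open Timed

section Algorithm

variable {σ : Signature.{u}} {P : Type u}

/-! ### Step 1, abstraction -/

/-- Add a literal. -/
def FlatFormula.add (F : FlatFormula σ P) (L : FlatLit σ P) : FlatFormula σ P :=
  { F with lits := L :: F.lits }

/-- Name a flat term: `f(e_i)` is replaced by a fresh existential variable `e'`, with `f(e_i) = e'`. -/
def nameTerm (F : FlatFormula σ P) : FlatTerm σ P → Timed (Atm σ P × FlatFormula σ P)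
  | .atm a => tick 1 (ret (a, F))
  | .app f i => tick 1 (ret (.ex F.exNum,
      { exNum := F.exNum + 1
        exSort := Function.update F.exSort F.exNum (σ.cod f)
        lits := .app f i (.ex F.exNum) :: F.lits }))

/-- Replace a term by a flat one, naming its proper subterms that are not flat atoms. -/
def flattenTerm (F : FlatFormula σ P) : Term σ (P ⊕ ℕ) → Timed (FlatTerm σ P × FlatFormula σ P)
  | .var (Sum.inl p) => tick 1 (ret (.atm (.free (.var p)), F))
  | .var (Sum.inr i) => tick 1 (ret (.atm (.ex i), F))
  | .app f t => tick 1 ((flattenTerm F t).bind fun r => (nameTerm r.2 r.1).bind fun s =>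
      match s.1 with
      | .ex i => ret (.app f i, s.2)
      | .free t' => ret (.atm (.free (.app f t')), s.2))

def abstractTerm (F : FlatFormula σ P) (t : Term σ (P ⊕ ℕ)) :
    Timed (Atm σ P × FlatFormula σ P) :=
  (flattenTerm F t).bind fun r => nameTerm r.2 r.1

def abstractList (F : FlatFormula σ P) :
    List (Term σ (P ⊕ ℕ)) → Timed (List (Atm σ P) × FlatFormula σ P)
  | [] => tick 1 (ret ([], F))
  | t :: ts => tick 1 ((abstractTerm F t).bind fun r => (abstractList r.2 ts).bind fun s =>
      ret (r.1 :: s.1, s.2))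

def flattenLit (F : FlatFormula σ P) : Literal σ (P ⊕ ℕ) → Timed (FlatFormula σ P)
  | .eq t t' => (flattenTerm F t).bind fun r => (flattenTerm r.2 t').bind fun s =>
      match r.1, s.1 with
      | .atm a, .atm b => ret (s.2.add (.eq a b))
      | .app f i, .atm b => ret (s.2.add (.app f i b))
      | .atm a, .app g j => ret (s.2.add (.app g j a))
      | .app f i, .app g j => (nameTerm s.2 (.app g j)).bind fun q => ret (q.2.add (.app f i q.1))
  | .ne t t' => (abstractTerm F t).bind fun r => (abstractTerm r.2 t').bind fun s =>
      ret (s.2.add (.ne r.1 s.1))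
  | .pos R ts => (abstractList F ts).bind fun r => ret (r.2.add (.pos R r.1))
  | .neg R ts => (abstractList F ts).bind fun r => ret (r.2.add (.neg R r.1))

/-- The abstraction phase. -/
def flatten (φ : Primitive σ P) : Timed (FlatFormula σ P) :=
  tick φ.exNum (loop flattenLit ⟨φ.exNum, φ.exSort, []⟩ φ.lits)

/-! ### Step 1, congruence closure -/

/-- The state of the congruence closure.  `rep i` is the representative (the least member) of the class
of `e_i`; for a representative `i`, `(f, a) ∈ bucket i` stands for `f(e_i) = a`; `todo` contains the
equations not yet processed, `eqs` the processed ones having an `e`-free member. -/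
structure Closure (σ : Signature.{u}) (P : Type u) where
  rep : ℕ → ℕ
  bucket : ℕ → List (σ.Fn × Atm σ P)
  todo : List (Atm σ P × Atm σ P)
  eqs : List (Atm σ P × Atm σ P)

def findFn [DecidableEq σ.Fn] (f : σ.Fn) : List (σ.Fn × Atm σ P) → Timed (Option (Atm σ P))
  | [] => tick 1 (ret none)
  | (g, b) :: l => tick 1 (if f = g then ret (some b) else findFn f l)

/-- Insert `f(e_i) = a`; if `f(e_i) = b` is present, the equation `a = b` is deduced instead. -/
def initLit [DecidableEq σ.Fn] (c : Closure σ P) : FlatLit σ P → Timed (Closure σ P)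
  | .eq a b => ret { c with todo := (a, b) :: c.todo }
  | .app f i a => (findFn f (c.bucket i)).bind fun r =>
      match r with
      | some b => ret { c with todo := (a, b) :: c.todo }
      | none => ret { c with bucket := Function.update c.bucket i ((f, a) :: c.bucket i) }
  | _ => ret c

/-- Merge the class of `e_l` into that of `e_k`, in an array of length `N`; whenever `f(e_l) = a` and
`f(e_k) = b`, the equation `a = b` is deduced. -/
def mergeClasses [DecidableEq σ.Fn] (N l k : ℕ) (c : Closure σ P) : Timed (Closure σ P) :=
  (loop (fun (s : List (σ.Fn × Atm σ P) × List (Atm σ P × Atm σ P)) (x : σ.Fn × Atm σ P) =>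
      (findFn x.1 (c.bucket k)).bind fun r =>
        match r with
        | some b => ret (s.1, (x.2, b) :: s.2)
        | none => ret (x :: s.1, s.2))
    (c.bucket k, c.todo) (c.bucket l)).bind fun s =>
  tick N (ret
    { rep := fun i => if c.rep i = l then k else c.rep i
      bucket := Function.update (Function.update c.bucket l []) k s.1
      todo := s.2
      eqs := c.eqs })

/-- Process the equations one by one.  The first argument only ensures termination. -/
def closeLoop [DecidableEq σ.Fn] (N : ℕ) : ℕ → Closure σ P → Timed (Closure σ P)
  | 0, c => ret c
  | n + 1, c => tick 1 (match c.todo with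
    | [] => ret c
    | (.ex i, .ex j) :: todo =>
        if c.rep i = c.rep j then closeLoop N n { c with todo := todo }
        else (mergeClasses N (max (c.rep i) (c.rep j)) (min (c.rep i) (c.rep j))
          { c with todo := todo }).bind (closeLoop N n)
    | (a, b) :: todo => closeLoop N n { c with todo := todo, eqs := (a, b) :: c.eqs })

def Atm.norm (rep : ℕ → ℕ) : Atm σ P → Atm σ P
  | .ex i => .ex (rep i)
  | .free t => .free t

def normList (rep : ℕ → ℕ) : List (Atm σ P) → Timed (List (Atm σ P))
  | [] => tick 1 (ret [])
  | a :: as => tick 1 ((normList rep as).bind fun bs => ret (a.norm rep :: bs))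

/-- List the equations `e_i = e_{rep i}`, and the literals rewritten to representatives. -/
def emit (F : FlatFormula σ P) (c : Closure σ P) : Timed (List (FlatLit σ P)) :=
  (loop (fun (S : List (FlatLit σ P)) (i : ℕ) =>
      loop (fun (S : List (FlatLit σ P)) (x : σ.Fn × Atm σ P) =>
          ret (.app x.1 i (x.2.norm c.rep) :: .eq (x.2.norm c.rep) (x.2.norm c.rep) :: S))
        (.eq (.ex i) (.ex (c.rep i)) :: S) (c.bucket i))
    [] (List.range F.exNum)).bind fun S₁ =>
  (loop (fun (S : List (FlatLit σ P)) (x : Atm σ P × Atm σ P) =>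
      ret (.eq (x.1.norm c.rep) (x.2.norm c.rep) :: S)) S₁ c.eqs).bind fun S₂ =>
  loop (fun (S : List (FlatLit σ P)) (L : FlatLit σ P) =>
      match L with
      | .ne a b => ret (.ne (a.norm c.rep) (b.norm c.rep) :: S)
      | .pos R as => (normList c.rep as).bind fun bs => ret (.pos R bs :: S)
      | .neg R as => (normList c.rep as).bind fun bs => ret (.neg R bs :: S)
      | _ => ret S) S₂ F.lits

/-- Step 1: preprocess the input into a set of `e`-flat literals closed under restricted superposition. -/
def preprocess [DecidableEq σ.Fn] (φ : Primitive σ P) : Timed (FlatFormula σ P) :=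
  (flatten φ).bind fun F =>
  tick (2 * F.exNum) ((loop initLit ⟨id, fun _ => [], [], []⟩ F.lits).bind fun c =>
  (closeLoop F.exNum F.lits.length c).bind fun c' =>
  (emit F c').bind fun S => ret { F with lits := S })

/-! ### Step 2, marking -/

/-- All existential variables of the atom are marked: the atom counts as parametric. -/
def Atm.marked (marks : ℕ → Bool) : Atm σ P → Bool
  | .ex i => marks i
  | .free _ => true

/-- If the literal is an equation `e_i = t` with `e_i` unmarked, all existential variables of `t` being
marked, return `i` and `t`. -/
def markable (marks : ℕ → Bool) : FlatLit σ P → Option (ℕ × FlatTerm σ P)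
  | .eq (.ex i) b =>
      if !marks i && b.marked marks then some (i, .atm b)
      else match b with
        | .ex j => if !marks j && marks i then some (j, .atm (.ex i)) else none
        | .free _ => none
  | .eq (.free t) (.ex j) => if !marks j then some (j, .atm (.free t)) else none
  | .app f i (.ex j) => if !marks j && marks i then some (j, .app f i) else none
  | _ => none

/-- The marks, the definitions of the marked variables (the last one first), and whether a variable has
been marked during the current scan. -/
structure Marking (σ : Signature.{u}) (P : Type u) where
  marks : ℕ → Bool
  defs : List (ℕ × FlatTerm σ P)
  changed : Bool

/-- Scan the literals; as soon as a variable can be marked, mark it. -/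
def markScan (S : List (FlatLit σ P)) (m : Marking σ P) : Timed (Marking σ P) :=
  loop (fun (m : Marking σ P) (L : FlatLit σ P) =>
    match markable m.marks L with
    | some (i, t) => ret ⟨Function.update m.marks i true, (i, t) :: m.defs, true⟩
    | none => ret m) { m with changed := false } S

/-- Repeat the scan until no more variable gets marked.  The first argument only ensures termination. -/
def markLoop (S : List (FlatLit σ P)) : ℕ → Marking σ P → Timed (Marking σ P)
  | 0, m => ret m
  | n + 1, m => tick 1 ((markScan S m).bind fun m' =>
      if m'.changed then markLoop S n m' else ret m')

/-! ### Step 3, Reflexion -/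

/-- Is Reflexion applicable, i.e. is there a literal `e_i ≠ e_i`? -/
def reflexion (S : List (FlatLit σ P)) : Timed Bool :=
  loop (fun (r : Bool) (L : FlatLit σ P) =>
    match L with
    | .ne (.ex i) (.ex j) => ret (r || decide (i = j))
    | _ => ret r) false S

/-! ### Step 4, literals with marked variables only -/

def writeTerm : Term σ P → Timed (Term σ (P ⊕ ℕ))
  | .var p => tick 1 (ret (.var (Sum.inl p)))
  | .app f t => tick 1 ((writeTerm t).bind fun t' => ret (.app f t'))

def writeAtm : Atm σ P → Timed (Term σ (P ⊕ ℕ))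
  | .ex i => tick 1 (ret (.var (Sum.inr i)))
  | .free t => tick 1 (writeTerm t)

def writeList : List (Atm σ P) → Timed (List (Term σ (P ⊕ ℕ)))
  | [] => tick 1 (ret [])
  | a :: as => tick 1 ((writeAtm a).bind fun t => (writeList as).bind fun ts => ret (t :: ts))

def writeLit : FlatLit σ P → Timed (QF σ (P ⊕ ℕ))
  | .eq a b => (writeAtm a).bind fun t => (writeAtm b).bind fun t' => ret (.eq t t')
  | .app f i a => (writeAtm a).bind fun t => ret (.eq (.app f (.var (Sum.inr i))) t)
  | .ne a b => (writeAtm a).bind fun t => (writeAtm b).bind fun t' => ret (.neg (.eq t t'))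
  | .pos R as => (writeList as).bind fun ts => ret (.rel R ts)
  | .neg R as => (writeList as).bind fun ts => ret (.neg (.rel R ts))

def allMarked (marks : ℕ → Bool) : List (Atm σ P) → Timed Bool
  | [] => tick 1 (ret true)
  | a :: as => tick 1 (if a.marked marks then allMarked marks as else ret false)

def litMarked (marks : ℕ → Bool) : FlatLit σ P → Timed Bool
  | .eq a b => ret (a.marked marks && b.marked marks)
  | .app _ i a => ret (marks i && a.marked marks)
  | .ne a b => ret (a.marked marks && b.marked marks)
  | .pos _ as => allMarked marks as
  | .neg _ as => allMarked marks as

/-- Conjoin `out` with the literals all of whose existential variables are marked. -/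
def conjoinMarked (marks : ℕ → Bool) (S : List (FlatLit σ P)) (out : QF σ (P ⊕ ℕ)) :
    Timed (QF σ (P ⊕ ℕ)) :=
  loop (fun (out : QF σ (P ⊕ ℕ)) (L : FlatLit σ P) =>
    (litMarked marks L).bind fun b =>
      if b then (writeLit L).bind fun q => ret (.and out q) else ret out) out S

/-! ### Step 5, Resolution -/

/-- Syntactic coincidence of terms. -/
def termEq [DecidableEq σ.Fn] [DecidableEq P] : Term σ P → Term σ P → Timed Bool
  | .var x, .var y => tick 1 (ret (decide (x = y)))
  | .app f t, .app g t' => tick 1 (if f = g then termEq t t' else ret false)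
  | _, _ => tick 1 (ret false)

def atmEq [DecidableEq σ.Fn] [DecidableEq P] : Atm σ P → Atm σ P → Timed Bool
  | .ex i, .ex j => tick 1 (ret (decide (i = j)))
  | .free t, .free t' => tick 1 (termEq t t')
  | _, _ => tick 1 (ret false)

/-- The procedure `E(a₁, b₁) ∪ … ∪ E(a_m, b_m)`, with the marked variables treated as parameters.  The
result is `none` on failure, and otherwise contains the constraints of `E`, added to `C`. -/
def unifyE [DecidableEq σ.Fn] [DecidableEq P] (marks : ℕ → Bool) :
    List (Atm σ P × Atm σ P) → List (Atm σ P) → List (Atm σ P) →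
      Timed (Option (List (Atm σ P × Atm σ P)))
  | C, [], [] => tick 1 (ret (some C))
  | C, a :: as, b :: bs => tick 1 ((atmEq a b).bind fun r =>
      if r then unifyE marks C as bs
      else if a.marked marks && b.marked marks then unifyE marks ((a, b) :: C) as bs
      else ret none)
  | _, _, _ => tick 1 (ret none)

/-- The disjunction of the negations of the constraints. -/
def writeClause : List (Atm σ P × Atm σ P) → Timed (QF σ (P ⊕ ℕ))
  | [] => tick 1 (ret .bot)
  | (a, b) :: C => tick 1 ((writeAtm a).bind fun t => (writeAtm b).bind fun t' =>
      (writeClause C).bind fun q => ret (.or (.neg (.eq t t')) q))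

/-- Resolve `R(as)` with all the literals `¬ R(bs)` of `S`. -/
def resolveWith [DecidableEq σ.Fn] [DecidableEq σ.Rel] [DecidableEq P] (marks : ℕ → Bool)
    (R : σ.Rel) (as : List (Atm σ P)) (S : List (FlatLit σ P)) (out : QF σ (P ⊕ ℕ)) :
    Timed (QF σ (P ⊕ ℕ)) :=
  loop (fun (out : QF σ (P ⊕ ℕ)) (L : FlatLit σ P) =>
    match L with
    | .neg R' bs =>
        if R = R' then (unifyE marks [] as bs).bind fun r =>
          match r with
          | some C => (writeClause C).bind fun q => ret (.and out q)
          | none => ret out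
        else ret out
    | _ => ret out) out S

/-- Apply Resolution to all the literals `R(as)` with at least one unmarked variable. -/
def resolution [DecidableEq σ.Fn] [DecidableEq σ.Rel] [DecidableEq P] (marks : ℕ → Bool)
    (S : List (FlatLit σ P)) (out : QF σ (P ⊕ ℕ)) : Timed (QF σ (P ⊕ ℕ)) :=
  loop (fun (out : QF σ (P ⊕ ℕ)) (L : FlatLit σ P) =>
    match L with
    | .pos R as => (allMarked marks as).bind fun b =>
        if b then ret out else resolveWith marks R as S out
    | _ => ret out) out S

/-! ### The whole procedure -/

/-- Steps 2 to 6.  The marked variables are existentially quantified in the output, their definitions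
being listed in the order of marking. -/
def coverOfClosed [DecidableEq σ.Fn] [DecidableEq σ.Rel] [DecidableEq P] (F : FlatFormula σ P) :
    Timed (DagFormula σ P) :=
  tick F.exNum ((markLoop F.lits F.exNum ⟨fun _ => false, [], false⟩).bind fun m =>
  (reflexion F.lits).bind fun r =>
  if r then ret ⟨F.exSort, [], .bot⟩
  else
    (conjoinMarked m.marks F.lits .top).bind fun out =>
    (resolution m.marks F.lits out).bind fun out' =>
    tick m.defs.length (ret ⟨F.exSort, m.defs.reverse, out'⟩))

/-- The procedure, steps 1 to 6. -/
def coverProcedure [DecidableEq σ.Fn] [DecidableEq σ.Rel] [DecidableEq P] (φ : Primitive σ P) :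
    Timed (DagFormula σ P) :=
  (preprocess φ).bind coverOfClosed

end Algorithm

/-! Preprocessing. A fresh variable naming `f(e_i)` is defined by it, so the flat formula is
solvable over given parameters exactly when the input is (`flatten_spec`). Congruence closure
replaces the equations by equivalent ones in normal form (`FlatFormula.Reduced`): apart from the
equations linking each variable to its representative, only representatives occur, no two distinct
variables are equated, and each `f(e_i)` is given at most one value. Superposition inside such a set
can only produce trivial equations, which are already listed (`FlatFormula.Reduced.rsClosed`).

Cover. The output follows from the flat formula: its conjuncts are literals of the formula or sound
resolvents (`realize_outputMatrix`). For the converse it suffices that every model of the output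
embeds into a model of `∃ e, φ`: a residue is true in the larger model and, being quantifier-free,
is then true in the smaller one, for all values of the additional variables `z` there. The embedding
is `FlatFormula.Reduced.exists_extension`. Marked variables keep their values, and each class of
unmarked variables receives its own new element. Functions at new elements are read off the literals
`f(e_i) = a`, which are unambiguous; relations gain only the instances `R(as)` containing an
unmarked variable, so the old structure is untouched. Literals with marked variables only are
conjuncts of the output. As the marking is saturated, an equation with an unmarked variable is
trivial, links the variable to its representative, or is some `f(e_i) = a` with `e_i` unmarked, true
by construction. Disequations hold because different classes have different elements and Reflexion
was not applicable. A literal `¬ R(bs)` could only be violated by an added instance `R(as)` with the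
same values; then `E` does not fail on `as`, `bs`, and the resolvent in the output says that some
pair has different values. Finally, acyclic definitions can be unfolded, so the output is equivalent
to a quantifier-free formula (`DagFormula.IsDag.exists_qf`).

Cost. Abstraction is linear, giving `m = 13 * φ.size` as a bound for the flat formula. In the
congruence closure every deduced equation consumes a bucket entry, so there are at most linearly
many equations. A merge costs the product of two bucket lengths plus a linear term; the products are
paid for by the potential `(∑ |b|)² - ∑ |b|²`, which counts ordered pairs of entries in different
buckets (`mergedClosure_measure`, `closeLoop_spec`). Marking needs linearly many scans, since each
but the last marks a variable. Resolution is quadratic because the relational literals have linear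
total size, so that comparing all pairs costs at most the number of literals times that total. -/

/-! ### Values and costs of loops. -/

namespace Timed

variable {α : Type v} {β : Type w}

@[simp] theorem ret_val (a : α) : (ret a).val = a := rfl
@[simp] theorem ret_cost (a : α) : (ret a).cost = 0 := rfl
@[simp] theorem bind_val (x : Timed α) (f : α → Timed β) : (x.bind f).val = (f x.val).val := rfl
@[simp] theorem bind_cost (x : Timed α) (f : α → Timed β) :
    (x.bind f).cost = x.cost + (f x.val).cost := rfl
@[simp] theorem tick_val (n : ℕ) (x : Timed α) : (tick n x).val = x.val := rfl
@[simp] theorem tick_cost (n : ℕ) (x : Timed α) : (tick n x).cost = n + x.cost := rfl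
@[simp] theorem loop_nil_val (body : β → α → Timed β) (b : β) : (loop body b []).val = b := rfl
@[simp] theorem loop_nil_cost (body : β → α → Timed β) (b : β) : (loop body b []).cost = 1 := rfl
@[simp] theorem loop_cons_val (body : β → α → Timed β) (b : β) (x : α) (l : List α) :
    (loop body b (x :: l)).val = (loop body (body b x).val l).val := rfl
@[simp] theorem loop_cons_cost (body : β → α → Timed β) (b : β) (x : α) (l : List α) :
    (loop body b (x :: l)).cost = 1 + ((body b x).cost + (loop body (body b x).val l).cost) := rfl

theorem loop_cost_le_of_invariant {body : β → α → Timed β} (I : β → Prop) (g : α → ℕ)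
    {b : β} {l : List α} (h : ∀ b, ∀ x ∈ l, I b → I (body b x).val)
    (hg : ∀ b, ∀ x ∈ l, I b → (body b x).cost ≤ g x) (hb : I b) :
    (loop body b l).cost ≤ (l.map g).sum + l.length + 1 := by
  induction l generalizing b with
  | nil => simp
  | cons x l ih =>
    have h1 := ih (fun b y hy => h b y (List.mem_cons_of_mem _ hy))
      (fun b y hy => hg b y (List.mem_cons_of_mem _ hy)) (h b x List.mem_cons_self hb)
    have h2 := hg b x List.mem_cons_self hb
    simp only [loop_cons_cost, List.map_cons, List.sum_cons, List.length_cons]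
    omega

theorem loop_cost_le {body : β → α → Timed β} (g : α → ℕ) {b : β} {l : List α}
    (hg : ∀ b, ∀ x ∈ l, (body b x).cost ≤ g x) :
    (loop body b l).cost ≤ (l.map g).sum + l.length + 1 :=
  loop_cost_le_of_invariant (fun _ => True) g (fun _ _ _ _ => trivial)
    (fun b x hx _ => hg b x hx) trivial

end Timed

/-! ### Terms and formulas depend only on the variables occurring in them. -/

section Terms

variable {σ : Signature.{u}} {V : Type v}

namespace Term

/-- Function symbols being unary, the head is the only variable of a term. -/
theorem eval_congr {M : Model σ} {ρ ρ' : V → M.carrier} {t : Term σ V}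
    (h : ρ t.head = ρ' t.head) : t.eval M ρ = t.eval M ρ' := by
  induction t with
  | var x => exact h
  | app f t ih => exact congrArg (M.fn f) (ih h)

theorem sortOf_congr {s s' : V → σ.Srt} {t : Term σ V} (h : s t.head = s' t.head) :
    t.sortOf s = t.sortOf s' := by
  cases t with
  | var x => exact h
  | app f t => rfl

theorem WellSorted.congr {s s' : V → σ.Srt} {t : Term σ V} (h : s t.head = s' t.head)
    (ht : t.WellSorted s) : t.WellSorted s' := by
  induction t with
  | var x => trivial
  | app f t ih => exact ⟨(sortOf_congr (t := t) h).symm.trans ht.1, ih h ht.2⟩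

theorem sort_eval {s : V → σ.Srt} {M : Model σ} {ρ : V → M.carrier} {t : Term σ V}
    (ht : t.WellSorted s) (h : M.sort (ρ t.head) = s t.head) :
    M.sort (t.eval M ρ) = t.sortOf s := by
  induction t with
  | var x => exact h
  | app f t ih => exact M.sort_fn f _ ((ih ht.2 h).trans ht.1)

theorem one_le_size (t : Term σ V) : 1 ≤ t.size := by cases t <;> simp [size]

end Term

namespace QF

theorem VarsIn.mono {p q : V → Prop} (h : ∀ x, p x → q x) {φ : QF σ V} (hφ : φ.VarsIn p) :
    φ.VarsIn q := by
  induction φ with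
  | bot => trivial
  | eq t t' => exact ⟨h _ hφ.1, h _ hφ.2⟩
  | rel R ts => exact fun t ht => h _ (hφ t ht)
  | neg φ ih => exact ih hφ
  | and φ ψ ih ih' => exact ⟨ih hφ.1, ih' hφ.2⟩
  | or φ ψ ih ih' => exact ⟨ih hφ.1, ih' hφ.2⟩

theorem realize_congr {M : Model σ} {ρ ρ' : V → M.carrier} {p : V → Prop} {φ : QF σ V}
    (hφ : φ.VarsIn p) (h : ∀ x, p x → ρ x = ρ' x) : φ.Realize M ρ ↔ φ.Realize M ρ' := by
  induction φ with
  | bot => exact Iff.rfl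
  | eq t t' =>
    simp only [Realize, Term.eval_congr (h _ hφ.1), Term.eval_congr (h _ hφ.2)]
  | rel R ts =>
    simp only [Realize]
    rw [List.map_congr_left fun t ht => Term.eval_congr (h _ (hφ t ht))]
  | neg φ ih => exact not_congr (ih hφ)
  | and φ ψ ih ih' => exact and_congr (ih hφ.1) (ih' hφ.2)
  | or φ ψ ih ih' => exact or_congr (ih hφ.1) (ih' hφ.2)

theorem WellSorted.congr {s s' : V → σ.Srt} {p : V → Prop} {φ : QF σ V}
    (hφ : φ.VarsIn p) (h : ∀ x, p x → s x = s' x) (hs : φ.WellSorted s) : φ.WellSorted s' := by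
  induction φ with
  | bot => trivial
  | eq t t' =>
    obtain ⟨h1, h2, h3⟩ := hs
    exact ⟨h1.congr (h _ hφ.1), h2.congr (h _ hφ.2), by
      rw [← Term.sortOf_congr (h _ hφ.1), ← Term.sortOf_congr (h _ hφ.2), h3]⟩
  | rel R ts =>
    exact ⟨fun t ht => (hs.1 t ht).congr (h _ (hφ t ht)),
      (List.map_congr_left fun t ht => (Term.sortOf_congr (h _ (hφ t ht))).symm).trans hs.2⟩
  | neg φ ih => exact ih hφ hs
  | and φ ψ ih ih' => exact ⟨ih hφ.1 hs.1, ih' hφ.2 hs.2⟩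
  | or φ ψ ih ih' => exact ⟨ih hφ.1 hs.1, ih' hφ.2 hs.2⟩

end QF

end Terms

/-! ### Abstraction: flattening preserves solvability. -/

section Lift

variable {σ : Signature.{u}} {P : Type u}

namespace Term

@[simp] theorem head_lift (t : Term σ P) : t.lift.head = Sum.inl t.head := by
  induction t with
  | var x => rfl
  | app f t ih => exact ih

@[simp] theorem eval_lift (M : Model σ) (ρ : P → M.carrier) (ε : ℕ → M.carrier) (t : Term σ P) :
    t.lift.eval M (Sum.elim ρ ε) = t.eval M ρ := by
  induction t with
  | var x => rfl
  | app f t ih => exact congrArg (M.fn f) ih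

@[simp] theorem sortOf_lift (s : P → σ.Srt) (s' : ℕ → σ.Srt) (t : Term σ P) :
    t.lift.sortOf (Sum.elim s s') = t.sortOf s := by
  cases t <;> rfl

@[simp] theorem wellSorted_lift (s : P → σ.Srt) (s' : ℕ → σ.Srt) (t : Term σ P) :
    t.lift.WellSorted (Sum.elim s s') ↔ t.WellSorted s := by
  induction t with
  | var x => exact Iff.rfl
  | app f t ih => simp [lift, WellSorted, ih]

end Term

/-- The flat literal as a quantifier-free formula. -/
def FlatLit.toQF : FlatLit σ P → QF σ (P ⊕ ℕ)
  | .eq a b => .eq a.toTerm b.toTerm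
  | .app f i a => .eq (.app f (.var (Sum.inr i))) a.toTerm
  | .ne a b => .neg (.eq a.toTerm b.toTerm)
  | .pos R as => .rel R (as.map Atm.toTerm)
  | .neg R as => .neg (.rel R (as.map Atm.toTerm))

/-- The variable is a parameter, or an existential variable of index less than `n`. -/
def Below (n : ℕ) (x : P ⊕ ℕ) : Prop := ∀ i, x = Sum.inr i → i < n

theorem Below.mono {m n : ℕ} (h : m ≤ n) {x : P ⊕ ℕ} (hx : Below m x) : Below n x :=
  fun i hi => (hx i hi).trans_le h

@[simp] theorem below_inr {n i : ℕ} : Below n (Sum.inr i : P ⊕ ℕ) ↔ i < n :=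
  ⟨fun h => h i rfl, fun h j hj => by cases hj; exact h⟩

namespace FlatFormula

def WellFormed (psort : P → σ.Srt) (F : FlatFormula σ P) : Prop :=
  ∀ L ∈ F.lits, L.toQF.WellSorted (Sum.elim psort F.exSort) ∧ L.toQF.VarsIn (Below F.exNum)

/-- The values `ε` of the existential variables are well-sorted and satisfy the matrix. -/
def Sat (M : Model σ) (ρ : P → M.carrier) (F : FlatFormula σ P) (ε : ℕ → M.carrier) : Prop :=
  (∀ i < F.exNum, M.sort (ε i) = F.exSort i) ∧
    ∀ L ∈ F.lits, L.toQF.Realize M (Sum.elim ρ ε)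

/-- `F'` extends `F` by fresh existential variables and by literals, and expresses `F ∧ Q`. -/
structure ExtendsBy (psort : P → σ.Srt) (F F' : FlatFormula σ P) (Q : QF σ (P ⊕ ℕ)) : Prop where
  le : F.exNum ≤ F'.exNum
  sort_eq : ∀ i < F.exNum, F'.exSort i = F.exSort i
  lits_subset : ∀ L ∈ F.lits, L ∈ F'.lits
  wf : F'.WellFormed psort
  entails : ∀ (M : Model σ) (ρ : P → M.carrier) (ε : ℕ → M.carrier), F'.Sat M ρ ε →
    Q.Realize M (Sum.elim ρ ε)
  sat : ∀ (M : Model σ) (ρ : P → M.carrier) (ε : ℕ → M.carrier), F.Sat M ρ ε →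
    Q.Realize M (Sum.elim ρ ε) → ∃ ε', F'.Sat M ρ ε' ∧ ∀ i < F.exNum, ε' i = ε i

abbrev Extends (psort : P → σ.Srt) (F F' : FlatFormula σ P) : Prop := ExtendsBy psort F F' .top

variable {psort : P → σ.Srt} {F F' F'' : FlatFormula σ P} {Q Q' : QF σ (P ⊕ ℕ)}

theorem Extends.refl (hF : F.WellFormed psort) : Extends psort F F :=
  ⟨le_rfl, fun _ _ => rfl, fun _ h => h, hF, fun _ _ _ _ h => h,
    fun _ _ ε h _ => ⟨ε, h, fun _ _ => rfl⟩⟩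

theorem ExtendsBy.sat_of_sat (h : ExtendsBy psort F F' Q) {M : Model σ} {ρ : P → M.carrier}
    {ε : ℕ → M.carrier} (hε : F'.Sat M ρ ε) : F.Sat M ρ ε :=
  ⟨fun i hi => (hε.1 i (hi.trans_le h.le)).trans (h.sort_eq i hi),
    fun L hL => hε.2 L (h.lits_subset L hL)⟩

theorem sum_elim_eq_of_below {α : Type*} {ρ : P → α} {ε ε' : ℕ → α} {n : ℕ}
    (h : ∀ i < n, ε' i = ε i) : ∀ x, Below n x → Sum.elim ρ ε' x = Sum.elim ρ ε x := by
  rintro (p | i) hx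
  · rfl
  · exact h i (below_inr.1 hx)

/-- The condition on `Q'` is what makes extensions compose: speaking only of the variables of `F`,
it keeps its truth value when a solution of `F` is changed at the fresh variables of `F'`. -/
theorem ExtendsBy.trans (h : ExtendsBy psort F F' Q) (h' : ExtendsBy psort F' F'' Q')
    (hQ' : Q'.VarsIn (Below F.exNum)) : ExtendsBy psort F F'' (.and Q Q') := by
  refine ⟨h.le.trans h'.le, fun i hi => (h'.sort_eq i (hi.trans_le h.le)).trans (h.sort_eq i hi),
    fun L hL => h'.lits_subset L (h.lits_subset L hL), h'.wf,
    fun M ρ ε hε => ⟨h.entails M ρ ε (h'.sat_of_sat hε), h'.entails M ρ ε hε⟩, ?_⟩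
  intro M ρ ε hε hQ
  obtain ⟨ε', hε', h1⟩ := h.sat M ρ ε hε hQ.1
  obtain ⟨ε'', hε'', h2⟩ := h'.sat M ρ ε' hε'
    ((QF.realize_congr hQ' (sum_elim_eq_of_below h1)).2 hQ.2)
  exact ⟨ε'', hε'', fun i hi => (h2 i (hi.trans_le h.le)).trans (h1 i hi)⟩

theorem ExtendsBy.congr (h : ExtendsBy psort F F' Q)
    (hQ : ∀ (M : Model σ) (ρ : P → M.carrier) (ε : ℕ → M.carrier),
      Q.Realize M (Sum.elim ρ ε) ↔ Q'.Realize M (Sum.elim ρ ε)) : ExtendsBy psort F F' Q' :=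
  ⟨h.le, h.sort_eq, h.lits_subset, h.wf, fun M ρ ε hε => (hQ M ρ ε).1 (h.entails M ρ ε hε),
    fun M ρ ε hε h' => h.sat M ρ ε hε ((hQ M ρ ε).2 h')⟩

theorem Extends.trans (h : Extends psort F F') (h' : Extends psort F' F'') :
    Extends psort F F'' :=
  (ExtendsBy.trans h h' trivial).congr fun M ρ ε => by simp [QF.top, QF.Realize]

/-- Adding a literal which expresses `Q` in all the solutions of `F'`. -/
theorem Extends.add (h : Extends psort F F') {L : FlatLit σ P}
    (hs : L.toQF.WellSorted (Sum.elim psort F'.exSort)) (hv : L.toQF.VarsIn (Below F'.exNum))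
    (hQ' : Q.VarsIn (Below F.exNum))
    (hQ : ∀ (M : Model σ) (ρ : P → M.carrier) (ε : ℕ → M.carrier), F'.Sat M ρ ε →
      (L.toQF.Realize M (Sum.elim ρ ε) ↔ Q.Realize M (Sum.elim ρ ε))) :
    ExtendsBy psort F (F'.add L) Q := by
  refine ⟨h.le, h.sort_eq, fun L hL => List.mem_cons_of_mem _ (h.lits_subset L hL), ?_, ?_, ?_⟩
  · intro L' hL'
    rcases List.mem_cons.1 hL' with rfl | hL'
    · exact ⟨hs, hv⟩
    · exact h.wf L' hL'
  · intro M ρ ε hε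
    exact (hQ M ρ ε ⟨hε.1, fun L hL => hε.2 L (List.mem_cons_of_mem _ hL)⟩).1
      (hε.2 L List.mem_cons_self)
  · intro M ρ ε hε hq
    obtain ⟨ε', hε', h1⟩ := h.sat M ρ ε hε (by simp [QF.top, QF.Realize])
    refine ⟨ε', ⟨hε'.1, fun L' hL' => ?_⟩, h1⟩
    rcases List.mem_cons.1 hL' with rfl | hL'
    · exact (hQ M ρ ε' hε').2 ((QF.realize_congr hQ' (sum_elim_eq_of_below h1)).2 hq)
    · exact hε'.2 L' hL'

/-- The term is well-sorted over the variables of `F`. -/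
def Proper (psort : P → σ.Srt) (F : FlatFormula σ P) (t : Term σ (P ⊕ ℕ)) : Prop :=
  t.WellSorted (Sum.elim psort F.exSort) ∧ Below F.exNum t.head

/-- The term `t'` is well-sorted over the variables of `F` and has the same sort as `t` and, in all
solutions of `F`, the same value as `t`. -/
structure Names (psort : P → σ.Srt) (F : FlatFormula σ P) (t t' : Term σ (P ⊕ ℕ)) : Prop where
  proper : F.Proper psort t'
  sortOf : t'.sortOf (Sum.elim psort F.exSort) = t.sortOf (Sum.elim psort F.exSort)
  eval : ∀ (M : Model σ) (ρ : P → M.carrier) (ε : ℕ → M.carrier), F.Sat M ρ ε →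
    t'.eval M (Sum.elim ρ ε) = t.eval M (Sum.elim ρ ε)

theorem Names.refl {t : Term σ (P ⊕ ℕ)} (ht : F.Proper psort t) : Names psort F t t :=
  ⟨ht, rfl, fun _ _ _ _ => rfl⟩

theorem Names.trans {t t' t'' : Term σ (P ⊕ ℕ)} (h : Names psort F t t')
    (h' : Names psort F t' t'') : Names psort F t t'' :=
  ⟨h'.proper, h'.sortOf.trans h.sortOf, fun M ρ ε hε => (h'.eval M ρ ε hε).trans (h.eval M ρ ε hε)⟩

theorem Names.app {t t' : Term σ (P ⊕ ℕ)} {f : σ.Fn} (h : Names psort F t t')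
    (ht : F.Proper psort (.app f t)) : Names psort F (.app f t) (.app f t') :=
  ⟨⟨⟨h.sortOf.trans ht.1.1, h.proper.1⟩, h.proper.2⟩, rfl,
    fun M ρ ε hε => congrArg (M.fn f) (h.eval M ρ ε hε)⟩

theorem ExtendsBy.sort_eq_of_below (h : ExtendsBy psort F F' Q) :
    ∀ x, Below F.exNum x → Sum.elim psort F'.exSort x = Sum.elim psort F.exSort x :=
  sum_elim_eq_of_below h.sort_eq

theorem ExtendsBy.proper (h : ExtendsBy psort F F' Q) {t : Term σ (P ⊕ ℕ)}
    (ht : F.Proper psort t) : F'.Proper psort t :=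
  ⟨ht.1.congr (h.sort_eq_of_below _ ht.2).symm, ht.2.mono h.le⟩

theorem ExtendsBy.names (h : ExtendsBy psort F F' Q) {t t' : Term σ (P ⊕ ℕ)}
    (ht : F.Proper psort t) (hn : Names psort F t t') : Names psort F' t t' :=
  ⟨h.proper hn.proper, by
    rw [Term.sortOf_congr (h.sort_eq_of_below _ ht.2),
      Term.sortOf_congr (h.sort_eq_of_below _ hn.proper.2), hn.sortOf],
    fun M ρ ε hε => hn.eval M ρ ε (h.sat_of_sat hε)⟩

end FlatFormula

open FlatFormula

variable {psort : P → σ.Srt}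

/-- A solution extends by giving the fresh variable the value of the term that it names. Its index
`F.exNum` occurs in no literal of `F`, so these keep their truth values. -/
theorem nameTerm_spec {F : FlatFormula σ P} (hF : F.WellFormed psort) {t : FlatTerm σ P}
    (ht : F.Proper psort t.toTerm) :
    Extends psort F (nameTerm F t).val.2 ∧
      Names psort (nameTerm F t).val.2 t.toTerm (nameTerm F t).val.1.toTerm := by
  cases t with
  | atm a => exact ⟨Extends.refl hF, Names.refl ht⟩
  | app f i =>
    have hi : i < F.exNum := below_inr.1 ht.2
    have hsort : F.exSort i = σ.dom f := ht.1.1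
    have hup : ∀ j < F.exNum, Function.update F.exSort F.exNum (σ.cod f) j = F.exSort j :=
      fun j hj => Function.update_of_ne hj.ne _ _
    have hE : Extends psort F (nameTerm F (.app f i)).val.2 := by
      refine ⟨Nat.le_succ _, hup, fun L hL => List.mem_cons_of_mem _ hL, ?_,
        fun _ _ _ _ h => h, ?_⟩
      · intro L hL
        rcases List.mem_cons.1 hL with rfl | hL
        · refine ⟨⟨⟨(hup i hi).trans hsort, trivial⟩, trivial, ?_⟩, ?_, ?_⟩
          · exact (Function.update_self F.exNum (σ.cod f) F.exSort).symm
          · exact below_inr.2 (hi.trans (Nat.lt_succ_self _))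
          · exact below_inr.2 (Nat.lt_succ_self _)
        · obtain ⟨h1, h2⟩ := hF L hL
          exact ⟨h1.congr h2 fun x hx => (sum_elim_eq_of_below hup x hx).symm,
            h2.mono fun x hx => hx.mono (Nat.le_succ _)⟩
      · intro M ρ ε hε _
        have hup' : ∀ j < F.exNum, Function.update ε F.exNum (M.fn f (ε i)) j = ε j :=
          fun j hj => Function.update_of_ne hj.ne _ _
        refine ⟨Function.update ε F.exNum (M.fn f (ε i)), ⟨?_, ?_⟩, hup'⟩
        · intro j hj
          rcases Nat.lt_succ_iff_lt_or_eq.1 hj with hj | rfl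
          · exact (congrArg M.sort (hup' j hj)).trans ((hε.1 j hj).trans (hup j hj).symm)
          · refine (congrArg M.sort (Function.update_self F.exNum (M.fn f (ε i)) ε)).trans
              (Eq.trans ?_ (Function.update_self F.exNum (σ.cod f) F.exSort).symm)
            exact M.sort_fn f _ ((hε.1 i hi).trans hsort)
        · intro L hL
          rcases List.mem_cons.1 hL with rfl | hL
          · exact (congrArg (M.fn f) (hup' i hi)).trans
              (Function.update_self F.exNum (M.fn f (ε i)) ε).symm
          · exact (QF.realize_congr (hF L hL).2 (sum_elim_eq_of_below hup')).2 (hε.2 L hL)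
    refine ⟨hE, ⟨trivial, below_inr.2 (Nat.lt_succ_self _)⟩,
      (Function.update_self F.exNum (σ.cod f) F.exSort :), ?_⟩
    intro M ρ ε hε
    exact (hε.2 (.app f i (.ex F.exNum)) List.mem_cons_self).symm

theorem flattenTerm_spec {t : Term σ (P ⊕ ℕ)} {F : FlatFormula σ P} (hF : F.WellFormed psort)
    (ht : F.Proper psort t) :
    Extends psort F (flattenTerm F t).val.2 ∧
      Names psort (flattenTerm F t).val.2 t (flattenTerm F t).val.1.toTerm := by
  induction t with
  | var x => cases x <;> exact ⟨Extends.refl hF, Names.refl ht⟩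
  | app f t ih =>
    have ht' : F.Proper psort t := ⟨ht.1.2, ht.2⟩
    obtain ⟨h1, h2⟩ := ih ht'
    obtain ⟨h3, h4⟩ := nameTerm_spec h1.wf h2.proper
    have h5 := h1.trans h3
    have h6 := ((h3.names (h1.proper ht') h2).trans h4).app (h5.proper ht)
    simp only [flattenTerm, tick_val, bind_val]
    generalize (nameTerm (flattenTerm F t).val.2 (flattenTerm F t).val.1).val = s at *
    obtain ⟨a, F'⟩ := s
    cases a <;> exact ⟨h5, h6⟩

theorem abstractTerm_spec {t : Term σ (P ⊕ ℕ)} {F : FlatFormula σ P} (hF : F.WellFormed psort)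
    (ht : F.Proper psort t) :
    Extends psort F (abstractTerm F t).val.2 ∧
      Names psort (abstractTerm F t).val.2 t (abstractTerm F t).val.1.toTerm := by
  obtain ⟨h1, h2⟩ := flattenTerm_spec hF ht
  obtain ⟨h3, h4⟩ := nameTerm_spec h1.wf h2.proper
  exact ⟨h1.trans h3, (h3.names (h1.proper ht) h2).trans h4⟩

theorem abstractList_spec {ts : List (Term σ (P ⊕ ℕ))} {F : FlatFormula σ P}
    (hF : F.WellFormed psort) (ht : ∀ t ∈ ts, F.Proper psort t) :
    Extends psort F (abstractList F ts).val.2 ∧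
      List.Forall₂ (Names psort (abstractList F ts).val.2) ts
        ((abstractList F ts).val.1.map Atm.toTerm) := by
  induction ts generalizing F with
  | nil => exact ⟨Extends.refl hF, List.Forall₂.nil⟩
  | cons t ts ih =>
    have ht0 := ht t List.mem_cons_self
    obtain ⟨h1, h2⟩ := abstractTerm_spec hF ht0
    obtain ⟨h3, h4⟩ := ih h1.wf fun t' ht' => h1.proper (ht t' (List.mem_cons_of_mem _ ht'))
    exact ⟨h1.trans h3, List.Forall₂.cons (h3.names (h1.proper ht0) h2) h4⟩

namespace FlatFormula

variable {F F' : FlatFormula σ P}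

theorem Names.eqSorted {t₁ t₁' t₂ t₂' : Term σ (P ⊕ ℕ)} (h₁ : Names psort F t₁ t₁')
    (h₂ : Names psort F t₂ t₂')
    (h : t₁.sortOf (Sum.elim psort F.exSort) = t₂.sortOf (Sum.elim psort F.exSort)) :
    EqSorted (Sum.elim psort F.exSort) t₁' t₂' :=
  ⟨h₁.proper.1, h₂.proper.1, h₁.sortOf.trans (h.trans h₂.sortOf.symm)⟩

theorem Names.realize_eq {t₁ t₁' t₂ t₂' : Term σ (P ⊕ ℕ)} (h₁ : Names psort F t₁ t₁')
    (h₂ : Names psort F t₂ t₂') {M : Model σ} {ρ : P → M.carrier} {ε : ℕ → M.carrier}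
    (hε : F.Sat M ρ ε) : (QF.eq t₁' t₂').Realize M (Sum.elim ρ ε) ↔
      (QF.eq t₁ t₂).Realize M (Sum.elim ρ ε) := by
  simp only [QF.Realize, h₁.eval M ρ ε hε, h₂.eval M ρ ε hε]

theorem forall₂_names_relSorted {ts ts' : List (Term σ (P ⊕ ℕ))} {R : σ.Rel}
    (h : List.Forall₂ (Names psort F) ts ts')
    (hs : ts.map (Term.sortOf (Sum.elim psort F.exSort)) = σ.relSorts R) :
    RelSorted (Sum.elim psort F.exSort) R ts' ∧ ∀ t' ∈ ts', Below F.exNum t'.head := by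
  refine ⟨⟨?_, ?_⟩, ?_⟩
  · clear hs
    induction h with
    | nil => simp
    | cons h _ ih => simpa using ⟨h.proper.1, ih⟩
  · rw [← hs]
    clear hs
    induction h with
    | nil => rfl
    | cons h _ ih => simp [h.sortOf, ih]
  · clear hs
    induction h with
    | nil => simp
    | cons h _ ih => simpa using ⟨h.proper.2, ih⟩

theorem forall₂_names_eval {ts ts' : List (Term σ (P ⊕ ℕ))}
    (h : List.Forall₂ (Names psort F) ts ts') {M : Model σ} {ρ : P → M.carrier}
    {ε : ℕ → M.carrier} (hε : F.Sat M ρ ε) :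
    ts'.map (Term.eval M (Sum.elim ρ ε)) = ts.map (Term.eval M (Sum.elim ρ ε)) := by
  induction h with
  | nil => rfl
  | cons h _ ih => simp [h.eval M ρ ε hε, ih]

theorem ExtendsBy.sortOf_eq {Q : QF σ (P ⊕ ℕ)} (h : ExtendsBy psort F F' Q) {t : Term σ (P ⊕ ℕ)}
    (ht : Below F.exNum t.head) :
    t.sortOf (Sum.elim psort F'.exSort) = t.sortOf (Sum.elim psort F.exSort) :=
  Term.sortOf_congr (h.sort_eq_of_below _ ht)

theorem relSorted_of_extends {Q : QF σ (P ⊕ ℕ)} (h : ExtendsBy psort F F' Q)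
    {ts : List (Term σ (P ⊕ ℕ))} {R : σ.Rel} (hv : ∀ t ∈ ts, Below F.exNum t.head)
    (hs : RelSorted (Sum.elim psort F.exSort) R ts) :
    ts.map (Term.sortOf (Sum.elim psort F'.exSort)) = σ.relSorts R :=
  (List.map_congr_left fun t ht => h.sortOf_eq (hv t ht)).trans hs.2

end FlatFormula

theorem flattenLit_spec {L : Literal σ (P ⊕ ℕ)} {F : FlatFormula σ P} (hF : F.WellFormed psort)
    (hs : L.toQF.WellSorted (Sum.elim psort F.exSort)) (hv : L.toQF.VarsIn (Below F.exNum)) :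
    ExtendsBy psort F (flattenLit F L).val L.toQF := by
  cases L with
  | eq t t' =>
    have ht : F.Proper psort t := ⟨hs.1, hv.1⟩
    have ht' : F.Proper psort t' := ⟨hs.2.1, hv.2⟩
    obtain ⟨h1, h2⟩ := flattenTerm_spec hF ht
    obtain ⟨h3, h4⟩ := flattenTerm_spec h1.wf (h1.proper ht')
    have h5 := h1.trans h3
    have h6 := h3.names (h1.proper ht) h2
    -- Both orientations are needed: when only the right side flattens to `g(e_j)`, the literal is
    -- stored with its sides exchanged.
    have key : ∀ (F' : FlatFormula σ P) (u u' : Term σ (P ⊕ ℕ)), Extends psort F F' →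
        Names psort F' t u → Names psort F' t' u' →
        EqSorted (Sum.elim psort F'.exSort) u u' ∧ EqSorted (Sum.elim psort F'.exSort) u' u := by
      intro F' u u' hE hu hu'
      have h7 := hu.eqSorted hu' (by rw [hE.sortOf_eq hv.1, hE.sortOf_eq hv.2]; exact hs.2.2)
      exact ⟨h7, h7.2.1, h7.1, h7.2.2.symm⟩
    simp only [flattenLit, bind_val]
    have hn := nameTerm_spec h3.wf h4.proper
    generalize (flattenTerm F t).val = r at *
    generalize (flattenTerm r.2 t').val = s at *
    obtain ⟨r, F₁⟩ := r
    obtain ⟨s, F₂⟩ := s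
    cases r with
    | atm a =>
      cases s with
      | atm b =>
        exact h5.add (key _ _ _ h5 h6 h4).1 ⟨h6.proper.2, h4.proper.2⟩ hv
          fun M ρ ε hε => h6.realize_eq h4 hε
      | app g j =>
        exact h5.add (key _ _ _ h5 h6 h4).2 ⟨h4.proper.2, h6.proper.2⟩ hv
          fun M ρ ε hε => (h4.realize_eq h6 hε).trans eq_comm
    | app f i =>
      cases s with
      | atm b =>
        exact h5.add (key _ _ _ h5 h6 h4).1 ⟨h6.proper.2, h4.proper.2⟩ hv
          fun M ρ ε hε => h6.realize_eq h4 hε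
      | app g j =>
        have h7 := hn.1.names (h5.proper ht) h6
        have h8 := (hn.1.names (h5.proper ht') h4).trans hn.2
        have h9 := h5.trans hn.1
        exact h9.add (key _ _ _ h9 h7 h8).1 ⟨h7.proper.2, h8.proper.2⟩ hv
          fun M ρ ε hε => h7.realize_eq h8 hε
  | ne t t' =>
    have ht : F.Proper psort t := ⟨hs.1, hv.1⟩
    have ht' : F.Proper psort t' := ⟨hs.2.1, hv.2⟩
    obtain ⟨h1, h2⟩ := abstractTerm_spec hF ht
    obtain ⟨h3, h4⟩ := abstractTerm_spec h1.wf (h1.proper ht')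
    have h5 := h1.trans h3
    have h6 := h3.names (h1.proper ht) h2
    exact h5.add (h6.eqSorted h4 (by rw [h5.sortOf_eq hv.1, h5.sortOf_eq hv.2]; exact hs.2.2))
      ⟨h6.proper.2, h4.proper.2⟩ hv fun M ρ ε hε => not_congr (h6.realize_eq h4 hε)
  | pos R ts =>
    obtain ⟨h1, h2⟩ := abstractList_spec hF fun t ht => ⟨hs.1 t ht, hv t ht⟩
    obtain ⟨h3, h4⟩ := forall₂_names_relSorted h2 (relSorted_of_extends h1 hv hs)
    exact h1.add h3 h4 hv fun M ρ ε hε => by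
      simp only [FlatLit.toQF, Literal.toQF, QF.Realize, forall₂_names_eval h2 hε]
  | neg R ts =>
    obtain ⟨h1, h2⟩ := abstractList_spec hF fun t ht => ⟨hs.1 t ht, hv t ht⟩
    obtain ⟨h3, h4⟩ := forall₂_names_relSorted h2 (relSorted_of_extends h1 hv hs)
    exact h1.add h3 h4 hv fun M ρ ε hε => by
      simp only [FlatLit.toQF, Literal.toQF, QF.Realize, forall₂_names_eval h2 hε]

/-- The conjunction of a list of formulas. -/
def conjunction (l : List (QF σ (P ⊕ ℕ))) : QF σ (P ⊕ ℕ) := l.foldr .and .top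

theorem realize_conjunction {M : Model σ} {v : P ⊕ ℕ → M.carrier} {l : List (QF σ (P ⊕ ℕ))} :
    (conjunction l).Realize M v ↔ ∀ q ∈ l, q.Realize M v := by
  induction l with
  | nil => simp [conjunction, QF.top, QF.Realize]
  | cons q l ih =>
    simp only [List.mem_cons, forall_eq_or_imp, ← ih]
    exact Iff.rfl

theorem varsIn_conjunction {p : P ⊕ ℕ → Prop} {l : List (QF σ (P ⊕ ℕ))}
    (h : ∀ q ∈ l, q.VarsIn p) : (conjunction l).VarsIn p := by
  induction l with
  | nil => trivial
  | cons q l ih =>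
    exact ⟨h q List.mem_cons_self, ih fun q' hq' => h q' (List.mem_cons_of_mem _ hq')⟩

theorem loop_flattenLit_spec {ls : List (Literal σ (P ⊕ ℕ))} {F : FlatFormula σ P}
    (hF : F.WellFormed psort)
    (h : ∀ L ∈ ls, L.toQF.WellSorted (Sum.elim psort F.exSort) ∧
      L.toQF.VarsIn (Below F.exNum)) :
    ExtendsBy psort F (loop flattenLit F ls).val (conjunction (ls.map Literal.toQF)) := by
  induction ls generalizing F with
  | nil => exact Extends.refl hF
  | cons L ls ih =>
    have h0 := h L List.mem_cons_self
    have h1 := flattenLit_spec hF h0.1 h0.2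
    have h' : ∀ L' ∈ ls, L'.toQF.VarsIn (Below F.exNum) :=
      fun L' hL' => (h L' (List.mem_cons_of_mem _ hL')).2
    have h2 := ih h1.wf fun L' hL' =>
      ⟨(h L' (List.mem_cons_of_mem _ hL')).1.congr (h' L' hL')
        fun x hx => (h1.sort_eq_of_below x hx).symm,
        (h' L' hL').mono fun x hx => hx.mono h1.le⟩
    exact h1.trans h2 (varsIn_conjunction (by simpa using h'))

theorem flatten_spec {φ : Primitive σ P} (h : φ.WellFormed psort) :
    (flatten φ).val.WellFormed psort ∧ ∀ (M : Model σ) (ρ : P → M.carrier),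
      φ.Realize M ρ ↔ ∃ ε, (flatten φ).val.Sat M ρ ε := by
  have h0 : ExtendsBy psort ⟨φ.exNum, φ.exSort, []⟩ (flatten φ).val
    (conjunction (φ.lits.map Literal.toQF)) := loop_flattenLit_spec (by simp [WellFormed]) h
  refine ⟨h0.wf, fun M ρ => ⟨?_, ?_⟩⟩
  · rintro ⟨ε, h1, h2⟩
    obtain ⟨ε', h3, -⟩ := h0.sat M ρ ε ⟨h1, by simp⟩ (realize_conjunction.2 (by simpa using h2))
    exact ⟨ε', h3⟩
  · rintro ⟨ε, h1⟩
    exact ⟨ε, (h0.sat_of_sat h1).1, by simpa using realize_conjunction.1 (h0.entails M ρ ε h1)⟩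

end Lift

/-! ### Loops that accumulate a list or a measure. -/

namespace Timed

variable {α : Type v} {β : Type w}

theorem mem_loop {γ : Type*} {body : List γ → α → Timed (List γ)} {R : α → γ → Prop}
    {S : List γ} {l : List α}
    (h : ∀ S, ∀ x ∈ l, ∀ y, y ∈ (body S x).val ↔ y ∈ S ∨ R x y) (y : γ) :
    y ∈ (loop body S l).val ↔ y ∈ S ∨ ∃ x ∈ l, R x y := by
  induction l generalizing S with
  | nil => simp
  | cons x l ih =>
    rw [loop_cons_val, ih fun S y hy => h S y (List.mem_cons_of_mem _ hy),
      h S x List.mem_cons_self]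
    simp [or_assoc]

theorem loop_measure_le {body : β → α → Timed β} (f : β → ℕ) (g : α → ℕ) {b : β} {l : List α}
    (h : ∀ b, ∀ x ∈ l, f (body b x).val ≤ f b + g x) :
    f (loop body b l).val ≤ f b + (l.map g).sum := by
  induction l generalizing b with
  | nil => simp
  | cons x l ih =>
    have h1 := ih (b := (body b x).val) fun b y hy => h b y (List.mem_cons_of_mem _ hy)
    have h2 := h b x List.mem_cons_self
    simp only [loop_cons_val, List.map_cons, List.sum_cons]
    omega

end Timed

/-! ### Congruence closure: invariant, and the effect of one merge. -/

section CongruenceClosure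

variable {σ : Signature.{u}} {P : Type u}

def Atm.size : Atm σ P → ℕ
  | .ex _ => 1
  | .free t => t.size

theorem Atm.one_le_size (a : Atm σ P) : 1 ≤ a.size := by
  cases a with
  | ex i => exact le_rfl
  | free t => exact t.one_le_size

def FlatLit.size : FlatLit σ P → ℕ
  | .eq a b => a.size + b.size + 1
  | .app _ _ a => a.size + 2
  | .ne a b => a.size + b.size + 1
  | .pos _ as => (as.map Atm.size).sum + 1
  | .neg _ as => (as.map Atm.size).sum + 1

theorem FlatLit.one_le_size (L : FlatLit σ P) : 1 ≤ L.size := by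
  cases L <;> simp only [size] <;> omega

/-- Equations, including those of the form `f(e_i) = a`. -/
def FlatLit.IsEquation : FlatLit σ P → Prop
  | .eq _ _ => True
  | .app _ _ _ => True
  | _ => False

section FindFn

variable [DecidableEq σ.Fn]

theorem findFn_some {f : σ.Fn} {l : List (σ.Fn × Atm σ P)} {b : Atm σ P}
    (h : (findFn f l).val = some b) : (f, b) ∈ l := by
  induction l with
  | nil => cases h
  | cons x l ih =>
    obtain ⟨g, a⟩ := x
    by_cases hf : f = g
    · subst hf
      simp only [findFn, if_true, tick_val, ret_val, Option.some.injEq] at h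
      simp [h]
    · simp only [findFn, hf, if_false, tick_val] at h
      exact List.mem_cons_of_mem _ (ih h)

theorem findFn_none {f : σ.Fn} {l : List (σ.Fn × Atm σ P)}
    (h : (findFn f l).val = none) : ∀ x ∈ l, f ≠ x.1 := by
  induction l with
  | nil => simp
  | cons x l ih =>
    obtain ⟨g, a⟩ := x
    by_cases hf : f = g
    · subst hf
      simp [findFn] at h
    · simp only [findFn, hf, if_false, tick_val] at h
      intro x hx
      rcases List.mem_cons.1 hx with rfl | hx
      · exact hf
      · exact ih h x hx

theorem findFn_cost (f : σ.Fn) (l : List (σ.Fn × Atm σ P)) :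
    (findFn f l).cost ≤ l.length + 1 := by
  induction l with
  | nil => simp [findFn]
  | cons x l ih =>
    obtain ⟨g, a⟩ := x
    by_cases hf : f = g
    · simp [findFn, hf]
    · simp only [findFn, hf, if_false, tick_cost, List.length_cons]
      omega

/-- The body of the loop of `mergeClasses`. -/
def mergeBody (B : List (σ.Fn × Atm σ P))
    (s : List (σ.Fn × Atm σ P) × List (Atm σ P × Atm σ P)) (x : σ.Fn × Atm σ P) :
    Timed (List (σ.Fn × Atm σ P) × List (Atm σ P × Atm σ P)) :=
  (findFn x.1 B).bind fun r =>
    match r with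
    | some b => ret (s.1, (x.2, b) :: s.2)
    | none => ret (x :: s.1, s.2)

theorem mergeBody_cases (B : List (σ.Fn × Atm σ P))
    (s : List (σ.Fn × Atm σ P) × List (Atm σ P × Atm σ P)) (x : σ.Fn × Atm σ P) :
    (∃ b, (x.1, b) ∈ B ∧ (mergeBody B s x).val = (s.1, (x.2, b) :: s.2)) ∨
      (∀ y ∈ B, x.1 ≠ y.1) ∧ (mergeBody B s x).val = (x :: s.1, s.2) := by
  simp only [mergeBody, bind_val]
  cases h : (findFn x.1 B).val with
  | some b => exact Or.inl ⟨b, findFn_some h, rfl⟩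
  | none => exact Or.inr ⟨findFn_none h, rfl⟩

theorem mergeBody_cost (B : List (σ.Fn × Atm σ P))
    (s : List (σ.Fn × Atm σ P) × List (Atm σ P × Atm σ P)) (x : σ.Fn × Atm σ P) :
    (mergeBody B s x).cost ≤ B.length + 1 := by
  have := findFn_cost x.1 B
  simp only [mergeBody, bind_cost]
  cases (findFn x.1 B).val <;> simpa using this

/-- The relation between the values of `s` before and after the loop of `mergeClasses`. -/
structure MergeSpec (B L : List (σ.Fn × Atm σ P))
    (s s' : List (σ.Fn × Atm σ P) × List (Atm σ P × Atm σ P)) : Prop where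
  subset₁ : ∀ y ∈ s.1, y ∈ s'.1
  subset₂ : ∀ y ∈ s.2, y ∈ s'.2
  mem₁ : ∀ y ∈ s'.1, y ∈ s.1 ∨ y ∈ L
  mem₂ : ∀ y ∈ s'.2, y ∈ s.2 ∨ ∃ f, (f, y.1) ∈ L ∧ (f, y.2) ∈ B
  cover : ∀ x ∈ L, x ∈ s'.1 ∨ ∃ b, (x.1, b) ∈ B ∧ (x.2, b) ∈ s'.2
  length : s'.1.length + s'.2.length = s.1.length + s.2.length + L.length
  length₂ : s.2.length ≤ s'.2.length

theorem mergeSpec_loop (B L : List (σ.Fn × Atm σ P))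
    (s : List (σ.Fn × Atm σ P) × List (Atm σ P × Atm σ P)) :
    MergeSpec B L s (loop (mergeBody B) s L).val := by
  induction L generalizing s with
  | nil => constructor <;> simp +contextual
  | cons x L ih =>
    have h := ih (mergeBody B s x).val
    rw [loop_cons_val]
    generalize (loop (mergeBody B) (mergeBody B s x).val L).val = s' at h ⊢
    rcases mergeBody_cases B s x with ⟨b, hb, hv⟩ | ⟨hb, hv⟩ <;> rw [hv] at h
    · obtain ⟨h1, h2, h3, h4, h5, h6, h7⟩ := h
      refine ⟨h1, fun y hy => h2 y (List.mem_cons_of_mem _ hy), ?_, ?_, ?_, ?_, ?_⟩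
      · exact fun y hy => (h3 y hy).imp_right (List.mem_cons_of_mem _)
      · intro y hy
        rcases h4 y hy with hy | ⟨f, hf, hf'⟩
        · rcases List.mem_cons.1 hy with rfl | hy
          · exact Or.inr ⟨x.1, List.mem_cons_self, hb⟩
          · exact Or.inl hy
        · exact Or.inr ⟨f, List.mem_cons_of_mem _ hf, hf'⟩
      · intro y hy
        rcases List.mem_cons.1 hy with rfl | hy
        · exact Or.inr ⟨b, hb, h2 _ List.mem_cons_self⟩
        · exact h5 y hy
      · simp only [List.length_cons] at h6 ⊢; omega
      · simp only [List.length_cons] at h7; omega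
    · obtain ⟨h1, h2, h3, h4, h5, h6, h7⟩ := h
      refine ⟨fun y hy => h1 y (List.mem_cons_of_mem _ hy), h2, ?_, ?_, ?_, ?_, h7⟩
      · intro y hy
        rcases h3 y hy with hy | hy
        · rcases List.mem_cons.1 hy with rfl | hy
          · exact Or.inr List.mem_cons_self
          · exact Or.inl hy
        · exact Or.inr (List.mem_cons_of_mem _ hy)
      · intro y hy
        exact (h4 y hy).imp_right fun ⟨f, hf, hf'⟩ => ⟨f, List.mem_cons_of_mem _ hf, hf'⟩
      · intro y hy
        rcases List.mem_cons.1 hy with rfl | hy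
        · exact Or.inl (h1 _ List.mem_cons_self)
        · exact h5 y hy
      · simp only [List.length_cons] at h6 ⊢; omega

/-- Lookups are made in the fixed list `B`, not in the growing accumulator. This suffices: every
accumulator entry sharing a symbol with the rest of `L` must share it with `B` as well, and
inserting entries of `L` preserves this because the symbols of `L` are distinct. -/
theorem pairwise_loop_mergeBody {B L : List (σ.Fn × Atm σ P)}
    {s : List (σ.Fn × Atm σ P) × List (Atm σ P × Atm σ P)}
    (hs : s.1.Pairwise (fun x y => x.1 ≠ y.1)) (hL : L.Pairwise (fun x y => x.1 ≠ y.1))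
    (h : ∀ x ∈ L, ∀ y ∈ s.1, x.1 = y.1 → ∃ z ∈ B, x.1 = z.1) :
    (loop (mergeBody B) s L).val.1.Pairwise (fun x y => x.1 ≠ y.1) := by
  induction L generalizing s with
  | nil => exact hs
  | cons x L ih =>
    rw [loop_cons_val]
    rw [List.pairwise_cons] at hL
    rcases mergeBody_cases B s x with ⟨b, hb, hv⟩ | ⟨hb, hv⟩ <;> rw [hv]
    · exact ih hs hL.2 fun y hy => h y (List.mem_cons_of_mem _ hy)
    · refine ih (List.pairwise_cons.2 ⟨?_, hs⟩) hL.2 ?_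
      · intro y hy hxy
        obtain ⟨z, hz, hxz⟩ := h x List.mem_cons_self y hy hxy
        exact hb z hz hxz
      · intro y hy z hz hyz
        rcases List.mem_cons.1 hz with rfl | hz
        · exact absurd hyz.symm (hL.1 y hy)
        · exact h y (List.mem_cons_of_mem _ hy) z hz hyz

/-- Each entry of the absorbed bucket is looked up in the other one, whence the product; `N` is the
pass over the array of representatives. -/
theorem mergeClasses_cost (N l k : ℕ) (c : Closure σ P) :
    (mergeClasses N l k c).cost ≤
      (c.bucket l).length * (c.bucket k).length + 2 * (c.bucket l).length + 1 + N := by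
  have h := loop_cost_le (body := mergeBody (c.bucket k)) (b := (c.bucket k, c.todo))
    (l := c.bucket l) (fun _ => (c.bucket k).length + 1) fun b x _ => mergeBody_cost _ b x
  have h' : (mergeClasses N l k c).cost =
    (loop (mergeBody (c.bucket k)) (c.bucket k, c.todo) (c.bucket l)).cost + (N + 0) := rfl
  simp only [List.map_const', List.sum_replicate, smul_eq_mul] at h
  rw [h']
  nlinarith

end FindFn

namespace Closure

/-- The equations stored in the closure hold under the assignment `v`. -/
structure Holds (M : Model σ) (v : P ⊕ ℕ → M.carrier) (c : Closure σ P) : Prop where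
  rep : ∀ i, v (Sum.inr i) = v (Sum.inr (c.rep i))
  bucket : ∀ i, ∀ x ∈ c.bucket i, (FlatLit.app x.1 i x.2).toQF.Realize M v
  todo : ∀ x ∈ c.todo, (FlatLit.eq x.1 x.2).toQF.Realize M v
  eqs : ∀ x ∈ c.eqs, (FlatLit.eq x.1 x.2).toQF.Realize M v

end Closure

/-- The literal is well-sorted over the first `N` existential variables. -/
def FlatLit.Good (psort : P → σ.Srt) (s : ℕ → σ.Srt) (N : ℕ) (L : FlatLit σ P) : Prop :=
  L.toQF.WellSorted (Sum.elim psort s) ∧ L.toQF.VarsIn (Below N)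

/-- The number of entries of the buckets. -/
def Closure.entries (N : ℕ) (c : Closure σ P) : ℕ := ∑ i ∈ Finset.range N, (c.bucket i).length

/-- The sum of the squares of the lengths of the buckets. -/
def Closure.squares (N : ℕ) (c : Closure σ P) : ℕ :=
  ∑ i ∈ Finset.range N, (c.bucket i).length ^ 2

/-- The invariant of the congruence closure: well-sortedness, the normal form of the representatives
and of the buckets, equivalence to the condition `H`, and bounds for the sizes. -/
structure Closure.Inv (psort : P → σ.Srt) (s : ℕ → σ.Srt) (N : ℕ)
    (H : ∀ M : Model σ, (P ⊕ ℕ → M.carrier) → Prop) (B E : ℕ) (c : Closure σ P) : Prop where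
  good_rep : ∀ i < N, (FlatLit.eq (.ex i) (.ex (c.rep i)) : FlatLit σ P).Good psort s N
  good_bucket : ∀ i, ∀ x ∈ c.bucket i, (FlatLit.app x.1 i x.2).Good psort s N
  good_todo : ∀ x ∈ c.todo, (FlatLit.eq x.1 x.2).Good psort s N
  good_eqs : ∀ x ∈ c.eqs, (FlatLit.eq x.1 x.2).Good psort s N
  rep_le : ∀ i, c.rep i ≤ i
  rep_rep : ∀ i, c.rep (c.rep i) = c.rep i
  rep_of_le : ∀ i, N ≤ i → c.rep i = i
  rep_of_bucket : ∀ i, ∀ x ∈ c.bucket i, c.rep i = i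
  pairwise : ∀ i, (c.bucket i).Pairwise (fun x y => x.1 ≠ y.1)
  eqs_free : ∀ x ∈ c.eqs, (∃ t, x.1 = .free t) ∨ ∃ t, x.2 = .free t
  holds : ∀ (M : Model σ) v, c.Holds M v ↔ H M v
  size_bucket : ∀ i, ∀ x ∈ c.bucket i, x.2.size ≤ B
  size_todo : ∀ x ∈ c.todo, x.1.size ≤ B ∧ x.2.size ≤ B
  size_eqs : ∀ x ∈ c.eqs, x.1.size ≤ B ∧ x.2.size ≤ B
  count : c.eqs.length + c.todo.length + c.entries N ≤ E

theorem FlatLit.good_ex_eq_ex {psort : P → σ.Srt} {s : ℕ → σ.Srt} {N i j : ℕ} :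
    (FlatLit.eq (.ex i) (.ex j) : FlatLit σ P).Good psort s N ↔ s i = s j ∧ i < N ∧ j < N := by
  simp [Good, toQF, QF.WellSorted, QF.VarsIn, EqSorted, Term.WellSorted, Atm.toTerm,
    Term.sortOf, Term.head]

theorem FlatLit.good_app {psort : P → σ.Srt} {s : ℕ → σ.Srt} {N i : ℕ} {f : σ.Fn} {a : Atm σ P} :
    (FlatLit.app f i a).Good psort s N ↔ s i = σ.dom f ∧ i < N ∧
      a.toTerm.WellSorted (Sum.elim psort s) ∧ a.toTerm.sortOf (Sum.elim psort s) = σ.cod f ∧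
      Below N a.toTerm.head := by
  simp only [Good, toQF, QF.WellSorted, QF.VarsIn, EqSorted, Term.WellSorted, Term.head,
    Term.sortOf, below_inr, Sum.elim_inr, and_true]
  tauto

theorem sum_range_eq_add_add {N l k : ℕ} (hl : l < N) (hk : k < N) (h : l ≠ k) (f : ℕ → ℕ) :
    ∑ i ∈ Finset.range N, f i =
      f l + (f k + ∑ i ∈ ((Finset.range N).erase l).erase k, f i) := by
  rw [Finset.add_sum_erase _ f (Finset.mem_erase.2 ⟨h.symm, Finset.mem_range.2 hk⟩),
    Finset.add_sum_erase _ f (Finset.mem_range.2 hl)]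

section Merge

variable {psort : P → σ.Srt} {s : ℕ → σ.Srt} {N : ℕ}
  {H : ∀ M : Model σ, (P ⊕ ℕ → M.carrier) → Prop} {B E : ℕ}

/-- The closure after merging two classes, `t` being the result of the inner loop. -/
def mergedClosure (l k : ℕ) (c : Closure σ P)
    (t : List (σ.Fn × Atm σ P) × List (Atm σ P × Atm σ P)) : Closure σ P :=
  { rep := fun i => if c.rep i = l then k else c.rep i
    bucket := Function.update (Function.update c.bucket l []) k t.1
    todo := t.2
    eqs := c.eqs }

theorem mergedClosure_bucket_cases {l k : ℕ} {c : Closure σ P} (hkl : k ≠ l)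
    {t : List (σ.Fn × Atm σ P) × List (Atm σ P × Atm σ P)}
    (i : ℕ) : (i = k ∧ (mergedClosure l k c t).bucket i = t.1) ∨
      (i = l ∧ (mergedClosure l k c t).bucket i = []) ∨
      (i ≠ k ∧ i ≠ l ∧ (mergedClosure l k c t).bucket i = c.bucket i) := by
  by_cases hk : i = k
  · subst hk
    exact Or.inl ⟨rfl, Function.update_self ..⟩
  · by_cases hl : i = l
    · subst hl
      refine Or.inr (Or.inl ⟨rfl, ?_⟩)
      simp [mergedClosure, hk]
    · refine Or.inr (Or.inr ⟨hk, hl, ?_⟩)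
      simp [mergedClosure, hk, hl]

/-- An entry of the absorbed bucket is either moved or exchanged for one new equation, so the number
of entries and pending equations is unchanged. The last conjunct is the amortization: two formerly
separate buckets become one, and the potential falls by at least the product of their lengths. -/
theorem mergedClosure_measure {l k : ℕ} {c : Closure σ P} (hl : l < N) (hk : k < N) (hkl : k < l)
    {t : List (σ.Fn × Atm σ P) × List (Atm σ P × Atm σ P)}
    (ht : MergeSpec (c.bucket k) (c.bucket l) (c.bucket k, c.todo) t) :
    (mergedClosure l k c t).todo.length + (mergedClosure l k c t).entries N =
        c.todo.length + c.entries N ∧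
      (mergedClosure l k c t).entries N ≤ c.entries N ∧
      (c.bucket l).length ≤ c.entries N ∧
      ((c.bucket l).length * (c.bucket k).length : ℤ) +
        (((mergedClosure l k c t).entries N : ℤ) ^ 2 - (mergedClosure l k c t).squares N) ≤
        (c.entries N : ℤ) ^ 2 - c.squares N := by
  have hb := fun i => mergedClosure_bucket_cases (l := l) (k := k) (c := c) hkl.ne (t := t) i
  have e1 : (mergedClosure l k c t).bucket k = t.1 := by
    rcases hb k with h | h | h
    · exact h.2
    · exact absurd h.1 hkl.ne
    · exact absurd rfl h.1
  have e2 : (mergedClosure l k c t).bucket l = [] := by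
    rcases hb l with h | h | h
    · exact absurd h.1 hkl.ne'
    · exact h.2
    · exact absurd rfl h.2.1
  have e3 : ∀ g : List (σ.Fn × Atm σ P) → ℕ,
      ∑ i ∈ ((Finset.range N).erase l).erase k, g ((mergedClosure l k c t).bucket i) =
        ∑ i ∈ ((Finset.range N).erase l).erase k, g (c.bucket i) := by
    intro g
    refine Finset.sum_congr rfl fun i hi => ?_
    rw [Finset.mem_erase, Finset.mem_erase] at hi
    rcases hb i with h | h | h
    · exact absurd h.1 hi.1
    · exact absurd h.1 hi.2.1
    · rw [h.2.2]
  have h1 := sum_range_eq_add_add hl hk hkl.ne' fun i =>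
    ((mergedClosure l k c t).bucket i).length
  have h2 := sum_range_eq_add_add hl hk hkl.ne' fun i => (c.bucket i).length
  have h3 := sum_range_eq_add_add hl hk hkl.ne' fun i =>
    ((mergedClosure l k c t).bucket i).length ^ 2
  have h4 := sum_range_eq_add_add hl hk hkl.ne' fun i => (c.bucket i).length ^ 2
  rw [e3 List.length, e1, e2] at h1
  rw [e3 fun x => x.length ^ 2, e1, e2] at h3
  have e4 : (mergedClosure l k c t).todo = t.2 := rfl
  rw [Closure.entries, Closure.entries, Closure.squares, Closure.squares, h1, h2, h3, h4, e4]
  have h5 := ht.length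
  have h6 := ht.length₂
  simp only at h5 h6
  obtain ⟨r, hr⟩ := Nat.exists_eq_add_of_le h6
  generalize ∑ i ∈ ((Finset.range N).erase l).erase k, (c.bucket i).length = X
  generalize ∑ i ∈ ((Finset.range N).erase l).erase k, (c.bucket i).length ^ 2 = Y
  have h7 : t.1.length + r = (c.bucket k).length + (c.bucket l).length := by omega
  simp only [List.length_nil]
  refine ⟨by omega, by omega, by omega, ?_⟩
  generalize (c.bucket l).length = bl at *
  generalize (c.bucket k).length = bk at *
  -- Here `r` is the number of deduced equations, and `X`, `Y` are the sums of lengths and of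
  -- squares over the other buckets. The potential drops by exactly `2 * bl * bk + 2 * r * X`.
  have h8 : (t.1.length : ℤ) = bk + bl - r := by omega
  push_cast
  rw [h8]
  have h9 : (0 : ℤ) ≤ bl * bk := by positivity
  have h10 : (0 : ℤ) ≤ r * X := by positivity
  nlinarith

/-- Merging loses no information: the new representative of `l` records `e_l = e_k`, which yields
the processed equation, and an entry `f(e_l) = a` that was not moved is recovered from `f(e_k) = b`
and the deduced `a = b`. The smaller index survives, so `rep i ≤ i` is kept. -/
theorem mergedClosure_inv {l k i j : ℕ} {c : Closure σ P} {todo : List (Atm σ P × Atm σ P)}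
    (hc : c.Inv psort s N H B E) (htodo : c.todo = (.ex i, .ex j) :: todo)
    (hkl : k < l) (hij : (c.rep i = l ∧ c.rep j = k) ∨ (c.rep i = k ∧ c.rep j = l))
    {t : List (σ.Fn × Atm σ P) × List (Atm σ P × Atm σ P)}
    (ht : MergeSpec (c.bucket k) (c.bucket l) (c.bucket k, todo) t)
    (hp : t.1.Pairwise fun x y => x.1 ≠ y.1) :
    (mergedClosure l k { c with todo := todo } t).Inv psort s N H B E := by
  have hmem : ((.ex i, .ex j) : Atm σ P × Atm σ P) ∈ c.todo := by rw [htodo]; simp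
  have hsub : ∀ x ∈ todo, x ∈ c.todo := fun x hx => by rw [htodo]; exact List.mem_cons_of_mem _ hx
  obtain ⟨g1, g2, g3⟩ := FlatLit.good_ex_eq_ex.1 (hc.good_todo _ hmem)
  obtain ⟨g4, -, g5⟩ := FlatLit.good_ex_eq_ex.1 (hc.good_rep i g2)
  obtain ⟨g6, -, g7⟩ := FlatLit.good_ex_eq_ex.1 (hc.good_rep j g3)
  have hlN : l < N := by rcases hij with h | h <;> omega
  have hkN : k < N := by omega
  have hrl : c.rep l = l := by
    rcases hij with h | h
    · rw [← h.1]; exact hc.rep_rep i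
    · rw [← h.2]; exact hc.rep_rep j
  have hrk : c.rep k = k := by
    rcases hij with h | h
    · rw [← h.2]; exact hc.rep_rep j
    · rw [← h.1]; exact hc.rep_rep i
  have hslk : s l = s k := by
    rcases hij with ⟨h, h'⟩ | ⟨h, h'⟩ <;> rw [h] at g4 <;> rw [h'] at g6
    · rw [← g4, ← g6, g1]
    · rw [← g4, ← g6, g1]
  have hb := fun x => mergedClosure_bucket_cases (l := l) (k := k)
    (c := { c with todo := todo }) hkl.ne (t := t) x
  have hrep : ∀ x, (mergedClosure l k { c with todo := todo } t).rep x =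
    if c.rep x = l then k else c.rep x := fun x => rfl
  have hbk : ∀ x y, y ∈ (mergedClosure l k { c with todo := todo } t).bucket x →
      y ∈ c.bucket x ∨ (x = k ∧ y ∈ c.bucket l) := by
    intro x y hy
    rcases hb x with ⟨rfl, h⟩ | ⟨rfl, h⟩ | ⟨_, _, h⟩ <;> rw [h] at hy
    · exact (ht.mem₁ y hy).imp_right fun h => ⟨rfl, h⟩
    · cases hy
    · exact Or.inl hy
  refine ⟨?_, ?_, ?_, hc.good_eqs, ?_, ?_, ?_, ?_, ?_, hc.eqs_free, ?_, ?_, ?_, hc.size_eqs, ?_⟩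
  · intro x hx
    obtain ⟨h1, h2, h3⟩ := FlatLit.good_ex_eq_ex.1 (hc.good_rep x hx)
    rw [hrep]
    split_ifs with h
    · exact FlatLit.good_ex_eq_ex.2 ⟨by rw [h1, h, hslk], hx, hkN⟩
    · exact FlatLit.good_ex_eq_ex.2 ⟨h1, hx, h3⟩
  · intro x y hy
    rcases hbk x y hy with h | ⟨rfl, h⟩
    · exact hc.good_bucket x y h
    · have := FlatLit.good_app.1 (hc.good_bucket l y h)
      exact FlatLit.good_app.2 ⟨hslk ▸ this.1, hkN, this.2.2⟩
  · intro x hx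
    rcases ht.mem₂ x hx with hx | ⟨f, h1, h2⟩
    · exact hc.good_todo x (hsub x hx)
    · obtain ⟨_, _, h3, h4, h5⟩ := FlatLit.good_app.1 (hc.good_bucket _ _ h1)
      obtain ⟨_, _, h6, h7, h8⟩ := FlatLit.good_app.1 (hc.good_bucket _ _ h2)
      exact ⟨⟨h3, h6, h4.trans h7.symm⟩, h5, h8⟩
  · intro x
    have := hc.rep_le x
    rw [hrep]
    split_ifs <;> omega
  · intro x
    rw [hrep x]
    by_cases h : c.rep x = l
    · rw [if_pos h, hrep, hrk, if_neg hkl.ne]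
    · rw [if_neg h, hrep, hc.rep_rep, if_neg h]
  · intro x hx
    have := hc.rep_of_le x hx
    rw [hrep, this, if_neg (by omega)]
  · intro x y hy
    have hx : c.rep x = x := by
      rcases hbk x y hy with h | ⟨rfl, h⟩
      · exact hc.rep_of_bucket x y h
      · exact hrk
    have hxl : x ≠ l := by
      rintro rfl
      rcases hb x with h | h | h
      · exact hkl.ne' h.1
      · rw [h.2] at hy; cases hy
      · exact h.2.1 rfl
    rw [hrep, hx, if_neg hxl]
  · intro x
    rcases hb x with h | h | h
    · rw [h.2]; exact hp
    · rw [h.2]; exact List.Pairwise.nil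
    · rw [h.2.2]; exact hc.pairwise x
  · intro M v
    rw [← hc.holds M v]
    constructor
    · intro h
      have hvl : v (Sum.inr l) = v (Sum.inr k) := by
        have := h.rep l
        rwa [hrep, hrl, if_pos rfl] at this
      have hv : ∀ x, v (Sum.inr x) = v (Sum.inr (c.rep x)) := by
        intro x
        have := h.rep x
        rw [hrep] at this
        split_ifs at this with hx
        · rw [this, hx, hvl]
        · exact this
      have hbk' : ∀ y ∈ t.1, (FlatLit.app y.1 k y.2).toQF.Realize M v := by
        intro y hy
        refine h.bucket k y ?_
        rcases hb k with h | h | h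
        · rw [h.2]; exact hy
        · exact absurd h.1 hkl.ne
        · exact absurd rfl h.1
      refine ⟨hv, ?_, ?_, h.eqs⟩
      · intro x y hy
        by_cases hxl : x = l
        · subst hxl
          -- The entry was either moved to the bucket of `k`, or replaced by an equation with the
          -- value stored there.
          rcases ht.cover y hy with h' | ⟨b, h1, h2⟩
          · exact (congrArg (M.fn y.1) hvl).trans (hbk' y h')
          · exact ((congrArg (M.fn y.1) hvl).trans (hbk' (y.1, b) (ht.subset₁ (y.1, b) h1))).trans
              (h.todo _ h2).symm
        · by_cases hxk : x = k
          · subst hxk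
            exact hbk' y (ht.subset₁ y hy)
          · refine h.bucket x y ?_
            rcases hb x with h | h | h
            · exact absurd h.1 hxk
            · exact absurd h.1 hxl
            · rw [h.2.2]; exact hy
      · intro x hx
        rw [htodo] at hx
        rcases List.mem_cons.1 hx with rfl | hx
        · show v (Sum.inr i) = v (Sum.inr j)
          rw [hv i, hv j]
          rcases hij with ⟨h, h'⟩ | ⟨h, h'⟩
          · rw [h, h', hvl]
          · rw [h, h', hvl]
        · exact h.todo x (ht.subset₂ x hx)
    · intro h
      have hvl : v (Sum.inr l) = v (Sum.inr k) := by
        have h1 : v (Sum.inr i) = v (Sum.inr j) := h.todo _ hmem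
        rw [h.rep i, h.rep j] at h1
        rcases hij with ⟨h, h'⟩ | ⟨h, h'⟩
        · rwa [h, h'] at h1
        · rw [h, h'] at h1; exact h1.symm
      refine ⟨?_, ?_, ?_, h.eqs⟩
      · intro x
        rw [hrep]
        split_ifs with hx
        · rw [h.rep x, hx, hvl]
        · exact h.rep x
      · intro x y hy
        rcases hbk x y hy with h' | ⟨rfl, h'⟩
        · exact h.bucket x y h'
        · exact (congrArg (M.fn y.1) hvl.symm).trans (h.bucket l y h')
      · intro x hx
        rcases ht.mem₂ x hx with hx | ⟨f, h1, h2⟩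
        · exact h.todo x (hsub x hx)
        · exact (h.bucket _ _ h1).symm.trans
            ((congrArg (M.fn f) hvl).trans (h.bucket _ _ h2))
  · intro x y hy
    rcases hbk x y hy with h | ⟨rfl, h⟩
    · exact hc.size_bucket x y h
    · exact hc.size_bucket l y h
  · intro x hx
    rcases ht.mem₂ x hx with hx | ⟨f, h1, h2⟩
    · exact hc.size_todo x (hsub x hx)
    · exact ⟨hc.size_bucket _ _ h1, hc.size_bucket _ _ h2⟩
  · have h1 := (mergedClosure_measure (N := N) (c := { c with todo := todo }) hlN hkN hkl ht).1
    have h2 := hc.count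
    rw [htodo] at h2
    have h3 : (mergedClosure l k { c with todo := todo } t).eqs = c.eqs := rfl
    have h4 : Closure.entries N { c with todo := todo } = c.entries N := rfl
    simp only [List.length_cons] at h1 h2
    rw [h4] at h1
    rw [h3]
    omega

end Merge

end CongruenceClosure

/-! ### Congruence closure: insertion of the literals and the main loop. -/

section CongruenceClosureLoops

variable {σ : Signature.{u}} {P : Type u} {psort : P → σ.Srt} {s : ℕ → σ.Srt}
  {N : ℕ} {H : ∀ M : Model σ, (P ⊕ ℕ → M.carrier) → Prop} {B E : ℕ}

theorem Closure.Inv.mono {c : Closure σ P} {E' : ℕ} (hc : c.Inv psort s N H B E) (h : E ≤ E') :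
    c.Inv psort s N H B E' :=
  { hc with count := hc.count.trans h }

theorem Closure.Inv.congr {c : Closure σ P} {H' : ∀ M : Model σ, (P ⊕ ℕ → M.carrier) → Prop}
    (hc : c.Inv psort s N H B E) (h : ∀ (M : Model σ) v, H M v ↔ H' M v) :
    c.Inv psort s N H' B E :=
  { hc with holds := fun M v => (hc.holds M v).trans (h M v) }

theorem sum_range_update {N i : ℕ} (hi : i < N) (g : ℕ → ℕ) (n : ℕ) :
    ∑ x ∈ Finset.range N, Function.update g i (n + g i) x = n + ∑ x ∈ Finset.range N, g x := by
  have hi' := Finset.mem_range.2 hi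
  rw [Finset.sum_update_of_mem hi', ← Finset.add_sum_erase _ g hi', ← Finset.erase_eq]
  omega

variable [DecidableEq σ.Fn]

theorem initLit_inv {c : Closure σ P} {L : FlatLit σ P} (hc : c.Inv psort s N H B E)
    (hrep : c.rep = id) (hL : L.Good psort s N) (hB : L.size ≤ B) :
    (initLit c L).val.Inv psort s N
        (fun M v => H M v ∧ (L.IsEquation → L.toQF.Realize M v)) B (E + 1) ∧
      (initLit c L).val.rep = id := by
  have key : ∀ a b : Atm σ P, (FlatLit.eq a b).Good psort s N → a.size ≤ B → b.size ≤ B →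
      Closure.Inv psort s N (fun M v => H M v ∧ (FlatLit.eq a b).toQF.Realize M v) B (E + 1)
        { c with todo := (a, b) :: c.todo } := by
    intro a b hab ha hb
    refine { hc with
      good_todo := ?_
      holds := ?_
      size_todo := ?_
      count := ?_ }
    · simpa using ⟨hab, fun a b => hc.good_todo (a, b)⟩
    · intro M v
      constructor
      · intro h
        exact ⟨(hc.holds M v).1 ⟨h.rep, h.bucket, fun x hx => h.todo x (List.mem_cons_of_mem _ hx),
          h.eqs⟩, h.todo _ List.mem_cons_self⟩
      · rintro ⟨h, h'⟩
        obtain ⟨h1, h2, h3, h4⟩ := (hc.holds M v).2 h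
        refine ⟨h1, h2, ?_, h4⟩
        intro x hx
        rcases List.mem_cons.1 hx with rfl | hx
        · exact h'
        · exact h3 x hx
    · simpa using ⟨⟨ha, hb⟩, fun a b => hc.size_todo (a, b)⟩
    · have h1 := hc.count
      have h2 : Closure.entries N { c with todo := (a, b) :: c.todo } = c.entries N := rfl
      simp only [h2, List.length_cons]
      omega
  have skip : (¬ L.IsEquation) → c.Inv psort s N
      (fun M v => H M v ∧ (L.IsEquation → L.toQF.Realize M v)) B (E + 1) := fun h =>
    (hc.mono (Nat.le_succ E)).congr fun M v => by simp [h]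
  cases L with
  | eq a b =>
    refine ⟨(key a b hL ?_ ?_).congr fun M v => ?_, hrep⟩
    · simp only [FlatLit.size] at hB; omega
    · simp only [FlatLit.size] at hB; omega
    · simp [FlatLit.IsEquation]
  | app f i a =>
    have ha : a.size ≤ B := by simp only [FlatLit.size] at hB; omega
    simp only [initLit, bind_val]
    cases hf : (findFn f (c.bucket i)).val with
    | some b =>
      have hb := findFn_some hf
      obtain ⟨_, _, h3, h4, h5⟩ := FlatLit.good_app.1 hL
      obtain ⟨_, _, h6, h7, h8⟩ := FlatLit.good_app.1 (hc.good_bucket _ _ hb)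
      refine ⟨(key a b ⟨⟨h3, h6, h4.trans h7.symm⟩, h5, h8⟩ ha
        (hc.size_bucket _ _ hb)).congr fun M v => ?_, hrep⟩
      -- In the presence of the stored `f(e_i) = b`, the literal `f(e_i) = a` is equivalent to `a =
      -- b`.
      refine and_congr_right fun h => ?_
      have h9 : M.fn f (v (Sum.inr i)) = b.toTerm.eval M v := ((hc.holds M v).2 h).bucket _ _ hb
      simp only [FlatLit.IsEquation, true_imp_iff, FlatLit.toQF, QF.Realize, Term.eval, h9]
      exact eq_comm
    | none =>
      have hnone := findFn_none hf
      have hbk : ∀ x, ∀ y ∈ Function.update c.bucket i ((f, a) :: c.bucket i) x,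
          y ∈ c.bucket x ∨ (x = i ∧ y = (f, a)) := by
        intro x y hy
        by_cases hx : x = i
        · subst hx
          rw [Function.update_self] at hy
          exact (List.mem_cons.1 hy).symm.imp_right fun h => ⟨rfl, h⟩
        · rw [Function.update_of_ne hx] at hy
          exact Or.inl hy
      have hbk' : ∀ x, ∀ y ∈ c.bucket x,
          y ∈ Function.update c.bucket i ((f, a) :: c.bucket i) x := by
        intro x y hy
        by_cases hx : x = i
        · subst hx
          rw [Function.update_self]
          exact List.mem_cons_of_mem _ hy
        · rwa [Function.update_of_ne hx]
      refine ⟨?_, hrep⟩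
      refine { hc with
        good_bucket := ?_
        rep_of_bucket := ?_
        pairwise := ?_
        holds := ?_
        size_bucket := ?_
        count := ?_ }
      · intro x y hy
        rcases hbk x y hy with h | ⟨rfl, rfl⟩
        · exact hc.good_bucket x y h
        · exact hL
      · intro x y _
        exact congrFun hrep x
      · intro x
        by_cases hx : x = i
        · subst hx
          show (Function.update c.bucket x ((f, a) :: c.bucket x) x).Pairwise _
          rw [Function.update_self]
          exact List.pairwise_cons.2 ⟨hnone, hc.pairwise x⟩
        · show (Function.update c.bucket i ((f, a) :: c.bucket i) x).Pairwise _
          rw [Function.update_of_ne hx]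
          exact hc.pairwise x
      · intro M v
        constructor
        · intro h
          refine ⟨(hc.holds M v).1 ⟨h.rep, fun x y hy => h.bucket x y (hbk' x y hy), h.todo,
            h.eqs⟩, fun _ => h.bucket i (f, a) ?_⟩
          show (f, a) ∈ Function.update c.bucket i ((f, a) :: c.bucket i) i
          rw [Function.update_self]
          exact List.mem_cons_self
        · rintro ⟨h, h'⟩
          obtain ⟨h1, h2, h3, h4⟩ := (hc.holds M v).2 h
          refine ⟨h1, ?_, h3, h4⟩
          intro x y hy
          rcases hbk x y hy with h | ⟨rfl, rfl⟩
          · exact h2 x y h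
          · exact h' trivial
      · intro x y hy
        rcases hbk x y hy with h | ⟨rfl, rfl⟩
        · exact hc.size_bucket x y h
        · exact ha
      · have hi : i < N := (FlatLit.good_app.1 hL).2.1
        have h1 := sum_range_update hi (fun x => (c.bucket x).length) 1
        have h2 : Closure.entries N
            { c with bucket := Function.update c.bucket i ((f, a) :: c.bucket i) } =
            ∑ x ∈ Finset.range N,
              Function.update (fun x => (c.bucket x).length) i (1 + (c.bucket i).length) x := by
          refine Finset.sum_congr rfl fun x _ => ?_
          by_cases hx : x = i
          · subst hx
            simp [add_comm]
          · simp [hx]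
        rw [ret_val, h2, h1]
        have := hc.count
        unfold Closure.entries at this
        show c.eqs.length + c.todo.length + _ ≤ _
        omega
  | ne a b => exact ⟨skip id, hrep⟩
  | pos R as => exact ⟨skip id, hrep⟩
  | neg R as => exact ⟨skip id, hrep⟩

theorem loop_initLit_inv {c : Closure σ P} {l : List (FlatLit σ P)}
    (hc : c.Inv psort s N H B E) (hrep : c.rep = id) (hl : ∀ L ∈ l, L.Good psort s N)
    (hB : ∀ L ∈ l, L.size ≤ B) :
    (loop initLit c l).val.Inv psort s N
      (fun M v => H M v ∧ ∀ L ∈ l, L.IsEquation → L.toQF.Realize M v) B (E + l.length) := by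
  induction l generalizing c H E with
  | nil => exact hc.congr fun M v => by simp
  | cons L l ih =>
    obtain ⟨h1, h2⟩ := initLit_inv hc hrep (hl L List.mem_cons_self) (hB L List.mem_cons_self)
    have h3 := ih h1 h2 (fun L' h => hl L' (List.mem_cons_of_mem _ h))
      (fun L' h => hB L' (List.mem_cons_of_mem _ h))
    rw [loop_cons_val]
    refine (h3.mono ?_).congr fun M v => ?_
    · simp only [List.length_cons]; omega
    · simp [and_assoc]

theorem initLit_bucket_length (c : Closure σ P) (L : FlatLit σ P) (i : ℕ) :
    ((initLit c L).val.bucket i).length ≤ (c.bucket i).length + 1 := by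
  cases L with
  | app f j a =>
    simp only [initLit, bind_val]
    cases (findFn f (c.bucket j)).val with
    | some b => exact Nat.le_succ _
    | none =>
      show (Function.update c.bucket j _ i).length ≤ _
      by_cases h : i = j
      · subst h; simp
      · rw [Function.update_of_ne h]; exact Nat.le_succ _
  | _ => exact Nat.le_succ _

theorem initLit_cost (c : Closure σ P) (L : FlatLit σ P) {n : ℕ}
    (h : ∀ i, (c.bucket i).length ≤ n) : (initLit c L).cost ≤ n + 1 := by
  cases L with
  | app f j a =>
    have h1 := findFn_cost f (c.bucket j)
    have h2 := h j
    simp only [initLit, bind_cost]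
    cases (findFn f (c.bucket j)).val <;> simp only [ret_cost] <;> omega
  | _ => exact Nat.zero_le _

/-- A literal lengthens each bucket by at most one, so no lookup ever meets a bucket longer than `n
+ l.length`. -/
theorem loop_initLit_cost {c : Closure σ P} {l : List (FlatLit σ P)} {n : ℕ}
    (h : ∀ i, (c.bucket i).length ≤ n) :
    (loop initLit c l).cost ≤ l.length * (n + l.length + 2) + 1 := by
  induction l generalizing c n with
  | nil => simp
  | cons L l ih =>
    have h1 := ih (c := (initLit c L).val) (n := n + 1)
      fun i => (initLit_bucket_length c L i).trans (Nat.add_le_add_right (h i) 1)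
    have h2 := initLit_cost c L h
    simp only [loop_cons_cost, List.length_cons]
    nlinarith

theorem mergeClasses_spec {c : Closure σ P} {i j : ℕ} {todo : List (Atm σ P × Atm σ P)}
    (hc : c.Inv psort s N H B E) (htodo : c.todo = (.ex i, .ex j) :: todo)
    (hij : c.rep i ≠ c.rep j) (c' : Timed (Closure σ P))
    (hc' : c' = mergeClasses N (max (c.rep i) (c.rep j)) (min (c.rep i) (c.rep j))
      { c with todo := todo }) :
    c'.val.Inv psort s N H B E ∧
      c'.val.todo.length + c'.val.entries N + 1 = c.todo.length + c.entries N ∧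
      c'.val.entries N ≤ c.entries N ∧
      (c'.cost : ℤ) + ((c'.val.entries N : ℤ) ^ 2 - c'.val.squares N) ≤
        ((c.entries N : ℤ) ^ 2 - c.squares N) + 2 * c.entries N + 1 + N := by
  have hmem : ((.ex i, .ex j) : Atm σ P × Atm σ P) ∈ c.todo := by rw [htodo]; simp
  obtain ⟨-, g2, g3⟩ := FlatLit.good_ex_eq_ex.1 (hc.good_todo _ hmem)
  have h1 : min (c.rep i) (c.rep j) < max (c.rep i) (c.rep j) := by omega
  have h2 : (c.rep i = max (c.rep i) (c.rep j) ∧ c.rep j = min (c.rep i) (c.rep j)) ∨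
      (c.rep i = min (c.rep i) (c.rep j) ∧ c.rep j = max (c.rep i) (c.rep j)) := by omega
  have hlN : max (c.rep i) (c.rep j) < N := by
    have := hc.rep_le i
    have := hc.rep_le j
    omega
  generalize max (c.rep i) (c.rep j) = l at *
  generalize min (c.rep i) (c.rep j) = k at *
  have h3 := mergeSpec_loop (c.bucket k) (c.bucket l) (c.bucket k, todo)
  have h4 : (loop (mergeBody (c.bucket k)) (c.bucket k, todo) (c.bucket l)).val.1.Pairwise
      fun x y => x.1 ≠ y.1 :=
    pairwise_loop_mergeBody (hc.pairwise k) (hc.pairwise l) fun x _ y hy hxy => ⟨y, hy, hxy⟩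
  have h5 := mergedClosure_inv hc htodo h1 h2 h3 h4
  obtain ⟨h6, h7, h8, h9⟩ := mergedClosure_measure (N := N) (c := { c with todo := todo })
    hlN (h1.trans hlN) h1 h3
  have h10 := mergeClasses_cost N l k { c with todo := todo }
  rw [← hc'] at h10
  have h11 : c'.val = mergedClosure l k { c with todo := todo }
    (loop (mergeBody (c.bucket k)) (c.bucket k, todo) (c.bucket l)).val := by rw [hc']; rfl
  have e1 : Closure.entries N { c with todo := todo } = c.entries N := rfl
  have e2 : Closure.squares N { c with todo := todo } = c.squares N := rfl
  rw [e1] at h6 h7 h8 h9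
  rw [e2] at h9
  rw [h11]
  refine ⟨h5, ?_, h7, ?_⟩
  · simp only at h6
    rw [htodo, h6, List.length_cons]
    omega
  · simp only at h8 h9 h10
    have h12 : (c'.cost : ℤ) ≤
      (c.bucket l).length * (c.bucket k).length + 2 * (c.bucket l).length + 1 + N := by
      exact_mod_cast h10
    have h13 : ((c.bucket l).length : ℤ) ≤ c.entries N := by exact_mod_cast h8
    linarith

/-- Every iteration removes one pending equation, and a deduced one uses up a bucket entry, so
`c.todo.length + c.entries N` decreases strictly and bounds the number of iterations. An iteration
is charged the linear term `2 * D + N + 2`; the quadratic parts of the merges are charged to the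
potential. -/
theorem closeLoop_spec {n D : ℕ} {c : Closure σ P} (hc : c.Inv psort s N H B E)
    (hn : c.todo.length + c.entries N ≤ n) (hD : c.entries N ≤ D) :
    (closeLoop N n c).val.Inv psort s N H B E ∧ (closeLoop N n c).val.todo = [] ∧
      ((closeLoop N n c).cost : ℤ) ≤ n * (2 * D + N + 2) +
        ((c.entries N : ℤ) ^ 2 - c.squares N) := by
  have hnn : ∀ c : Closure σ P, (0 : ℤ) ≤ (c.entries N : ℤ) ^ 2 - c.squares N := by
    intro c
    have : c.squares N ≤ c.entries N ^ 2 :=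
      Finset.sum_sq_le_sq_sum_of_nonneg fun i _ => Nat.zero_le _
    have : (c.squares N : ℤ) ≤ (c.entries N : ℤ) ^ 2 := by exact_mod_cast this
    linarith
  induction n generalizing c with
  | zero =>
    refine ⟨hc, List.eq_nil_of_length_eq_zero (show c.todo.length = 0 by omega), ?_⟩
    simpa [closeLoop] using hnn c
  | succ n ih =>
    have hpos : (0 : ℤ) ≤ n * (2 * D + N + 2) := by positivity
    -- An equation with an `e`-free member merges no classes; it is only transferred to `eqs`.
    have move : ∀ a b todo, c.todo = (a, b) :: todo →
        ((∃ t, a = .free t) ∨ ∃ t, b = .free t) →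
        (closeLoop N n { c with todo := todo, eqs := (a, b) :: c.eqs }).val.Inv psort s N H B E ∧
        (closeLoop N n { c with todo := todo, eqs := (a, b) :: c.eqs }).val.todo = [] ∧
        ((1 + (closeLoop N n { c with todo := todo, eqs := (a, b) :: c.eqs }).cost : ℕ) : ℤ) ≤
          (n + 1 : ℕ) * (2 * D + N + 2) + ((c.entries N : ℤ) ^ 2 - c.squares N) := by
      intro a b todo h hab
      have hsub : ∀ x ∈ todo, x ∈ c.todo := fun x hx => by
        rw [h]; exact List.mem_cons_of_mem _ hx
      have hmem : (a, b) ∈ c.todo := by rw [h]; simp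
      have e1 : Closure.entries N { c with todo := todo, eqs := (a, b) :: c.eqs } =
        c.entries N := rfl
      have e2 : Closure.squares N { c with todo := todo, eqs := (a, b) :: c.eqs } =
        c.squares N := rfl
      rw [h, List.length_cons] at hn
      obtain ⟨h1, h2, h3⟩ := @ih { c with todo := todo, eqs := (a, b) :: c.eqs }
        { hc with
          good_todo := fun x hx => hc.good_todo x (hsub x hx)
          good_eqs := by simpa using ⟨hc.good_todo _ hmem, fun a b => hc.good_eqs (a, b)⟩
          eqs_free := by simpa using ⟨hab, fun a b => hc.eqs_free (a, b)⟩
          holds := fun M v => by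
            rw [← hc.holds M v]
            constructor
            · intro h'
              refine ⟨h'.rep, h'.bucket, ?_, fun x hx => h'.eqs x (List.mem_cons_of_mem _ hx)⟩
              rw [h]
              intro x hx
              rcases List.mem_cons.1 hx with rfl | hx
              · exact h'.eqs _ List.mem_cons_self
              · exact h'.todo x hx
            · intro h'
              refine ⟨h'.rep, h'.bucket, fun x hx => h'.todo x (hsub x hx), ?_⟩
              intro x hx
              rcases List.mem_cons.1 hx with rfl | hx
              · exact h'.todo _ hmem
              · exact h'.eqs x hx
          size_todo := fun x hx => hc.size_todo x (hsub x hx)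
          size_eqs := by simpa using ⟨hc.size_todo _ hmem, fun a b => hc.size_eqs (a, b)⟩
          count := by
            have := hc.count
            rw [h] at this
            simp only [e1, List.length_cons] at this ⊢
            omega }
        (by rw [e1]; show todo.length + _ ≤ _; omega) (by rw [e1]; exact hD)
      refine ⟨h1, h2, ?_⟩
      rw [e1, e2] at h3
      push_cast
      linarith
    unfold closeLoop
    simp only [tick_val, tick_cost]
    split
    next h =>
      refine ⟨hc, h, ?_⟩
      have := hnn c
      have h' : (0 : ℤ) ≤ 2 * D + N := by positivity
      push_cast
      rw [ret_cost, add_mul]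
      push_cast
      linarith
    next i j todo h =>
      have hsub : ∀ x ∈ todo, x ∈ c.todo := fun x hx => by
        rw [h]; exact List.mem_cons_of_mem _ hx
      -- If the two representatives coincide, the equation already follows from the classes and can
      -- be dropped.
      split_ifs with hij
      · have e1 : Closure.entries N { c with todo := todo } = c.entries N := rfl
        have e2 : Closure.squares N { c with todo := todo } = c.squares N := rfl
        rw [h, List.length_cons] at hn
        obtain ⟨h1, h2, h3⟩ := @ih { c with todo := todo }
          { hc with
            good_todo := fun x hx => hc.good_todo x (hsub x hx)
            holds := fun M v => by
              rw [← hc.holds M v]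
              constructor
              · intro h'
                refine ⟨h'.rep, h'.bucket, ?_, h'.eqs⟩
                rw [h]
                intro x hx
                rcases List.mem_cons.1 hx with rfl | hx
                · have h1 := h'.rep i
                  have h2 := h'.rep j
                  simp only [hij] at h1 h2
                  exact h1.trans h2.symm
                · exact h'.todo x hx
              · intro h'
                exact ⟨h'.rep, h'.bucket, fun x hx => h'.todo x (hsub x hx), h'.eqs⟩
            size_todo := fun x hx => hc.size_todo x (hsub x hx)
            count := by
              have := hc.count
              rw [h] at this
              simp only [e1, List.length_cons] at this ⊢
              omega }
          (by rw [e1]; show todo.length + _ ≤ _; omega) (by rw [e1]; exact hD)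
        refine ⟨h1, h2, ?_⟩
        rw [e1, e2] at h3
        push_cast
        linarith
      · obtain ⟨h1, h2, h3, h4⟩ := mergeClasses_spec hc h hij _ rfl
        obtain ⟨h5, h6, h7⟩ := ih h1 (by omega) (h3.trans hD)
        refine ⟨h5, h6, ?_⟩
        rw [bind_cost]
        push_cast
        have : (c.entries N : ℤ) ≤ D := by exact_mod_cast hD
        linarith
    next a b todo hne h =>
      refine move a b todo h ?_
      cases a with
      | free t => exact Or.inl ⟨t, rfl⟩
      | ex i =>
        cases b with
        | free t => exact Or.inr ⟨t, rfl⟩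
        | ex j => exact (hne i j rfl rfl).elim

end CongruenceClosureLoops

/-! ### The normal form of the preprocessed literals, and closure under superposition. -/

section Emit

variable {σ : Signature.{u}} {P : Type u}

/-! ### Rewriting to representatives -/

@[simp] theorem Atm.size_norm (rep : ℕ → ℕ) (a : Atm σ P) : (a.norm rep).size = a.size := by
  cases a <;> rfl

theorem Atm.norm_norm {rep : ℕ → ℕ} (h : ∀ i, rep (rep i) = rep i) (a : Atm σ P) :
    (a.norm rep).norm rep = a.norm rep := by
  cases a <;> simp [Atm.norm, h]

theorem Atm.eval_norm {rep : ℕ → ℕ} {M : Model σ} {v : P ⊕ ℕ → M.carrier}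
    (h : ∀ i, v (Sum.inr i) = v (Sum.inr (rep i))) (a : Atm σ P) :
    (a.norm rep).toTerm.eval M v = a.toTerm.eval M v := by
  cases a with
  | ex i => exact (h i).symm
  | free t => rfl

@[simp] theorem normList_val (rep : ℕ → ℕ) (as : List (Atm σ P)) :
    (normList rep as).val = as.map (Atm.norm rep) := by
  induction as with
  | nil => rfl
  | cons a as ih => simp [normList, ih]

@[simp] theorem normList_cost (rep : ℕ → ℕ) (as : List (Atm σ P)) :
    (normList rep as).cost = as.length + 1 := by
  induction as with
  | nil => rfl
  | cons a as ih =>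
    simp only [normList, tick_cost, bind_cost, ih, ret_cost, List.length_cons]; omega

namespace FlatLit

def norm (rep : ℕ → ℕ) : FlatLit σ P → FlatLit σ P
  | .eq a b => .eq (a.norm rep) (b.norm rep)
  | .app f i a => .app f (rep i) (a.norm rep)
  | .ne a b => .ne (a.norm rep) (b.norm rep)
  | .pos R as => .pos R (as.map (Atm.norm rep))
  | .neg R as => .neg R (as.map (Atm.norm rep))

@[simp] theorem size_norm (rep : ℕ → ℕ) (L : FlatLit σ P) : (L.norm rep).size = L.size := by
  cases L <;> simp [norm, size, Function.comp_def]

theorem realize_norm {rep : ℕ → ℕ} {M : Model σ} {v : P ⊕ ℕ → M.carrier}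
    (h : ∀ i, v (Sum.inr i) = v (Sum.inr (rep i))) (L : FlatLit σ P) :
    (L.norm rep).toQF.Realize M v ↔ L.toQF.Realize M v := by
  cases L <;>
    simp [norm, toQF, QF.Realize, Term.eval, Atm.eval_norm h, ← h, Function.comp_def]

theorem Good.norm {psort : P → σ.Srt} {s : ℕ → σ.Srt} {N : ℕ} {rep : ℕ → ℕ}
    (h : ∀ i < N, (.eq (.ex i) (.ex (rep i)) : FlatLit σ P).Good psort s N) {L : FlatLit σ P}
    (hL : L.Good psort s N) : (L.norm rep).Good psort s N := by
  have h1 : ∀ a : Atm σ P, Below N a.toTerm.head → Below N (a.norm rep).toTerm.head := by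
    intro a ha
    cases a with
    | ex i => exact below_inr.2 (good_ex_eq_ex.1 (h i (below_inr.1 ha))).2.2
    | free t => exact ha
  have h2 : ∀ a : Atm σ P, Below N a.toTerm.head →
      (a.norm rep).toTerm.sortOf (Sum.elim psort s) = a.toTerm.sortOf (Sum.elim psort s) := by
    intro a ha
    cases a with
    | ex i => exact (good_ex_eq_ex.1 (h i (below_inr.1 ha))).1.symm
    | free t => rfl
  have h3 : ∀ a : Atm σ P, a.toTerm.WellSorted (Sum.elim psort s) →
      (a.norm rep).toTerm.WellSorted (Sum.elim psort s) := by
    intro a ha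
    cases a with
    | ex i => trivial
    | free t => exact ha
  have h4 : ∀ (R : σ.Rel) (as : List (Atm σ P)),
      RelSorted (Sum.elim psort s) R (as.map Atm.toTerm) →
      (∀ t ∈ as.map Atm.toTerm, Below N t.head) →
      RelSorted (Sum.elim psort s) R ((as.map (Atm.norm rep)).map Atm.toTerm) ∧
      ∀ t ∈ (as.map (Atm.norm rep)).map Atm.toTerm, Below N t.head := by
    intro R as hs hv
    simp only [List.mem_map, forall_exists_index, and_imp, forall_apply_eq_imp_iff₂] at hv
    refine ⟨⟨?_, ?_⟩, ?_⟩
    · simp only [List.mem_map, forall_exists_index, and_imp, forall_apply_eq_imp_iff₂]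
      exact fun a ha => h3 a (hs.1 _ (List.mem_map_of_mem ha))
    · rw [← hs.2]
      simp only [List.map_map]
      exact List.map_congr_left fun a ha => h2 a (hv a ha)
    · simp only [List.mem_map, forall_exists_index, and_imp, forall_apply_eq_imp_iff₂]
      exact fun a ha => h1 a (hv a ha)
  cases L with
  | eq a b =>
    obtain ⟨⟨h5, h6, h7⟩, h8, h9⟩ := hL
    exact ⟨⟨h3 a h5, h3 b h6, by rw [h2 a h8, h2 b h9, h7]⟩, h1 a h8, h1 b h9⟩
  | app f i a =>
    obtain ⟨h5, h6, h7, h8, h9⟩ := good_app.1 hL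
    obtain ⟨h10, _, h11⟩ := good_ex_eq_ex.1 (h i h6)
    exact good_app.2 ⟨h10 ▸ h5, h11, h3 a h7, by rw [h2 a h9, h8], h1 a h9⟩
  | ne a b =>
    obtain ⟨⟨h5, h6, h7⟩, h8, h9⟩ := hL
    exact ⟨⟨h3 a h5, h3 b h6, by rw [h2 a h8, h2 b h9, h7]⟩, h1 a h8, h1 b h9⟩
  | pos R as => exact h4 R as hL.1 hL.2
  | neg R as => exact h4 R as hL.1 hL.2

/-- All existential variables of the literal are representatives, and it does not equate two
distinct existential variables. -/
def Normal (rep : ℕ → ℕ) : FlatLit σ P → Prop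
  | .eq a b => a.norm rep = a ∧ b.norm rep = b ∧
      (a = b ∨ (∃ t, a = .free t) ∨ ∃ t, b = .free t)
  | .app _ i a => rep i = i ∧ a.norm rep = a
  | .ne a b => a.norm rep = a ∧ b.norm rep = b
  | .pos _ as => ∀ a ∈ as, a.norm rep = a
  | .neg _ as => ∀ a ∈ as, a.norm rep = a

/-- The size of a relational literal, and `0` for equations and disequations. -/
def relSize : FlatLit σ P → ℕ
  | .pos R as => (pos R as).size
  | .neg R as => (neg R as).size
  | _ => 0

end FlatLit

theorem mem_emit (F : FlatFormula σ P) (c : Closure σ P) (L : FlatLit σ P) :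
    L ∈ (emit F c).val ↔
      (∃ i < F.exNum, L = .eq (.ex i) (.ex (c.rep i)) ∨ ∃ x ∈ c.bucket i,
        L = .app x.1 i (x.2.norm c.rep) ∨ L = .eq (x.2.norm c.rep) (x.2.norm c.rep)) ∨
      (∃ x ∈ c.eqs, L = .eq (x.1.norm c.rep) (x.2.norm c.rep)) ∨
      ∃ L' ∈ F.lits, ¬ L'.IsEquation ∧ L = L'.norm c.rep := by
  unfold emit
  simp only [bind_val]
  rw [mem_loop (R := fun L' L => ¬ L'.IsEquation ∧ L = L'.norm c.rep),
    mem_loop (R := fun (x : Atm σ P × Atm σ P) L =>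
      L = .eq (x.1.norm c.rep) (x.2.norm c.rep)),
    mem_loop (R := fun i L => L = .eq (.ex i) (.ex (c.rep i)) ∨ ∃ x ∈ c.bucket i,
        L = .app x.1 i (x.2.norm c.rep) ∨ L = .eq (x.2.norm c.rep) (x.2.norm c.rep))]
  · simp [or_assoc]
  · intro S i _ L
    rw [mem_loop (R := fun (x : σ.Fn × Atm σ P) L =>
      L = .app x.1 i (x.2.norm c.rep) ∨ L = .eq (x.2.norm c.rep) (x.2.norm c.rep))]
    · rw [List.mem_cons, or_comm (b := L ∈ S), or_assoc]
    · intro S x _ L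
      simp only [ret_val, List.mem_cons]; tauto
  · intro S x _ L
    simp only [ret_val, List.mem_cons]; tauto
  · intro S L' _ L
    cases L' <;> simp [FlatLit.IsEquation, FlatLit.norm, or_comm]

theorem sum_map_range (f : ℕ → ℕ) (N : ℕ) :
    ((List.range N).map f).sum = ∑ i ∈ Finset.range N, f i := rfl

theorem length_le_sum_map_size (as : List (Atm σ P)) : as.length ≤ (as.map Atm.size).sum := by
  induction as with
  | nil => simp
  | cons a as ih =>
    have := a.one_le_size
    simp only [List.length_cons, List.map_cons, List.sum_cons]; omega

/-- The value of `f` on the rewritten literal, and `0` for equations. -/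
def FlatLit.normMeasure (rep : ℕ → ℕ) (f : FlatLit σ P → ℕ) : FlatLit σ P → ℕ
  | .eq _ _ => 0
  | .app _ _ _ => 0
  | L => f (L.norm rep)

/-- Applied with the constant `1` to count the emitted literals, and with `FlatLit.relSize` to bound
the relational ones. -/
theorem emit_measure (F : FlatFormula σ P) (c : Closure σ P) (f : FlatLit σ P → ℕ) :
    ((emit F c).val.map f).sum ≤
      ((List.range F.exNum).map fun i => f (.eq (.ex i) (.ex (c.rep i))) +
        ((c.bucket i).map fun x => f (.app x.1 i (x.2.norm c.rep)) +
          f (.eq (x.2.norm c.rep) (x.2.norm c.rep))).sum).sum +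
      (c.eqs.map fun x => f (.eq (x.1.norm c.rep) (x.2.norm c.rep))).sum +
      (F.lits.map (FlatLit.normMeasure c.rep f)).sum := by
  unfold emit
  simp only [bind_val]
  refine (loop_measure_le (fun S : List (FlatLit σ P) => (S.map f).sum)
    (FlatLit.normMeasure c.rep f) ?_).trans ?_
  · intro S L _
    cases L <;> simp [FlatLit.normMeasure, FlatLit.norm, add_comm]
  refine Nat.add_le_add_right ((loop_measure_le (fun S : List (FlatLit σ P) => (S.map f).sum)
    (fun x => f (.eq (x.1.norm c.rep) (x.2.norm c.rep))) ?_).trans ?_) _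
  · intro S L _
    simp [add_comm]
  refine Nat.add_le_add_right ((loop_measure_le (fun S : List (FlatLit σ P) => (S.map f).sum)
    (fun i => f (.eq (.ex i) (.ex (c.rep i))) +
        ((c.bucket i).map fun x => f (.app x.1 i (x.2.norm c.rep)) +
          f (.eq (x.2.norm c.rep) (x.2.norm c.rep))).sum) ?_).trans ?_) _
  · intro S i _
    refine (loop_measure_le (fun S : List (FlatLit σ P) => (S.map f).sum)
      (fun x => f (.app x.1 i (x.2.norm c.rep)) +
          f (.eq (x.2.norm c.rep) (x.2.norm c.rep))) ?_).trans ?_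
    · intro S x _
      simp only [ret_val, List.map_cons, List.sum_cons]; omega
    · simp only [List.map_cons, List.sum_cons]; omega
  · simp

theorem emit_cost (F : FlatFormula σ P) (c : Closure σ P) :
    (emit F c).cost ≤ c.entries F.exNum + 2 * F.exNum + c.eqs.length +
      2 * (F.lits.map FlatLit.size).sum + 3 := by
  unfold emit
  simp only [bind_cost]
  have h1 : ∀ S : List (FlatLit σ P), (loop (fun (S : List (FlatLit σ P)) (i : ℕ) =>
      loop (fun (S : List (FlatLit σ P)) (x : σ.Fn × Atm σ P) =>
          ret (.app x.1 i (x.2.norm c.rep) :: .eq (x.2.norm c.rep) (x.2.norm c.rep) :: S))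
        (.eq (.ex i) (.ex (c.rep i)) :: S) (c.bucket i))
    S (List.range F.exNum)).cost ≤ c.entries F.exNum + 2 * F.exNum + 1 := by
    intro S
    refine (loop_cost_le (fun i => (c.bucket i).length + 1) ?_).trans ?_
    · intro S i _
      refine (loop_cost_le (fun _ => 0) fun _ _ _ => le_rfl).trans ?_
      simp
    · rw [List.sum_map_add, sum_map_range, ← Closure.entries]
      simp only [List.map_const', List.length_range, List.sum_replicate, smul_eq_mul]
      omega
  have h2 : ∀ S : List (FlatLit σ P),
      (loop (fun (S : List (FlatLit σ P)) (x : Atm σ P × Atm σ P) =>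
      ret (.eq (x.1.norm c.rep) (x.2.norm c.rep) :: S)) S c.eqs).cost ≤ c.eqs.length + 1 := by
    intro S
    refine (loop_cost_le (fun _ => 0) fun _ _ _ => le_rfl).trans ?_
    simp
  have h3 : ∀ S : List (FlatLit σ P), (loop (fun (S : List (FlatLit σ P)) (L : FlatLit σ P) =>
      match L with
      | .ne a b => ret (.ne (a.norm c.rep) (b.norm c.rep) :: S)
      | .pos R as => (normList c.rep as).bind fun bs => ret (.pos R bs :: S)
      | .neg R as => (normList c.rep as).bind fun bs => ret (.neg R bs :: S)
      | _ => ret S) S F.lits).cost ≤ 2 * (F.lits.map FlatLit.size).sum + 1 := by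
    intro S
    refine (loop_cost_le FlatLit.size ?_).trans ?_
    · intro S L _
      cases L with
      | pos R as =>
        have := length_le_sum_map_size as
        simp only [bind_cost, normList_cost, ret_cost, FlatLit.size]; omega
      | neg R as =>
        have := length_le_sum_map_size as
        simp only [bind_cost, normList_cost, ret_cost, FlatLit.size]; omega
      | _ => exact Nat.zero_le _
    · have : F.lits.length ≤ (F.lits.map FlatLit.size).sum := by
        have := List.length_le_sum_of_one_le (F.lits.map FlatLit.size)
          (by simpa using fun L _ => FlatLit.one_le_size L)
        simpa using this
      omega
  refine (Nat.add_le_add (h1 _) (Nat.add_le_add (h2 _) (h3 _))).trans ?_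
  omega

/-! ### The preprocessed formula -/

/-- The normal form of the sets of literals produced by the preprocessing. -/
structure FlatFormula.Reduced (psort : P → σ.Srt) (F : FlatFormula σ P) (rep : ℕ → ℕ) : Prop where
  wf : F.WellFormed psort
  rep_le : ∀ i, rep i ≤ i
  rep_rep : ∀ i, rep (rep i) = rep i
  eq_rep_mem : ∀ i < F.exNum, .eq (.ex i) (.ex (rep i)) ∈ F.lits
  normal : ∀ L ∈ F.lits, (∃ i, L = .eq (.ex i) (.ex (rep i))) ∨ L.Normal rep
  app_unique : ∀ f i a b, .app f i a ∈ F.lits → .app f i b ∈ F.lits →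
    a = b ∧ .eq a a ∈ F.lits

theorem FlatLit.Normal.eq_of_eq_ex {rep : ℕ → ℕ} {i j : ℕ}
    (h : (FlatLit.eq (.ex i) (.ex j) : FlatLit σ P).Normal rep) : i = j := by
  obtain ⟨-, -, h | ⟨t, h⟩ | ⟨t, h⟩⟩ := h
  · exact Atm.ex.inj h
  · cases h
  · cases h

/-- An equation `e_i = e_j` with `j < i` must be `e_i = e_{rep i}`. Then `e_i` is not a
representative, so no literal but this equation contains it, and rewriting the equation by itself
gives `e_{rep i} = e_{rep i}`. Rule (i) gives only `a = a`, because values of `f(e_i)` are unique.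
-/
theorem FlatFormula.Reduced.rsClosed {psort : P → σ.Srt} {F : FlatFormula σ P} {rep : ℕ → ℕ}
    (h : F.Reduced psort rep) : RSClosed F.lits := by
  refine ⟨fun f i a b ha hb => ?_, fun i j L L' hij hlt hL hrw => ?_⟩
  · obtain ⟨rfl, h'⟩ := h.app_unique f i a b ha hb
    exact Or.inl h'
  · have hj : j = rep i ∧ i < F.exNum := by
      rcases hij with hij | hij
      · refine ⟨?_, below_inr.1 (h.wf _ hij).2.1⟩
        rcases h.normal _ hij with ⟨k, hk⟩ | hk
        · cases hk; rfl
        · exact absurd hk.eq_of_eq_ex hlt.ne'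
      · refine ⟨?_, below_inr.1 (h.wf _ hij).2.2⟩
        rcases h.normal _ hij with ⟨k, hk⟩ | hk
        · cases hk
          exact absurd (h.rep_le j) (by omega)
        · exact absurd hk.eq_of_eq_ex hlt.ne
    obtain ⟨rfl, hi⟩ := hj
    have hnorm : ∀ a : Atm σ P, a.norm rep = a → a ≠ .ex i := by
      rintro a ha rfl
      have := Atm.ex.inj ha
      omega
    -- The only conclusion of rule (ii): it is the link of `e_{rep i}` to its own representative.
    have hrr : (FlatLit.eq (.ex (rep i)) (.ex (rep i)) : FlatLit σ P) ∈ F.lits := by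
      have := h.eq_rep_mem (rep i) (hlt.trans hi)
      rwa [h.rep_rep] at this
    have heq : ∀ a b : Atm σ P, Holds F.lits (.eq a b) → (a = .ex i → b = .ex (rep i)) ∧
        (b = .ex i → a = .ex (rep i)) := by
      have : ∀ a b : Atm σ P, .eq a b ∈ F.lits → (a = .ex i → b = .ex (rep i)) ∧
          (b = .ex i → a = .ex (rep i)) := by
        intro a b hab
        rcases h.normal _ hab with ⟨k, hk⟩ | hk
        · injection hk with hk1 hk2
          subst hk1 hk2
          refine ⟨?_, ?_⟩
          · intro h'
            rw [Atm.ex.inj h']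
          · intro h'
            have h1 := Atm.ex.inj h'
            have h2 := h.rep_rep k
            rw [h1] at h2
            omega
        · exact ⟨fun h' => absurd h' (hnorm a hk.1), fun h' => absurd h' (hnorm b hk.2.1)⟩
      rintro a b (hab | hab)
      · exact this a b hab
      · exact (this b a hab).symm
    have hrest : ∀ L, L ∈ F.lits → (∀ a b, L ≠ .eq a b) → L.Normal rep := by
      intro L hL hne
      rcases h.normal L hL with ⟨k, hk⟩ | hk
      · exact absurd hk (hne _ _)
      · exact hk
    cases hrw with
    | eq_left b =>
      rw [(heq _ _ hL).1 rfl]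
      exact Or.inl hrr
    | eq_right a =>
      rw [(heq _ _ hL).2 rfl]
      exact Or.inl hrr
    | app_arg f a =>
      have := (hrest _ hL (by simp)).1
      omega
    | app_right f k => exact absurd rfl (hnorm _ (hrest _ hL (by simp)).2)
    | ne_left b =>
      rcases hL with hL | hL
      · exact absurd rfl (hnorm _ (hrest _ hL (by simp)).1)
      · exact absurd rfl (hnorm _ (hrest _ hL (by simp)).2)
    | ne_right a =>
      rcases hL with hL | hL
      · exact absurd rfl (hnorm _ (hrest _ hL (by simp)).2)
      · exact absurd rfl (hnorm _ (hrest _ hL (by simp)).1)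
    | pos R as bs => exact absurd rfl (hnorm _ (hrest _ hL (by simp) (.ex i) (by simp)))
    | neg R as bs => exact absurd rfl (hnorm _ (hrest _ hL (by simp) (.ex i) (by simp)))

section Closed

variable {psort : P → σ.Srt} {F : FlatFormula σ P} {B E : ℕ} {c : Closure σ P}

/-- The assertion of all the equations among the literals of `F`. -/
def FlatFormula.Equations (F : FlatFormula σ P) (M : Model σ) (v : P ⊕ ℕ → M.carrier) : Prop :=
  ∀ L ∈ F.lits, L.IsEquation → L.toQF.Realize M v

/-- Uniqueness of values comes from the distinct symbols within a bucket. The equation `a = a`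
emitted beside each `f(e_i) = a` is the one that `app_unique` asks for: the trivial conclusion of
rule (i) has to be literally present. -/
theorem reduced_emit (hF : F.WellFormed psort)
    (hc : c.Inv psort F.exSort F.exNum F.Equations B E) :
    FlatFormula.Reduced psort { F with lits := (emit F c).val } c.rep where
  wf := by
    intro L hL
    rcases (mem_emit F c L).1 hL with ⟨i, hi, h | ⟨x, hx, h | h⟩⟩ | ⟨x, hx, h⟩ | ⟨L', hL', _, h⟩
    · rw [h]; exact hc.good_rep i hi
    · have := (hc.good_bucket i x hx).norm hc.good_rep
      rw [FlatLit.norm, hc.rep_of_bucket i x hx] at this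
      rw [h]; exact this
    · obtain ⟨_, _, h1, _, h2⟩ := FlatLit.good_app.1 (hc.good_bucket i x hx)
      have : (FlatLit.eq x.2 x.2).Good psort F.exSort F.exNum := ⟨⟨h1, h1, rfl⟩, h2, h2⟩
      rw [h]; exact this.norm hc.good_rep
    · rw [h]; exact (hc.good_eqs x hx).norm hc.good_rep
    · rw [h]; exact FlatLit.Good.norm hc.good_rep (hF L' hL')
  rep_le := hc.rep_le
  rep_rep := hc.rep_rep
  eq_rep_mem := fun i hi => (mem_emit F c _).2 (Or.inl ⟨i, hi, Or.inl rfl⟩)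
  normal := by
    intro L hL
    have hn := fun a : Atm σ P => a.norm_norm hc.rep_rep
    rcases (mem_emit F c L).1 hL with ⟨i, hi, h | ⟨x, hx, h | h⟩⟩ | ⟨x, hx, h⟩ |
      ⟨L', hL', h', h⟩
    · exact Or.inl ⟨i, h⟩
    · rw [h]; exact Or.inr ⟨hc.rep_of_bucket i x hx, hn _⟩
    · rw [h]; exact Or.inr ⟨hn _, hn _, Or.inl rfl⟩
    · rw [h]
      refine Or.inr ⟨hn _, hn _, Or.inr ?_⟩
      rcases hc.eqs_free x hx with ⟨t, ht⟩ | ⟨t, ht⟩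
      · exact Or.inl ⟨t, by rw [ht]; rfl⟩
      · exact Or.inr ⟨t, by rw [ht]; rfl⟩
    · rw [h]
      right
      cases L' with
      | eq a b => exact absurd trivial h'
      | app f i a => exact absurd trivial h'
      | ne a b => exact ⟨hn _, hn _⟩
      | pos R as => simp [FlatLit.norm, FlatLit.Normal, hn]
      | neg R as => simp [FlatLit.norm, FlatLit.Normal, hn]
  app_unique := by
    have happ : ∀ f i a, .app f i a ∈ (emit F c).val →
        i < F.exNum ∧ ∃ x ∈ c.bucket i, x.1 = f ∧ a = x.2.norm c.rep := by
      intro f i a h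
      rcases (mem_emit F c _).1 h with ⟨j, hj, h | ⟨x, hx, h | h⟩⟩ | ⟨x, hx, h⟩ | ⟨L', _, h', h⟩
      · cases h
      · cases h; exact ⟨hj, x, hx, rfl, rfl⟩
      · cases h
      · cases h
      · cases L' with
        | app f i a => exact absurd trivial h'
        | _ => cases h
    intro f i a b ha hb
    obtain ⟨hi, x, hx, rfl, rfl⟩ := happ f i a ha
    obtain ⟨_, y, hy, hxy, rfl⟩ := happ _ i b hb
    have hxy' : x = y := by
      have : Std.Symm fun x y : σ.Fn × Atm σ P => x.1 ≠ y.1 := ⟨fun _ _ h => h.symm⟩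
      by_contra hne
      exact (hc.pairwise i).forall hx hy hne hxy.symm
    subst hxy'
    exact ⟨rfl, (mem_emit F c _).2 (Or.inl ⟨i, hi, Or.inr ⟨x, hx, Or.inr rfl⟩⟩)⟩

theorem sat_emit_iff (hc : c.Inv psort F.exSort F.exNum F.Equations B E) (htodo : c.todo = [])
    {M : Model σ} {ρ : P → M.carrier} {ε : ℕ → M.carrier} :
    FlatFormula.Sat M ρ { F with lits := (emit F c).val } ε ↔ F.Sat M ρ ε := by
  refine and_congr_right fun _ => ?_
  constructor
  · intro h
    have hrep : ∀ i, Sum.elim ρ ε (Sum.inr i) = Sum.elim ρ ε (Sum.inr (c.rep i)) := by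
      intro i
      -- Links are emitted only for indices below `F.exNum`; every other index is its own
      -- representative.
      by_cases hi : i < F.exNum
      · exact h _ ((mem_emit F c _).2 (Or.inl ⟨i, hi, Or.inl rfl⟩))
      · rw [hc.rep_of_le i (not_lt.1 hi)]
    have hE : F.Equations M (Sum.elim ρ ε) := by
      refine (hc.holds M _).1 ⟨hrep, ?_, by simp [htodo], ?_⟩
      · intro i x hx
        have hi : i < F.exNum := (FlatLit.good_app.1 (hc.good_bucket i x hx)).2.1
        refine (FlatLit.realize_norm hrep _).1 (h _ ((mem_emit F c _).2
          (Or.inl ⟨i, hi, Or.inr ⟨x, hx, Or.inl ?_⟩⟩)))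
        rw [FlatLit.norm, hc.rep_of_bucket i x hx]
      · intro x hx
        exact (FlatLit.realize_norm hrep (.eq x.1 x.2)).1
          (h _ ((mem_emit F c _).2 (Or.inr (Or.inl ⟨x, hx, rfl⟩))))
    intro L hL
    by_cases hLE : L.IsEquation
    · exact hE L hL hLE
    · exact (FlatLit.realize_norm hrep L).1
        (h _ ((mem_emit F c _).2 (Or.inr (Or.inr ⟨L, hL, hLE, rfl⟩))))
  · intro h
    have hH : c.Holds M (Sum.elim ρ ε) := (hc.holds M _).2 fun L hL _ => h L hL
    intro L hL
    rcases (mem_emit F c L).1 hL with ⟨i, hi, h' | ⟨x, hx, h' | h'⟩⟩ | ⟨x, hx, h'⟩ |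
      ⟨L', hL', _, h'⟩
    · rw [h']; exact hH.rep i
    · have := (FlatLit.realize_norm hH.rep _).2 (hH.bucket i x hx)
      rw [FlatLit.norm, hc.rep_of_bucket i x hx] at this
      rw [h']; exact this
    · rw [h']; rfl
    · rw [h']; exact (FlatLit.realize_norm hH.rep _).2 (hH.eqs x hx)
    · rw [h']; exact (FlatLit.realize_norm hH.rep _).2 (h L' hL')

end Closed

end Emit

/-! ### Size and cost of the preprocessing. -/

section Preprocess

variable {σ : Signature.{u}} {P : Type u}

/-! ### Size and cost of the abstraction -/

def FlatTerm.size : FlatTerm σ P → ℕ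
  | .atm a => a.size
  | .app _ _ => 2

theorem FlatTerm.size_atm (a : Atm σ P) : (FlatTerm.atm a).size = a.size := rfl

theorem FlatTerm.size_app (f : σ.Fn) (i : ℕ) : (FlatTerm.app f i : FlatTerm σ P).size = 2 := rfl

theorem FlatLit.relSize_eq (a b : Atm σ P) : (FlatLit.eq a b).relSize = 0 := rfl

theorem FlatLit.relSize_app (f : σ.Fn) (i : ℕ) (a : Atm σ P) : (FlatLit.app f i a).relSize = 0 :=
  rfl

namespace FlatFormula

/-- The number of symbols of a flat formula. -/
def size (F : FlatFormula σ P) : ℕ := F.exNum + (F.lits.map FlatLit.size).sum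

theorem size_add (F : FlatFormula σ P) (L : FlatLit σ P) : (F.add L).size = F.size + L.size := by
  simp only [size, add, List.map_cons, List.sum_cons]; omega

theorem size_lit_le {F : FlatFormula σ P} {L : FlatLit σ P} (hL : L ∈ F.lits) :
    L.size ≤ F.size :=
  (List.single_le_sum (fun _ _ => Nat.zero_le _) _ (List.mem_map_of_mem hL)).trans
    (Nat.le_add_left _ _)

theorem exNum_add_length_le_size (F : FlatFormula σ P) : F.exNum + F.lits.length ≤ F.size := by
  have := List.length_le_sum_of_one_le (F.lits.map FlatLit.size)
    (by simpa using fun L _ => FlatLit.one_le_size L)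
  rw [List.length_map] at this
  exact Nat.add_le_add_left this _

end FlatFormula

theorem nameTerm_cost_add_size (F : FlatFormula σ P) (t : FlatTerm σ P) :
    (nameTerm F t).cost + (nameTerm F t).val.2.size + (nameTerm F t).val.1.size ≤
      F.size + t.size + 4 := by
  cases t with
  | atm a => simp only [nameTerm, tick_cost, ret_cost, tick_val, ret_val, FlatTerm.size]; omega
  | app f i =>
    simp only [nameTerm, tick_cost, ret_cost, tick_val, ret_val, FlatTerm.size, Atm.size,
      FlatFormula.size, List.map_cons, List.sum_cons, FlatLit.size]
    omega

/-- Bounding cost plus size of the result by the old size plus a multiple of the input lets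
successive calls telescope. Each symbol is charged `6`: one step for the call, `4` for naming, and
one for the larger flat term `f(e_i)` that is returned. -/
theorem flattenTerm_cost_add_size (F : FlatFormula σ P) (t : Term σ (P ⊕ ℕ)) :
    (flattenTerm F t).cost + (flattenTerm F t).val.2.size + (flattenTerm F t).val.1.size ≤
      F.size + 6 * t.size := by
  induction t with
  | var x =>
    cases x <;>
    · simp only [flattenTerm, tick_cost, ret_cost, tick_val, ret_val, FlatTerm.size, Atm.size,
        Term.size]
      omega
  | app f t ih =>
    have h := nameTerm_cost_add_size (flattenTerm F t).val.2 (flattenTerm F t).val.1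
    simp only [flattenTerm, tick_cost, bind_cost, tick_val, bind_val, Term.size]
    generalize (nameTerm (flattenTerm F t).val.2 (flattenTerm F t).val.1) = s at *
    obtain ⟨⟨a, F'⟩, n⟩ := s
    cases a <;>
    · simp only [ret_cost, ret_val, FlatTerm.size_atm, FlatTerm.size_app, Atm.size,
        Term.size] at h ⊢
      omega

theorem abstractTerm_cost_add_size (F : FlatFormula σ P) (t : Term σ (P ⊕ ℕ)) :
    (abstractTerm F t).cost + (abstractTerm F t).val.2.size + (abstractTerm F t).val.1.size ≤
      F.size + 10 * t.size := by
  have h1 := flattenTerm_cost_add_size F t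
  have h2 := nameTerm_cost_add_size (flattenTerm F t).val.2 (flattenTerm F t).val.1
  have h3 := t.one_le_size
  simp only [abstractTerm, bind_cost, bind_val]
  omega

theorem abstractList_cost_add_size (F : FlatFormula σ P) (ts : List (Term σ (P ⊕ ℕ))) :
    (abstractList F ts).cost + (abstractList F ts).val.2.size +
        ((abstractList F ts).val.1.map Atm.size).sum ≤
      F.size + 11 * (ts.map Term.size).sum + 1 := by
  induction ts generalizing F with
  | nil => simp [abstractList, add_comm]
  | cons t ts ih =>
    have h1 := abstractTerm_cost_add_size F t
    have h2 := ih (abstractTerm F t).val.2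
    have h3 := t.one_le_size
    simp only [abstractList, tick_cost, bind_cost, tick_val, bind_val, ret_cost, ret_val,
      List.map_cons, List.sum_cons]
    omega

theorem flattenLit_cost_add_size (F : FlatFormula σ P) (L : Literal σ (P ⊕ ℕ)) :
    (flattenLit F L).cost + (flattenLit F L).val.size ≤ F.size + 12 * L.size := by
  cases L with
  | eq t t' =>
    have h1 := flattenTerm_cost_add_size F t
    have h2 := flattenTerm_cost_add_size (flattenTerm F t).val.2 t'
    simp only [flattenLit, bind_cost, bind_val, Literal.size]
    generalize flattenTerm F t = r at *
    obtain ⟨⟨r, F₁⟩, n₁⟩ := r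
    simp only at h1 h2 ⊢
    generalize flattenTerm F₁ t' = s at *
    obtain ⟨⟨s, F₂⟩, n₂⟩ := s
    simp only at h1 h2 ⊢
    cases r with
    | atm a =>
      cases s <;>
      · simp only [ret_cost, ret_val, FlatFormula.size_add, FlatLit.size, FlatTerm.size] at *
        omega
    | app f i =>
      cases s with
      | atm b =>
        simp only [ret_cost, ret_val, FlatFormula.size_add, FlatLit.size, FlatTerm.size] at *
        omega
      | app g j =>
        have h3 := nameTerm_cost_add_size F₂ (.app g j)
        simp only [bind_cost, bind_val, ret_cost, ret_val, FlatFormula.size_add, FlatLit.size,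
          FlatTerm.size] at *
        omega
  | ne t t' =>
    have h1 := abstractTerm_cost_add_size F t
    have h2 := abstractTerm_cost_add_size (abstractTerm F t).val.2 t'
    simp only [flattenLit, bind_cost, bind_val, ret_cost, ret_val, FlatFormula.size_add,
      FlatLit.size, Literal.size]
    omega
  | pos R ts =>
    have h1 := abstractList_cost_add_size F ts
    simp only [flattenLit, bind_cost, bind_val, ret_cost, ret_val, FlatFormula.size_add,
      FlatLit.size, Literal.size]
    omega
  | neg R ts =>
    have h1 := abstractList_cost_add_size F ts
    simp only [flattenLit, bind_cost, bind_val, ret_cost, ret_val, FlatFormula.size_add,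
      FlatLit.size, Literal.size]
    omega

theorem Literal.one_le_size {V : Type v} (L : Literal σ V) : 1 ≤ L.size := by
  cases L <;> simp only [size] <;> omega

theorem loop_flattenLit_cost_add_size (F : FlatFormula σ P) (ls : List (Literal σ (P ⊕ ℕ))) :
    (loop flattenLit F ls).cost + (loop flattenLit F ls).val.size ≤
      F.size + 13 * (ls.map Literal.size).sum + 1 := by
  induction ls generalizing F with
  | nil => simp [add_comm]
  | cons L ls ih =>
    have h1 := flattenLit_cost_add_size F L
    have h2 := ih (flattenLit F L).val
    have h3 := L.one_le_size
    simp only [loop_cons_cost, loop_cons_val, List.map_cons, List.sum_cons]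
    omega

theorem flatten_cost_add_size (φ : Primitive σ P) :
    (flatten φ).cost + (flatten φ).val.size ≤ 13 * φ.size := by
  have h := loop_flattenLit_cost_add_size ⟨φ.exNum, φ.exSort, []⟩ φ.lits
  simp only [flatten, tick_cost, tick_val, Primitive.size]
  simp only [FlatFormula.size, List.map_nil, List.sum_nil] at h ⊢
  omega

/-! ### The specification of the preprocessing -/

/-- Bounds for the sizes of the parts of a preprocessed formula. -/
structure FlatFormula.Bounded (F : FlatFormula σ P) (m : ℕ) : Prop where
  exNum : F.exNum ≤ m
  length : F.lits.length ≤ 5 * m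
  size : ∀ L ∈ F.lits, L.size ≤ 3 * m
  relSize : (F.lits.map FlatLit.relSize).sum ≤ m

/-- Deduction may repeat a large `e`-free term in many equations, so for these only the number of
literals and the size of each one are bounded. Relational literals are never duplicated, and passing
to representatives preserves their size; hence their total size stays linear. -/
theorem bounded_emit {psort : P → σ.Srt} {F : FlatFormula σ P} {c : Closure σ P} {m : ℕ}
    {H : ∀ M : Model σ, (P ⊕ ℕ → M.carrier) → Prop}
    (hc : c.Inv psort F.exSort F.exNum H m F.lits.length) (hF : F.size ≤ m) (hm : 2 ≤ m) :
    FlatFormula.Bounded { F with lits := (emit F c).val } m := by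
  have h1 := F.exNum_add_length_le_size
  have h2 := hc.count
  refine ⟨?_, ?_, ?_, ?_⟩
  · show F.exNum ≤ m
    omega
  · have h3 := emit_measure F c fun _ => 1
    have h4 : (F.lits.map (FlatLit.normMeasure c.rep fun _ => 1)).sum ≤ F.lits.length := by
      refine (List.sum_le_card_nsmul _ 1 ?_).trans (by simp)
      simp only [List.mem_map, forall_exists_index, and_imp, forall_apply_eq_imp_iff₂]
      intro L _
      cases L <;> simp [FlatLit.normMeasure]
    simp only [List.map_const', List.sum_replicate, smul_eq_mul, mul_one, List.sum_map_add,
      List.length_range, sum_map_range, ← Finset.sum_mul] at h3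
    have h5 : ∑ i ∈ Finset.range F.exNum, (c.bucket i).length = c.entries F.exNum := rfl
    rw [h5] at h3
    show (emit F c).val.length ≤ _
    omega
  · intro L hL
    rcases (mem_emit F c L).1 hL with ⟨i, _, rfl | ⟨x, hx, rfl | rfl⟩⟩ | ⟨x, hx, rfl⟩ |
      ⟨L', hL', _, rfl⟩
    · simp only [FlatLit.size, Atm.size]; omega
    · have := hc.size_bucket i x hx
      simp only [FlatLit.size, Atm.size_norm]; omega
    · have := hc.size_bucket i x hx
      simp only [FlatLit.size, Atm.size_norm]; omega
    · have := hc.size_eqs x hx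
      simp only [FlatLit.size, Atm.size_norm]; omega
    · have := FlatFormula.size_lit_le hL'
      rw [FlatLit.size_norm]; omega
  · refine (emit_measure F c FlatLit.relSize).trans ?_
    have h3 : (F.lits.map (FlatLit.normMeasure c.rep FlatLit.relSize)).sum ≤
        (F.lits.map FlatLit.size).sum := by
      refine List.sum_le_sum fun L _ => ?_
      cases L with
      | pos R as => exact (FlatLit.size_norm c.rep (.pos R as)).le
      | neg R as => exact (FlatLit.size_norm c.rep (.neg R as)).le
      | _ => exact Nat.zero_le _
    have h4 : (F.lits.map FlatLit.size).sum ≤ F.size := Nat.le_add_left _ _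
    simp only [FlatLit.relSize_eq, FlatLit.relSize_app, List.map_const', List.sum_replicate,
      smul_eq_mul, mul_zero, add_zero, zero_add]
    omega

variable [DecidableEq σ.Fn]

theorem preprocess_spec {psort : P → σ.Srt} {φ : Primitive σ P} (hφ : φ.WellFormed psort) :
    (∃ rep, (preprocess φ).val.Reduced psort rep) ∧
      (∀ (M : Model σ) (ρ : P → M.carrier),
        φ.Realize M ρ ↔ ∃ ε, (preprocess φ).val.Sat M ρ ε) ∧
      (preprocess φ).val.Bounded (13 * φ.size) ∧
      (preprocess φ).cost ≤ 22 * (13 * φ.size) ^ 2 := by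
  obtain ⟨hF, hsat⟩ := flatten_spec hφ
  have hsize := flatten_cost_add_size φ
  have hpos : 1 ≤ φ.size := Nat.le_add_left _ _
  -- From here on `m` bounds the cost of flattening together with the size of the flat formula,
  -- hence also each atom, the number of variables and the number of literals.
  generalize hm : 13 * φ.size = m at *
  have hcost : (preprocess φ).cost = (flatten φ).cost + (2 * (flatten φ).val.exNum +
    ((loop initLit ⟨id, fun _ => [], [], []⟩ (flatten φ).val.lits).cost +
      ((closeLoop (flatten φ).val.exNum (flatten φ).val.lits.length
        (loop initLit ⟨id, fun _ => [], [], []⟩ (flatten φ).val.lits).val).cost +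
      ((emit (flatten φ).val (closeLoop (flatten φ).val.exNum (flatten φ).val.lits.length
        (loop initLit ⟨id, fun _ => [], [], []⟩ (flatten φ).val.lits).val).val).cost + 0)))) := rfl
  have hval : (preprocess φ).val = { (flatten φ).val with
    lits := (emit (flatten φ).val (closeLoop (flatten φ).val.exNum (flatten φ).val.lits.length
        (loop initLit ⟨id, fun _ => [], [], []⟩ (flatten φ).val.lits).val).val).val } := rfl
  generalize flatten φ = T at *
  obtain ⟨F, n⟩ := T
  simp only at *
  have h1 := F.exNum_add_length_le_size
  have h0 : Closure.Inv (σ := σ) (P := P) psort F.exSort F.exNum (fun _ _ => True) m 0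
      ⟨id, fun _ => [], [], []⟩ := by
    refine ⟨fun i hi => FlatLit.good_ex_eq_ex.2 ⟨rfl, hi, hi⟩, ?_, ?_, ?_, fun _ => le_rfl,
      fun _ => rfl, fun _ _ => rfl, ?_, fun _ => List.Pairwise.nil, ?_, ?_, ?_, ?_, ?_, ?_⟩
    -- The initial closure, with the identity for representatives and empty lists, asserts nothing.
    on_goal 6 => exact fun M v => ⟨fun _ => trivial, fun _ => ⟨fun _ => rfl, by simp, by simp,
      by simp⟩⟩
    all_goals simp [Closure.entries]
  have h2 := loop_initLit_inv h0 rfl hF fun L hL => (FlatFormula.size_lit_le hL).trans (by omega)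
  have h3 := loop_initLit_cost (c := (⟨id, fun _ => [], [], []⟩ : Closure σ P)) (l := F.lits)
    (n := 0) (by simp)
  generalize loop initLit (⟨id, fun _ => [], [], []⟩ : Closure σ P) F.lits = c at *
  have h4 := h2.count
  obtain ⟨h5, h6, h7⟩ := closeLoop_spec (n := F.lits.length) (D := m) h2 (by omega) (by omega)
  generalize closeLoop F.exNum F.lits.length c.val = c' at *
  have h8 : c'.val.Inv psort F.exSort F.exNum F.Equations m F.lits.length :=
    (h5.congr (fun M v => by simp [FlatFormula.Equations])).mono (by omega)
  refine ⟨⟨c'.val.rep, hval ▸ reduced_emit hF h8⟩, fun M ρ => ?_, ?_, ?_⟩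
  · rw [hsat, hval]
    exact exists_congr fun ε => (sat_emit_iff h8 h6).symm
  · rw [hval]
    exact bounded_emit h8 (by omega) (by omega)
  · have h9 := emit_cost F c'.val
    have h10 := h8.count
    have h11 : (F.lits.map FlatLit.size).sum ≤ F.size := Nat.le_add_left _ _
    have h12 : F.lits.length ≤ m := by omega
    have h13 : F.exNum ≤ m := by omega
    have h14 : c.val.entries F.exNum ≤ m := by omega
    have h15 : c'.cost ≤ 4 * m ^ 2 + 2 * m := by
      zify
      have a1 : (F.lits.length : ℤ) ≤ m := by exact_mod_cast h12
      have a2 : (F.exNum : ℤ) ≤ m := by exact_mod_cast h13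
      have a3 : (c.val.entries F.exNum : ℤ) ≤ m := by exact_mod_cast h14
      have a4 : (0 : ℤ) ≤ c.val.squares F.exNum := by positivity
      have a5 : ((c.val.entries F.exNum : ℤ)) ^ 2 ≤ (m : ℤ) ^ 2 := by gcongr
      have a6 : (F.lits.length : ℤ) * (2 * m + F.exNum + 2) ≤ m * (2 * m + m + 2) := by gcongr
      linarith
    have h16 : F.lits.length * (0 + F.lits.length + 2) ≤ m * (0 + m + 2) := by gcongr
    have h17 : m ≤ m ^ 2 := Nat.le_self_pow two_ne_zero m
    have h18 : m * (0 + m + 2) = m ^ 2 + 2 * m := by ring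
    omega

end Preprocess

/-! ### Marking, Reflexion, and the literals with marked variables only. -/

section Marking

variable {σ : Signature.{u}} {P : Type u}

/-! ### Acyclic definitions -/

/-- Marking puts the newest definition first, whereas acyclicity reads the oldest first; the
reversed list grows at its end. -/
theorem DagFormula.acyclic_append_singleton {seen : List ℕ} {ds : List (ℕ × FlatTerm σ P)} {x : ℕ}
    {t : FlatTerm σ P} (h : Acyclic seen ds) (hx : x ∉ seen) (hx' : x ∉ ds.map Prod.fst)
    (ht : ∀ i, t.toTerm.head = Sum.inr i → i ∈ seen ∨ i ∈ ds.map Prod.fst) :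
    Acyclic seen (ds ++ [(x, t)]) := by
  induction ds generalizing seen with
  | nil => exact ⟨hx, fun i hi => (ht i hi).resolve_right (by simp), trivial⟩
  | cons d ds ih =>
    obtain ⟨y, t'⟩ := d
    simp only [List.map_cons, List.mem_cons, not_or] at hx' ht
    refine ⟨h.1, h.2.1, ih h.2.2 (by simp [hx, hx'.1]) hx'.2 fun i hi => ?_⟩
    simp only [List.mem_cons]
    have := ht i hi
    tauto

theorem DagFormula.Acyclic.nodup {seen : List ℕ} {ds : List (ℕ × FlatTerm σ P)}
    (h : Acyclic seen ds) : (ds.map Prod.fst).Nodup ∧ ∀ x ∈ ds.map Prod.fst, x ∉ seen := by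
  induction ds generalizing seen with
  | nil => simp
  | cons d ds ih =>
    obtain ⟨y, t⟩ := d
    obtain ⟨h1, h2⟩ := ih h.2.2
    refine ⟨List.nodup_cons.2 ⟨fun hy => h2 y hy List.mem_cons_self, h1⟩, ?_⟩
    intro x hx
    rcases List.mem_cons.1 hx with rfl | hx
    · exact h.1
    · exact fun h' => h2 x hx (List.mem_cons_of_mem _ h')

/-! ### Marking -/

/-- The variable is a parameter or marked. -/
def MarkedVar (marks : ℕ → Bool) (x : P ⊕ ℕ) : Prop := ∀ i, x = Sum.inr i → marks i = true

@[simp] theorem markedVar_inl (marks : ℕ → Bool) (p : P) :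
    MarkedVar marks (Sum.inl p : P ⊕ ℕ) := fun _ h => by cases h

@[simp] theorem markedVar_inr {marks : ℕ → Bool} {i : ℕ} :
    MarkedVar marks (Sum.inr i : P ⊕ ℕ) ↔ marks i = true :=
  ⟨fun h => h i rfl, fun h j hj => by cases hj; exact h⟩

theorem Atm.marked_iff {marks : ℕ → Bool} {a : Atm σ P} :
    a.marked marks = true ↔ MarkedVar marks a.toTerm.head := by
  cases a with
  | ex i => exact markedVar_inr.symm
  | free t => simp [marked, toTerm]

/-- The literal is the equation `e_x = t`, up to symmetry. -/
structure FlatLit.Defines (L : FlatLit σ P) (x : ℕ) (t : FlatTerm σ P) : Prop where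
  realize : ∀ (M : Model σ) (v : P ⊕ ℕ → M.carrier),
    L.toQF.Realize M v → v (Sum.inr x) = t.toTerm.eval M v
  sorted : ∀ s, L.toQF.WellSorted s → EqSorted s (.var (Sum.inr x)) t.toTerm
  varsIn : ∀ p, L.toQF.VarsIn p → p (Sum.inr x)

theorem EqSorted.symm {V : Type v} {s : V → σ.Srt} {t t' : Term σ V} (h : EqSorted s t t') :
    EqSorted s t' t := ⟨h.2.1, h.1, h.2.2.symm⟩

theorem markable_some {marks : ℕ → Bool} {L : FlatLit σ P} {i : ℕ} {t : FlatTerm σ P}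
    (h : markable marks L = some (i, t)) :
    marks i = false ∧ MarkedVar marks t.toTerm.head ∧ L.Defines i t := by
  have left : ∀ (a : Atm σ P) j, (FlatLit.eq (.ex j) a).Defines j (.atm a) := fun a j =>
    ⟨fun M v h => h, fun s h => h, fun p h => h.1⟩
  have right : ∀ (a : Atm σ P) j, (FlatLit.eq a (.ex j)).Defines j (.atm a) := fun a j =>
    ⟨fun M v h => Eq.symm h, fun s h => EqSorted.symm h, fun p h => h.2⟩
  cases L with
  | eq a b =>
    cases a with
    | ex j =>
      simp only [markable] at h
      split_ifs at h with h1
      · simp only [Option.some.injEq, Prod.mk.injEq] at h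
        obtain ⟨rfl, rfl⟩ := h
        simp only [Bool.and_eq_true, Bool.not_eq_true'] at h1
        exact ⟨h1.1, Atm.marked_iff.1 h1.2, left b j⟩
      · cases b with
        | ex k =>
          simp only at h
          split_ifs at h with h2
          simp only [Option.some.injEq, Prod.mk.injEq] at h
          obtain ⟨rfl, rfl⟩ := h
          simp only [Bool.and_eq_true, Bool.not_eq_true'] at h2
          exact ⟨h2.1, markedVar_inr.2 h2.2, right (.ex j) k⟩
        | free t => cases h
    | free u =>
      cases b with
      | ex j =>
        simp only [markable] at h
        split_ifs at h with h1
        simp only [Option.some.injEq, Prod.mk.injEq] at h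
        obtain ⟨rfl, rfl⟩ := h
        exact ⟨by simpa using h1, Atm.marked_iff (a := .free u).1 rfl, right (.free u) j⟩
      | free t => cases h
  | app f j a =>
    cases a with
    | ex k =>
      simp only [markable] at h
      split_ifs at h with h1
      simp only [Option.some.injEq, Prod.mk.injEq] at h
      obtain ⟨rfl, rfl⟩ := h
      simp only [Bool.and_eq_true, Bool.not_eq_true'] at h1
      exact ⟨h1.1, markedVar_inr.2 h1.2,
        ⟨fun M v h => Eq.symm h, fun s h => EqSorted.symm h, fun p h => h.2⟩⟩
    | free t => cases h
  | ne a b => cases h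
  | pos R as => cases h
  | neg R as => cases h

/-- This lemma and the next three express saturation: when nothing more can be marked, marks
propagate along every equation. -/
theorem markable_eq_ex_ex {marks : ℕ → Bool} {i j : ℕ}
    (h : markable marks (.eq (.ex i) (.ex j) : FlatLit σ P) = none) : marks i = marks j := by
  cases hi : marks i <;> cases hj : marks j <;> simp [markable, Atm.marked, hi, hj] at h ⊢

theorem markable_eq_ex_free {marks : ℕ → Bool} {i : ℕ} {t : Term σ P}
    (h : markable marks (.eq (.ex i) (.free t)) = none) : marks i = true := by
  cases hi : marks i <;> simp [markable, Atm.marked, hi] at h ⊢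

theorem markable_eq_free_ex {marks : ℕ → Bool} {i : ℕ} {t : Term σ P}
    (h : markable marks (.eq (.free t) (.ex i)) = none) : marks i = true := by
  cases hi : marks i <;> simp [markable, hi] at h ⊢

theorem markable_app {marks : ℕ → Bool} {f : σ.Fn} {i : ℕ} {a : Atm σ P}
    (h : markable marks (.app f i a) = none) (hi : marks i = true) : a.marked marks = true := by
  cases a with
  | ex j => cases hj : marks j <;> simp [markable, Atm.marked, hi, hj] at h ⊢
  | free t => rfl

/-- The invariant of the marking: the marked variables have acyclic definitions taken from `S`. -/
structure Marking.Inv (S : List (FlatLit σ P)) (m : Marking σ P) : Prop where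
  acyclic : DagFormula.Acyclic [] m.defs.reverse
  marks_iff : ∀ i, m.marks i = true ↔ i ∈ m.defs.map Prod.fst
  defines : ∀ d ∈ m.defs, ∃ L ∈ S, L.Defines d.1 d.2

/-- One iteration of the scan. -/
def markStep (m : Marking σ P) (L : FlatLit σ P) : Timed (Marking σ P) :=
  match markable m.marks L with
  | some (i, t) => ret ⟨Function.update m.marks i true, (i, t) :: m.defs, true⟩
  | none => ret m

theorem markStep_spec {S : List (FlatLit σ P)} {m : Marking σ P} {L : FlatLit σ P} (hL : L ∈ S)
    (hm : m.Inv S) : (markStep m L).cost = 0 ∧ (markStep m L).val.Inv S ∧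
      ((markable m.marks L = none ∧ (markStep m L).val = m) ∨
        ((markStep m L).val.changed = true ∧
          (markStep m L).val.defs.length = m.defs.length + 1)) := by
  unfold markStep
  cases h : markable m.marks L with
  | none => exact ⟨rfl, hm, Or.inl ⟨rfl, rfl⟩⟩
  | some d =>
    obtain ⟨i, t⟩ := d
    obtain ⟨h1, h2, h3⟩ := markable_some h
    refine ⟨rfl, ⟨?_, ?_, ?_⟩, Or.inr ⟨rfl, rfl⟩⟩
    · show DagFormula.Acyclic [] ((i, t) :: m.defs).reverse
      rw [List.reverse_cons]
      refine DagFormula.acyclic_append_singleton hm.acyclic (by simp) ?_ fun j hj => Or.inr ?_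
      · rw [List.map_reverse, List.mem_reverse, ← hm.marks_iff, h1]
        simp
      · rw [List.map_reverse, List.mem_reverse, ← hm.marks_iff]
        exact h2 j hj
    · intro j
      show Function.update m.marks i true j = true ↔ j ∈ i :: m.defs.map Prod.fst
      rw [List.mem_cons, ← hm.marks_iff]
      by_cases hj : j = i
      · subst hj; simp
      · simp [hj]
    · intro d hd
      rcases List.mem_cons.1 hd with rfl | hd
      · exact ⟨L, hL, h3⟩
      · exact hm.defines d hd

/-- If no step marks a variable, the marks are constant during the scan, so every literal has been
tested against the final marks. This is why a scan without change certifies saturation. -/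
theorem loop_markStep_spec {S l : List (FlatLit σ P)} {m : Marking σ P} (hl : ∀ L ∈ l, L ∈ S)
    (hm : m.Inv S) : (loop markStep m l).cost = l.length + 1 ∧ (loop markStep m l).val.Inv S ∧
      m.defs.length ≤ (loop markStep m l).val.defs.length ∧
      ((∀ L ∈ l, markable m.marks L = none) ∧ (loop markStep m l).val = m ∨
        ((loop markStep m l).val.changed = true ∧
          m.defs.length < (loop markStep m l).val.defs.length)) := by
  induction l generalizing m with
  | nil => exact ⟨rfl, hm, le_rfl, Or.inl ⟨by simp, rfl⟩⟩
  | cons L l ih =>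
    obtain ⟨h1, h2, h3⟩ := markStep_spec (hl L List.mem_cons_self) hm
    obtain ⟨h4, h5, h6, h7⟩ := ih (fun L' hL' => hl L' (List.mem_cons_of_mem _ hL')) h2
    rw [loop_cons_cost, loop_cons_val]
    refine ⟨?_, h5, ?_, ?_⟩
    · rw [h1, h4, List.length_cons]; omega
    · rcases h3 with ⟨_, h3⟩ | ⟨_, h3⟩
      · rwa [h3] at h6 ⊢
      · omega
    · rcases h3 with ⟨h3, h3'⟩ | ⟨h3, h3'⟩
      · rw [h3'] at h7 ⊢
        refine h7.imp_left fun h => ⟨?_, h.2⟩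
        simpa using ⟨h3, h.1⟩
      · right
        rcases h7 with ⟨_, h7⟩ | h7
        · rw [h7]; exact ⟨h3, by omega⟩
        · exact ⟨h7.1, by omega⟩

/-- Pigeonhole: the defined variables are distinct and among the first `N`. -/
theorem Marking.Inv.length_le {S : List (FlatLit σ P)} {N : ℕ} {m : Marking σ P} (hm : m.Inv S)
    (hS : ∀ L ∈ S, L.toQF.VarsIn (Below N)) :
    m.defs.length ≤ N ∧ (N ≤ m.defs.length → ∀ i < N, m.marks i = true) := by
  have h1 := hm.acyclic.nodup.1
  rw [List.map_reverse, List.nodup_reverse] at h1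
  have h2 : (m.defs.map Prod.fst).toFinset ⊆ Finset.range N := by
    intro i hi
    obtain ⟨d, hd, rfl⟩ := List.mem_map.1 (List.mem_toFinset.1 hi)
    obtain ⟨L, hL, hLd⟩ := hm.defines d hd
    exact Finset.mem_range.2 (below_inr.1 (hLd.varsIn _ (hS L hL)))
  have h3 := List.toFinset_card_of_nodup h1
  rw [List.length_map] at h3
  refine ⟨?_, fun h i hi => ?_⟩
  · simpa [h3] using Finset.card_le_card h2
  · have h4 := Finset.eq_of_subset_of_card_le h2 (by rw [h3, Finset.card_range]; exact h)
    rw [hm.marks_iff, ← List.mem_toFinset, h4]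
    exact Finset.mem_range.2 hi

/-- Each scan either ends the loop or marks a variable, so `N - m.defs.length` further scans are
enough. If the counter runs out, all variables are marked and saturation is automatic. -/
theorem markLoop_spec {S : List (FlatLit σ P)} {N n : ℕ} {m : Marking σ P}
    (hS : ∀ L ∈ S, L.toQF.VarsIn (Below N)) (hm : m.Inv S) (hn : N ≤ m.defs.length + n) :
    (markLoop S n m).val.Inv S ∧ (∀ L ∈ S, markable (markLoop S n m).val.marks L = none) ∧
      (markLoop S n m).cost ≤ n * (S.length + 2) := by
  induction n generalizing m with
  | zero =>
    refine ⟨hm, fun L hL => ?_, Nat.zero_le _⟩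
    show markable m.marks L = none
    cases h : markable m.marks L with
    | none => rfl
    | some d =>
      obtain ⟨h1, _, h3⟩ := markable_some (i := d.1) (t := d.2) h
      have h4 := (hm.length_le hS).2 hn d.1 (below_inr.1 (h3.varsIn _ (hS L hL)))
      rw [h1] at h4
      cases h4
  | succ n ih =>
    have hm' : Marking.Inv S { m with changed := false } := ⟨hm.1, hm.2, hm.3⟩
    obtain ⟨h1, h2, _, h4⟩ := loop_markStep_spec (l := S) (fun _ h => h) hm'
    have h5 : markScan S m = loop markStep { m with changed := false } S := rfl
    rw [← h5] at h1 h2 h4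
    simp only [markLoop, tick_val, bind_val, tick_cost, bind_cost, h1]
    rcases h4 with ⟨h4, h6⟩ | ⟨h4, h6⟩
    · rw [h6] at h2 ⊢
      simp only [Bool.false_eq_true, if_false, ret_val, ret_cost]
      refine ⟨h2, h4, ?_⟩
      nlinarith [Nat.zero_le (n * (S.length + 2))]
    · rw [h4]
      simp only [if_true]
      simp only at h6
      obtain ⟨h7, h8, h9⟩ := ih h2 (by omega)
      refine ⟨h7, h8, ?_⟩
      nlinarith

theorem reflexion_val (S : List (FlatLit σ P)) :
    (reflexion S).val = true ↔ ∃ i, .ne (.ex i) (.ex i) ∈ S := by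
  have h : ∀ (l : List (FlatLit σ P)) (r : Bool), (loop (fun (r : Bool) (L : FlatLit σ P) =>
    match L with
    | .ne (.ex i) (.ex j) => ret (r || decide (i = j))
    | _ => ret r) r l).val = true ↔ r = true ∨ ∃ i, .ne (.ex i) (.ex i) ∈ l := by
    intro l
    induction l with
    | nil => simp
    | cons L l ih =>
      intro r
      rw [loop_cons_val, ih]
      cases L with
      | ne a b =>
        cases a with
        | ex i =>
          cases b with
          | ex j =>
            simp only [ret_val, Bool.or_eq_true, decide_eq_true_eq, List.mem_cons,
              FlatLit.ne.injEq, Atm.ex.injEq, exists_or, or_assoc]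
            refine or_congr_right (or_congr_left ⟨?_, ?_⟩)
            · rintro rfl; exact ⟨i, rfl, rfl⟩
            · rintro ⟨k, rfl, rfl⟩; rfl
          | free t => simp
        | free t => simp
      | _ => simp
  exact (h S false).trans (by simp)

theorem reflexion_cost (S : List (FlatLit σ P)) : (reflexion S).cost ≤ S.length + 1 := by
  refine (loop_cost_le (fun _ => 0) ?_).trans (by simp)
  intro r L _
  cases L with
  | ne a b => cases a <;> cases b <;> exact le_rfl
  | _ => exact le_rfl

/-! ### Writing literals -/

@[simp] theorem writeTerm_val (t : Term σ P) : (writeTerm t).val = t.lift := by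
  induction t with
  | var x => rfl
  | app f t ih => simp [writeTerm, Term.lift, ih]

theorem writeTerm_cost (t : Term σ P) : (writeTerm t).cost = t.size := by
  induction t with
  | var x => rfl
  | app f t ih => simp only [writeTerm, tick_cost, bind_cost, ih, ret_cost, Term.size]; omega

@[simp] theorem writeAtm_val (a : Atm σ P) : (writeAtm a).val = a.toTerm := by
  cases a with
  | ex i => rfl
  | free t => exact writeTerm_val t

theorem writeAtm_cost (a : Atm σ P) : (writeAtm a).cost ≤ a.size + 1 := by
  cases a with
  | ex i => exact Nat.le_succ _
  | free t => simp only [writeAtm, tick_cost, writeTerm_cost, Atm.size]; omega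

@[simp] theorem writeList_val (as : List (Atm σ P)) :
    (writeList as).val = as.map Atm.toTerm := by
  induction as with
  | nil => rfl
  | cons a as ih => simp [writeList, ih]

theorem writeList_cost (as : List (Atm σ P)) :
    (writeList as).cost ≤ 3 * (as.map Atm.size).sum + 1 := by
  induction as with
  | nil => simp [writeList]
  | cons a as ih =>
    have h1 := writeAtm_cost a
    have h2 := a.one_le_size
    simp only [writeList, tick_cost, bind_cost, ret_cost, List.map_cons, List.sum_cons]
    omega

@[simp] theorem writeLit_val (L : FlatLit σ P) : (writeLit L).val = L.toQF := by
  cases L <;> simp [writeLit, FlatLit.toQF]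

theorem writeLit_cost (L : FlatLit σ P) : (writeLit L).cost ≤ 3 * L.size := by
  cases L with
  | eq a b =>
    have h1 := writeAtm_cost a
    have h2 := writeAtm_cost b
    simp only [writeLit, bind_cost, ret_cost, FlatLit.size]; omega
  | app f i a =>
    have h1 := writeAtm_cost a
    simp only [writeLit, bind_cost, ret_cost, FlatLit.size]; omega
  | ne a b =>
    have h1 := writeAtm_cost a
    have h2 := writeAtm_cost b
    simp only [writeLit, bind_cost, ret_cost, FlatLit.size]; omega
  | pos R as =>
    have h1 := writeList_cost as
    simp only [writeLit, bind_cost, ret_cost, FlatLit.size]; omega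
  | neg R as =>
    have h1 := writeList_cost as
    simp only [writeLit, bind_cost, ret_cost, FlatLit.size]; omega

theorem allMarked_val {marks : ℕ → Bool} {as : List (Atm σ P)} :
    (allMarked marks as).val = true ↔ ∀ a ∈ as, MarkedVar marks a.toTerm.head := by
  induction as with
  | nil => simp [allMarked]
  | cons a as ih =>
    simp only [allMarked, tick_val, List.mem_cons, forall_eq_or_imp, ← Atm.marked_iff] at ih ⊢
    cases a.marked marks <;> simp [ih]

theorem allMarked_cost (marks : ℕ → Bool) (as : List (Atm σ P)) :
    (allMarked marks as).cost ≤ (as.map Atm.size).sum + 1 := by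
  induction as with
  | nil => simp [allMarked]
  | cons a as ih =>
    have h1 := a.one_le_size
    simp only [allMarked, tick_cost, List.map_cons, List.sum_cons]
    cases a.marked marks
    · simp only [Bool.false_eq_true, if_false, ret_cost]; omega
    · simp only [if_true]; omega

theorem litMarked_val {marks : ℕ → Bool} {L : FlatLit σ P} :
    (litMarked marks L).val = true ↔ L.toQF.VarsIn (MarkedVar marks) := by
  cases L with
  | eq a b => simp [litMarked, Atm.marked_iff, FlatLit.toQF, QF.VarsIn]
  | app f i a => simp [litMarked, Atm.marked_iff, FlatLit.toQF, QF.VarsIn, Term.head]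
  | ne a b => simp [litMarked, Atm.marked_iff, FlatLit.toQF, QF.VarsIn]
  | pos R as => simp [litMarked, allMarked_val, FlatLit.toQF, QF.VarsIn]
  | neg R as => simp [litMarked, allMarked_val, FlatLit.toQF, QF.VarsIn]

theorem litMarked_cost (marks : ℕ → Bool) (L : FlatLit σ P) :
    (litMarked marks L).cost ≤ L.size := by
  cases L with
  | pos R as => exact allMarked_cost marks as
  | neg R as => exact allMarked_cost marks as
  | _ => exact Nat.zero_le _

/-- The predicate `Φ` is arbitrary so that one analysis of the output serves for truth,
well-sortedness and the occurring variables, all of which distribute over conjunction. -/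
theorem loop_conjunction_iff {α : Type*} {body : QF σ (P ⊕ ℕ) → α → Timed (QF σ (P ⊕ ℕ))}
    (Φ : QF σ (P ⊕ ℕ) → Prop) (A : α → Prop) {l : List α} {out : QF σ (P ⊕ ℕ)}
    (h : ∀ out, ∀ x ∈ l, Φ (body out x).val ↔ Φ out ∧ A x) :
    Φ (loop body out l).val ↔ Φ out ∧ ∀ x ∈ l, A x := by
  induction l generalizing out with
  | nil => simp
  | cons x l ih =>
    rw [loop_cons_val, ih fun out y hy => h out y (List.mem_cons_of_mem _ hy),
      h out x List.mem_cons_self]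
    simp [and_assoc]

theorem conjoinMarked_iff {Φ : QF σ (P ⊕ ℕ) → Prop} (hΦ : ∀ q q', Φ (.and q q') ↔ Φ q ∧ Φ q')
    (marks : ℕ → Bool) (S : List (FlatLit σ P)) (out : QF σ (P ⊕ ℕ)) :
    Φ (conjoinMarked marks S out).val ↔
      Φ out ∧ ∀ L ∈ S, L.toQF.VarsIn (MarkedVar marks) → Φ L.toQF := by
  refine loop_conjunction_iff Φ _ fun out L _ => ?_
  rw [← litMarked_val, bind_val]
  cases (litMarked marks L).val <;> simp [hΦ]

theorem conjoinMarked_cost (marks : ℕ → Bool) {S : List (FlatLit σ P)} (out : QF σ (P ⊕ ℕ))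
    {B : ℕ} (hB : ∀ L ∈ S, L.size ≤ B) :
    (conjoinMarked marks S out).cost ≤ S.length * (4 * B + 1) + 1 := by
  refine (loop_cost_le (fun _ => 4 * B) fun out L hL => ?_).trans ?_
  · have h1 := litMarked_cost marks L
    have h2 := writeLit_cost L
    have h3 := hB L hL
    rw [bind_cost]
    cases (litMarked marks L).val
    · simp only [Bool.false_eq_true, if_false, ret_cost]; omega
    · simp only [if_true, bind_cost, ret_cost]; omega
  · simp only [List.map_const', List.sum_replicate, smul_eq_mul]
    nlinarith

end Marking

/-! ### Resolution: constraints, clauses, cost. -/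

section ResolutionSpec

variable {σ : Signature.{u}} {P : Type u}

/-! ### Resolution -/

section UnifyE

variable [DecidableEq σ.Fn] [DecidableEq P]

theorem termEq_val {t t' : Term σ P} : (termEq t t').val = true ↔ t = t' := by
  induction t generalizing t' with
  | var x => cases t' <;> simp [termEq]
  | app f t ih =>
    cases t' with
    | var y => simp [termEq]
    | app g t' =>
      by_cases h : f = g
      · simp [termEq, h, ih]
      · simp [termEq, h]

theorem termEq_cost (t t' : Term σ P) : (termEq t t').cost ≤ t.size := by
  induction t generalizing t' with
  | var x => cases t' <;> simp [termEq, Term.size]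
  | app f t ih =>
    cases t' with
    | var y => simp [termEq, Term.size]
    | app g t' =>
      have := ih t'
      by_cases h : f = g
      · simp only [termEq, h, if_true, tick_cost, Term.size]; omega
      · simp [termEq, h, Term.size]

theorem atmEq_val {a b : Atm σ P} : (atmEq a b).val = true ↔ a = b := by
  cases a <;> cases b <;> simp [atmEq, termEq_val]

theorem atmEq_cost (a b : Atm σ P) : (atmEq a b).cost ≤ a.size + 1 := by
  cases a with
  | ex i => cases b <;> simp [atmEq, Atm.size]
  | free t =>
    cases b with
    | ex j => simp [atmEq]
    | free t' =>
      have := termEq_cost t t'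
      simp only [atmEq, tick_cost, Atm.size]; omega

theorem unifyE_cost (marks : ℕ → Bool) (C : List (Atm σ P × Atm σ P)) (as bs : List (Atm σ P)) :
    (unifyE marks C as bs).cost ≤ 3 * (as.map Atm.size).sum + 1 := by
  induction as generalizing C bs with
  | nil => cases bs <;> simp [unifyE]
  | cons a as ih =>
    cases bs with
    | nil => simp [unifyE]
    | cons b bs =>
      have h1 := atmEq_cost a b
      have h2 := a.one_le_size
      have h3 := ih C bs
      have h4 := ih ((a, b) :: C) bs
      simp only [unifyE, tick_cost, bind_cost, List.map_cons, List.sum_cons]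
      split_ifs
      · omega
      · omega
      · simp only [ret_cost]; omega

/-- The number of symbols of a list of constraints. -/
def constraintsSize (C : List (Atm σ P × Atm σ P)) : ℕ :=
  (C.map fun p => p.1.size + p.2.size).sum

/-- What soundness needs: if the constraints hold, the two lists have equal values. Membership in
`as.zip bs` serves the sorts, the last bound the cost of writing the clause. -/
theorem unifyE_some {marks : ℕ → Bool} {C C' : List (Atm σ P × Atm σ P)} {as bs : List (Atm σ P)}
    (h : (unifyE marks C as bs).val = some C') :
    (∀ p ∈ C, p ∈ C') ∧ List.Forall₂ (fun a b => a = b ∨ (a, b) ∈ C') as bs ∧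
      (∀ p ∈ C', p ∈ C ∨ p.1.marked marks = true ∧ p.2.marked marks = true ∧ p ∈ as.zip bs) ∧
      constraintsSize C' ≤
        constraintsSize C + (as.map Atm.size).sum + (bs.map Atm.size).sum := by
  induction as generalizing C bs with
  | nil =>
    cases bs with
    | nil =>
      simp only [unifyE, tick_val, ret_val, Option.some.injEq] at h
      subst h
      exact ⟨fun _ h => h, List.Forall₂.nil, fun _ h => Or.inl h, by simp⟩
    | cons b bs => simp [unifyE] at h
  | cons a as ih =>
    cases bs with
    | nil => simp [unifyE] at h
    | cons b bs =>
      simp only [unifyE, tick_val, bind_val] at h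
      split_ifs at h with h1 h2
      · obtain ⟨h3, h4, h5, h6⟩ := ih h
        refine ⟨h3, List.Forall₂.cons (Or.inl (atmEq_val.1 h1)) h4, fun p hp => ?_, ?_⟩
        · exact (h5 p hp).imp_right fun h => ⟨h.1, h.2.1, List.mem_cons_of_mem _ h.2.2⟩
        · simp only [List.map_cons, List.sum_cons]; omega
      · obtain ⟨h3, h4, h5, h6⟩ := ih h
        rw [Bool.and_eq_true] at h2
        refine ⟨fun p hp => h3 p (List.mem_cons_of_mem _ hp),
          List.Forall₂.cons (Or.inr (h3 _ List.mem_cons_self)) h4, fun p hp => ?_, ?_⟩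
        · rcases h5 p hp with h7 | h7
          · rcases List.mem_cons.1 h7 with rfl | h7
            · exact Or.inr ⟨h2.1, h2.2, List.mem_cons_self⟩
            · exact Or.inl h7
          · exact Or.inr ⟨h7.1, h7.2.1, List.mem_cons_of_mem _ h7.2.2⟩
        · simp only [constraintsSize, List.map_cons, List.sum_cons] at h6 ⊢; omega
      · cases h

/-- What completeness needs, with `Q` meaning equality of values: lists that agree up to equal
parametric values do not make `E` fail, and all the constraints obtained are true. -/
theorem exists_unifyE_eq_some {marks : ℕ → Bool} {Q : Atm σ P → Atm σ P → Prop}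
    {C : List (Atm σ P × Atm σ P)} {as bs : List (Atm σ P)}
    (h : List.Forall₂
      (fun a b => a = b ∨ a.marked marks = true ∧ b.marked marks = true ∧ Q a b) as bs) :
    ∃ C', (unifyE marks C as bs).val = some C' ∧ ∀ p ∈ C', p ∈ C ∨ Q p.1 p.2 := by
  induction h generalizing C with
  | nil => exact ⟨C, rfl, fun _ h => Or.inl h⟩
  | @cons a b as bs hab _ ih =>
    simp only [unifyE, tick_val, bind_val]
    by_cases h1 : a = b
    · rw [if_pos (atmEq_val.2 h1)]
      exact ih
    · have h2 := hab.resolve_left h1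
      rw [if_neg (fun h => h1 (atmEq_val.1 h)), if_pos (by simp [h2.1, h2.2.1])]
      obtain ⟨C', h3, h4⟩ := ih (C := (a, b) :: C)
      refine ⟨C', h3, fun p hp => ?_⟩
      rcases h4 p hp with h5 | h5
      · rcases List.mem_cons.1 h5 with rfl | h5
        · exact Or.inr h2.2.2
        · exact Or.inl h5
      · exact Or.inr h5

end UnifyE

theorem writeClause_cost (C : List (Atm σ P × Atm σ P)) :
    (writeClause C).cost ≤ 3 * constraintsSize C + 1 := by
  induction C with
  | nil => simp [writeClause]
  | cons p C ih =>
    obtain ⟨a, b⟩ := p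
    have h1 := writeAtm_cost a
    have h2 := writeAtm_cost b
    have h3 := a.one_le_size
    have h4 := b.one_le_size
    simp only [constraintsSize, writeClause, tick_cost, bind_cost, ret_cost, List.map_cons,
      List.sum_cons] at ih ⊢
    omega

theorem realize_writeClause {M : Model σ} {v : P ⊕ ℕ → M.carrier}
    {C : List (Atm σ P × Atm σ P)} : (writeClause C).val.Realize M v ↔
      ∃ p ∈ C, p.1.toTerm.eval M v ≠ p.2.toTerm.eval M v := by
  induction C with
  | nil => simp [writeClause, QF.Realize]
  | cons p C ih =>
    obtain ⟨a, b⟩ := p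
    simp [writeClause, QF.Realize, ih]

theorem wellSorted_writeClause {s : P ⊕ ℕ → σ.Srt} {C : List (Atm σ P × Atm σ P)} :
    (writeClause C).val.WellSorted s ↔ ∀ p ∈ C, EqSorted s p.1.toTerm p.2.toTerm := by
  induction C with
  | nil => simp [writeClause, QF.WellSorted]
  | cons p C ih =>
    obtain ⟨a, b⟩ := p
    simp [writeClause, QF.WellSorted, ih]

theorem varsIn_writeClause {q : P ⊕ ℕ → Prop} {C : List (Atm σ P × Atm σ P)} :
    (writeClause C).val.VarsIn q ↔ ∀ p ∈ C, q p.1.toTerm.head ∧ q p.2.toTerm.head := by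
  induction C with
  | nil => simp [writeClause, QF.VarsIn]
  | cons p C ih =>
    obtain ⟨a, b⟩ := p
    simp [writeClause, QF.VarsIn, ih]

variable [DecidableEq σ.Fn] [DecidableEq σ.Rel] [DecidableEq P]

theorem resolveWith_iff {Φ : QF σ (P ⊕ ℕ) → Prop} (hΦ : ∀ q q', Φ (.and q q') ↔ Φ q ∧ Φ q')
    (marks : ℕ → Bool) (R : σ.Rel) (as : List (Atm σ P)) (S : List (FlatLit σ P))
    (out : QF σ (P ⊕ ℕ)) :
    Φ (resolveWith marks R as S out).val ↔ Φ out ∧ ∀ L ∈ S, ∀ bs, L = .neg R bs →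
      ∀ C, (unifyE marks [] as bs).val = some C → Φ (writeClause C).val := by
  refine loop_conjunction_iff Φ _ fun out L _ => ?_
  cases L with
  | neg R' bs =>
    by_cases h : R = R'
    · subst h
      simp only [if_true, bind_val, FlatLit.neg.injEq, true_and, forall_eq']
      cases (unifyE marks [] as bs).val <;> simp [hΦ]
    · simp [h, Ne.symm h]
  | _ => simp

theorem resolution_iff {Φ : QF σ (P ⊕ ℕ) → Prop} (hΦ : ∀ q q', Φ (.and q q') ↔ Φ q ∧ Φ q')
    (marks : ℕ → Bool) (S : List (FlatLit σ P)) (out : QF σ (P ⊕ ℕ)) :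
    Φ (resolution marks S out).val ↔ Φ out ∧ ∀ R as, .pos R as ∈ S →
      ¬ (∀ a ∈ as, MarkedVar marks a.toTerm.head) → ∀ bs, .neg R bs ∈ S →
      ∀ C, (unifyE marks [] as bs).val = some C → Φ (writeClause C).val := by
  have h : Φ (resolution marks S out).val ↔ Φ out ∧ ∀ L ∈ S, ∀ R as, L = .pos R as →
      ¬ (∀ a ∈ as, MarkedVar marks a.toTerm.head) → ∀ bs, .neg R bs ∈ S →
      ∀ C, (unifyE marks [] as bs).val = some C → Φ (writeClause C).val := by
    refine loop_conjunction_iff Φ _ fun out L _ => ?_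
    cases L with
    | pos R as =>
      simp only [bind_val, FlatLit.pos.injEq, and_imp, ← allMarked_val]
      have h1 : ∀ A : σ.Rel → List (Atm σ P) → Prop,
          (∀ R' as', R = R' → as = as' → A R' as') ↔ A R as :=
        fun A => ⟨fun h => h R as rfl rfl, fun h R' as' hR ha => hR ▸ ha ▸ h⟩
      rw [h1]
      cases hb : (allMarked marks as).val
      · simp only [Bool.false_eq_true, if_false, not_false_eq_true, true_imp_iff,
          resolveWith_iff hΦ]
        refine and_congr_right fun _ => ⟨fun h bs hbs => h _ hbs bs rfl, ?_⟩
        rintro h L hL bs rfl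
        exact h bs hL
      · simp
    | _ => simp
  rw [h]
  refine and_congr_right fun _ => ⟨fun h R as hL => h _ hL R as rfl, ?_⟩
  rintro h L hL R as rfl
  exact h R as hL

/-- One pair costs at most three steps per symbol of `as` for unification and three per symbol of
`as` and `bs` for the clause; summing over `S` separates the two sizes. -/
theorem resolveWith_cost (marks : ℕ → Bool) (R : σ.Rel) (as : List (Atm σ P))
    (S : List (FlatLit σ P)) (out : QF σ (P ⊕ ℕ)) :
    (resolveWith marks R as S out).cost ≤
      S.length * (6 * (FlatLit.pos R as).relSize + 1) + 6 * (S.map FlatLit.relSize).sum + 1 := by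
  refine (loop_cost_le (fun L => 6 * (FlatLit.pos R as).relSize + 6 * L.relSize)
    fun out L _ => ?_).trans ?_
  · cases L with
    | neg R' bs =>
      simp only
      split_ifs with h
      · have h1 := unifyE_cost marks [] as bs
        rw [bind_cost]
        cases hC : (unifyE marks [] as bs).val with
        | none =>
          simp only [ret_cost, FlatLit.relSize, FlatLit.size]; omega
        | some C =>
          have h2 := (unifyE_some hC).2.2.2
          have h3 := writeClause_cost C
          have h4 : constraintsSize ([] : List (Atm σ P × Atm σ P)) = 0 := rfl
          simp only [bind_cost, ret_cost, FlatLit.relSize, FlatLit.size]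
          omega
      · exact Nat.zero_le _
    | _ => exact Nat.zero_le _
  · rw [List.sum_map_add, List.sum_map_mul_left (f := FlatLit.relSize)]
    simp only [List.map_const', List.sum_replicate, smul_eq_mul]
    nlinarith

/-- A positive literal of size `k` costs at most `(30 * m + 1) * k + 11 * m + 1`. The first part
sums over total size at most `m`, the second over at most `5 * m` literals. -/
theorem resolution_cost (marks : ℕ → Bool) (S : List (FlatLit σ P)) (out : QF σ (P ⊕ ℕ)) {m : ℕ}
    (hS : S.length ≤ 5 * m) (hm : (S.map FlatLit.relSize).sum ≤ m) :
    (resolution marks S out).cost ≤ 85 * m ^ 2 + 11 * m + 1 := by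
  refine (loop_cost_le (fun L => (30 * m + 1) * L.relSize + (11 * m + 1))
    fun out L _ => ?_).trans ?_
  · cases L with
    | pos R as =>
      have h1 := allMarked_cost marks as
      rw [bind_cost]
      have h2 : (FlatLit.pos R as).relSize = (as.map Atm.size).sum + 1 := rfl
      cases (allMarked marks as).val
      · have h3 := resolveWith_cost marks R as S out
        simp only [Bool.false_eq_true, if_false]
        have h4 : S.length * (6 * (FlatLit.pos R as).relSize + 1) ≤
          5 * m * (6 * (FlatLit.pos R as).relSize + 1) := by gcongr
        rw [← h2] at h1
        nlinarith
      · simp only [if_true, ret_cost]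
        rw [← h2] at h1
        nlinarith [Nat.zero_le (m * (FlatLit.pos R as).relSize)]
    | _ => exact Nat.zero_le _
  · rw [List.sum_map_add, List.sum_map_mul_left]
    simp only [List.map_const', List.sum_replicate, smul_eq_mul]
    have h1 : (30 * m + 1) * (S.map FlatLit.relSize).sum ≤ (30 * m + 1) * m := by gcongr
    have h2 : S.length * (11 * m + 1) ≤ 5 * m * (11 * m + 1) := by gcongr
    nlinarith

end ResolutionSpec

/-! ### The model extension behind completeness. -/

section Extension

variable {σ : Signature.{u}} {P : Type u}

/-! ### Extending a model by new elements -/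

open Classical in
/-- The extension of `M` by new elements `e_i` of sorts `s i`: the value of `f` at `e_i` is an `x` with
`g f i x`, if there is one of the right sort, and `r` adds instances of the relations. -/
noncomputable def Model.extend (M : Model σ) (s : ℕ → σ.Srt)
    (g : σ.Fn → ℕ → M.carrier ⊕ ULift.{u} ℕ → Prop)
    (r : σ.Rel → List (M.carrier ⊕ ULift.{u} ℕ) → Prop) : Model σ where
  carrier := M.carrier ⊕ ULift.{u} ℕ
  sort := Sum.elim M.sort fun i => s i.down
  sort_surjective := fun x =>
    let ⟨y, hy⟩ := M.sort_surjective x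
    ⟨Sum.inl y, hy⟩
  fn := fun f => Sum.elim (fun x => Sum.inl (M.fn f x)) fun i =>
    if h : ∃ x, g f i.down x ∧ Sum.elim M.sort (fun i => s i.down) x = σ.cod f then h.choose
    else Sum.inl (M.sort_surjective (σ.cod f)).choose
  sort_fn := by
    rintro f (x | i) hx
    · exact M.sort_fn f x hx
    · simp only [Sum.elim_inr]
      split_ifs with h
      · exact h.choose_spec.2
      · exact (M.sort_surjective (σ.cod f)).choose_spec
  rel := fun R xs => (∃ ys, xs = ys.map Sum.inl ∧ M.rel R ys) ∨ r R xs

section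

variable {M : Model σ} {s : ℕ → σ.Srt} {g : σ.Fn → ℕ → M.carrier ⊕ ULift.{u} ℕ → Prop}
  {r : σ.Rel → List (M.carrier ⊕ ULift.{u} ℕ) → Prop}

theorem Model.extend_fn_inr {f : σ.Fn} {i : ℕ} {x : M.carrier ⊕ ULift.{u} ℕ}
    (hx : g f i x) (hs : Sum.elim M.sort (fun i => s i.down) x = σ.cod f)
    (huniq : ∀ y, g f i y → y = x) : (M.extend s g r).fn f (Sum.inr ⟨i⟩) = x := by
  have h : ∃ x, g f i x ∧ Sum.elim M.sort (fun i => s i.down) x = σ.cod f := ⟨x, hx, hs⟩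
  have h' : (M.extend s g r).fn f (Sum.inr ⟨i⟩) = h.choose := by
    simp only [Model.extend, Sum.elim_inr]
    rw [dif_pos h]
  rw [h']
  exact huniq _ h.choose_spec.1

theorem Model.extend_eval {V : Type v} (t : Term σ V) (τ : V → M.carrier) :
    t.eval (M.extend s g r) (fun x => Sum.inl (τ x)) = Sum.inl (t.eval M τ) := by
  induction t with
  | var x => rfl
  | app f t ih => exact congrArg ((M.extend s g r).fn f) ih

/-- Since `r` adds no tuple of old elements, `M` is a substructure, and quantifier-free formulas are
preserved in both directions. -/
theorem Model.extend_realize (hr : ∀ R (ys : List M.carrier), ¬ r R (ys.map Sum.inl)) {V : Type v} (q : QF σ V)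
    (τ : V → M.carrier) :
    q.Realize (M.extend s g r) (fun x => Sum.inl (τ x)) ↔ q.Realize M τ := by
  induction q with
  | bot => exact Iff.rfl
  | eq t t' =>
    simp only [QF.Realize, Model.extend_eval]
    exact Sum.inl_injective.eq_iff
  | rel R ts =>
    have h : ts.map (Term.eval (M.extend s g r) fun x => Sum.inl (τ x)) =
        (ts.map (Term.eval M τ)).map Sum.inl := by
      rw [List.map_map]
      exact List.map_congr_left fun t _ => Model.extend_eval t τ
    simp only [QF.Realize, h]
    constructor
    · rintro (⟨ys, h1, h2⟩ | h)
      · rwa [List.map_injective_iff.2 Sum.inl_injective h1]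
      · exact absurd h (hr R _)
    · exact fun h => Or.inl ⟨_, rfl, h⟩
  | neg q ih => exact not_congr ih
  | and q q' ih ih' => exact and_congr ih ih'
  | or q q' ih ih' => exact or_congr ih ih'

end

/-! ### The matrix of the output -/

variable [DecidableEq σ.Fn] [DecidableEq σ.Rel] [DecidableEq P]

/-- The quantifier-free formula `OUT`. -/
def outputMatrix (marks : ℕ → Bool) (S : List (FlatLit σ P)) : QF σ (P ⊕ ℕ) :=
  (resolution marks S (conjoinMarked marks S .top).val).val

theorem outputMatrix_iff {Φ : QF σ (P ⊕ ℕ) → Prop} (hΦ : ∀ q q', Φ (.and q q') ↔ Φ q ∧ Φ q')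
    (htop : Φ .top) (marks : ℕ → Bool) (S : List (FlatLit σ P)) :
    Φ (outputMatrix marks S) ↔ (∀ L ∈ S, L.toQF.VarsIn (MarkedVar marks) → Φ L.toQF) ∧
      ∀ R as, .pos R as ∈ S → ¬ (∀ a ∈ as, MarkedVar marks a.toTerm.head) →
        ∀ bs, .neg R bs ∈ S → ∀ C, (unifyE marks [] as bs).val = some C →
          Φ (writeClause C).val := by
  rw [outputMatrix, resolution_iff hΦ, conjoinMarked_iff hΦ]
  simp [htop]

theorem varsIn_outputMatrix (marks : ℕ → Bool) (S : List (FlatLit σ P)) :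
    (outputMatrix marks S).VarsIn (MarkedVar marks) := by
  refine (outputMatrix_iff (fun _ _ => Iff.rfl) trivial marks S).2 ⟨fun L _ h => h, ?_⟩
  intro R as _ _ bs _ C hC
  refine varsIn_writeClause.2 fun p hp => ?_
  have h := ((unifyE_some hC).2.2.1 p hp).resolve_left (by simp)
  exact ⟨Atm.marked_iff.1 h.1, Atm.marked_iff.1 h.2.1⟩

theorem eq_of_mem_zip_of_map_eq {α β : Type*} {f : α → β} {as bs : List α}
    (h : as.map f = bs.map f) {p : α × α} (hp : p ∈ as.zip bs) : f p.1 = f p.2 := by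
  induction as generalizing bs with
  | nil => simp at hp
  | cons a as ih =>
    cases bs with
    | nil => simp at hp
    | cons b bs =>
      simp only [List.map_cons, List.cons.injEq] at h
      rcases List.mem_cons.1 hp with rfl | hp
      · exact h.1
      · exact ih h.2 hp

/-- A constraint pairs arguments in the same position of the same relation symbol, so their sorts
agree. -/
theorem wellSorted_outputMatrix {s : P ⊕ ℕ → σ.Srt} (marks : ℕ → Bool) {S : List (FlatLit σ P)}
    (hS : ∀ L ∈ S, L.toQF.WellSorted s) : (outputMatrix marks S).WellSorted s := by
  refine (outputMatrix_iff (fun _ _ => Iff.rfl) trivial marks S).2 ⟨fun L hL _ => hS L hL, ?_⟩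
  intro R as has _ bs hbs C hC
  refine wellSorted_writeClause.2 fun p hp => ?_
  have h := ((unifyE_some hC).2.2.1 p hp).resolve_left (by simp)
  obtain ⟨h1, h2⟩ := hS _ has
  obtain ⟨h3, h4⟩ := hS _ hbs
  have h5 := List.of_mem_zip h.2.2
  refine ⟨h1 _ (List.mem_map_of_mem h5.1), h3 _ (List.mem_map_of_mem h5.2), ?_⟩
  have h6 := h2.trans h4.symm
  rw [List.map_map, List.map_map] at h6
  exact eq_of_mem_zip_of_map_eq h6 h.2.2

/-- Soundness of Resolution: were all constraints true, `R(as)` and `¬ R(bs)` would speak of the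
same tuple. -/
theorem realize_outputMatrix {M : Model σ} {v : P ⊕ ℕ → M.carrier} (marks : ℕ → Bool)
    {S : List (FlatLit σ P)} (hS : ∀ L ∈ S, L.toQF.Realize M v) :
    (outputMatrix marks S).Realize M v := by
  refine (outputMatrix_iff (Φ := QF.Realize M v) (fun _ _ => Iff.rfl) (fun h => h) marks S).2
    ⟨fun L hL _ => hS L hL, ?_⟩
  intro R as has hna bs hbs C hC
  by_contra hcl
  simp only [realize_writeClause, not_exists, not_and, not_not] at hcl
  have h1 := (unifyE_some hC).2.1
  have h2 : (as.map Atm.toTerm).map (Term.eval M v) = (bs.map Atm.toTerm).map (Term.eval M v) := by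
    clear hC has hbs hna
    induction h1 with
    | nil => rfl
    | cons h _ ih =>
      simp only [List.map_cons, List.cons.injEq]
      refine ⟨?_, ih⟩
      rcases h with rfl | h
      · rfl
      · exact hcl _ h
  have h3 : M.rel R ((as.map Atm.toTerm).map (Term.eval M v)) := hS _ has
  have h4 : ¬ M.rel R ((bs.map Atm.toTerm).map (Term.eval M v)) := hS _ hbs
  exact h4 (h2 ▸ h3)

/-- The value of an atom, the existential variables taking new elements among their values. -/
def Atm.value (M : Model σ) (ρ : P → M.carrier) (ε : ℕ → M.carrier ⊕ ULift.{u} ℕ) :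
    Atm σ P → M.carrier ⊕ ULift.{u} ℕ
  | .ex i => ε i
  | .free t => Sum.inl (t.eval M ρ)

/-- A solution of the output in `M` extends to a solution of the reduced formula in an extension
of `M`, the unmarked representatives being interpreted by distinct new elements. -/
theorem FlatFormula.Reduced.exists_extension {psort : P → σ.Srt} {F : FlatFormula σ P}
    {rep : ℕ → ℕ} (hF : F.Reduced psort rep) {marks : ℕ → Bool}
    (hclosed : ∀ L ∈ F.lits, markable marks L = none)
    (hrefl : ∀ i, .ne (.ex i) (.ex i) ∉ F.lits) {M : Model σ} {ρ : P → M.carrier}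
    {ε : ℕ → M.carrier} (hρ : Respects psort M ρ)
    (hsort : ∀ i, marks i = true → M.sort (ε i) = F.exSort i)
    (hout : (outputMatrix marks F.lits).Realize M (Sum.elim ρ ε)) :
    ∃ (N : Model σ) (j : M.carrier → N.carrier), (∀ x, N.sort (j x) = M.sort x) ∧
      (∀ (V : Type u) (q : QF σ V) (τ : V → M.carrier),
        q.Realize N (fun x => j (τ x)) ↔ q.Realize M τ) ∧
      ∃ ε', F.Sat N (fun p => j (ρ p)) ε' := by
  obtain ⟨hlit, hclause⟩ := (outputMatrix_iff (Φ := QF.Realize M (Sum.elim ρ ε))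
    (fun _ _ => Iff.rfl) (fun h => h) marks F.lits).1 hout
  -- New elements are tagged by representatives, so that the unmarked members of a class share one
  -- element.
  set ε' : ℕ → M.carrier ⊕ ULift.{u} ℕ :=
    fun i => if marks i = true then Sum.inl (ε i) else Sum.inr ⟨rep i⟩ with hε'
  set val : Atm σ P → M.carrier ⊕ ULift.{u} ℕ := Atm.value M ρ ε' with hval
  set g : σ.Fn → ℕ → M.carrier ⊕ ULift.{u} ℕ → Prop :=
    fun f i x => ∃ a, .app f i a ∈ F.lits ∧ x = val a with hg
  -- Only instances with an unmarked argument are added; they contain a new element, so `M` is not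
  -- changed (`hr'`).
  set r : σ.Rel → List (M.carrier ⊕ ULift.{u} ℕ) → Prop :=
    fun R xs => ∃ as, .pos R as ∈ F.lits ∧ ¬ (∀ a ∈ as, MarkedVar marks a.toTerm.head) ∧
      xs = as.map val with hr
  have val_marked : ∀ a : Atm σ P, MarkedVar marks a.toTerm.head →
      val a = Sum.inl (a.toTerm.eval M (Sum.elim ρ ε)) := by
    intro a ha
    cases a with
    | ex i => exact if_pos (markedVar_inr.1 ha)
    | free t => exact congrArg Sum.inl (Term.eval_lift M ρ ε t).symm
  have marked_of_val : ∀ (a : Atm σ P) x, val a = Sum.inl x → MarkedVar marks a.toTerm.head := by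
    intro a x ha
    cases a with
    | ex i =>
      refine markedVar_inr.2 ?_
      by_contra h
      have : ε' i = Sum.inr ⟨rep i⟩ := if_neg h
      rw [hval, Atm.value, this] at ha
      cases ha
    | free t => exact Atm.marked_iff.1 rfl
  -- Coincidence of values forces one of the two cases in which `E` does not fail. Normality is
  -- essential: unmarked members of one class share their value.
  have val_inj : ∀ a b : Atm σ P, a.norm rep = a → b.norm rep = b → val a = val b →
      a = b ∨ MarkedVar marks a.toTerm.head ∧ MarkedVar marks b.toTerm.head ∧
        a.toTerm.eval M (Sum.elim ρ ε) = b.toTerm.eval M (Sum.elim ρ ε) := by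
    intro a b ha hb hab
    by_cases h1 : MarkedVar marks a.toTerm.head
    · have h2 := marked_of_val b _ (hab.symm.trans (val_marked a h1))
      refine Or.inr ⟨h1, h2, ?_⟩
      rw [val_marked a h1, val_marked b h2] at hab
      exact Sum.inl_injective hab
    · left
      cases a with
      | free t => exact absurd (Atm.marked_iff.1 rfl) h1
      | ex i =>
        have hi : ε' i = Sum.inr ⟨rep i⟩ := if_neg fun h => h1 (markedVar_inr.2 h)
        cases b with
        | free t =>
          have : ε' i = Sum.inl (t.eval M ρ) := hab
          rw [hi] at this
          cases this
        | ex k =>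
          have hik : ε' i = ε' k := hab
          have hk : ε' k = Sum.inr ⟨rep k⟩ := by
            refine if_neg fun h => ?_
            have : ε' k = Sum.inl (ε k) := if_pos h
            rw [hi, this] at hik
            cases hik
          rw [hi, hk] at hik
          simp only [Sum.inr.injEq, ULift.up.injEq] at hik
          rw [Atm.norm, hik] at ha
          rw [← ha, ← hb]
          rfl
  have hr' : ∀ R (ys : List M.carrier), ¬ r R (ys.map Sum.inl) := by
    rintro R ys ⟨as, _, h2, h3⟩
    refine h2 fun a ha => ?_
    have : val a ∈ ys.map Sum.inl := h3 ▸ List.mem_map_of_mem ha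
    obtain ⟨y, _, hy⟩ := List.mem_map.1 this
    exact marked_of_val a y hy.symm
  refine ⟨M.extend F.exSort g r, Sum.inl, fun x => rfl,
    fun V q τ => Model.extend_realize hr' q τ, ε', ?_, ?_⟩
  all_goals
    have sort_ex : ∀ i < F.exNum,
        Sum.elim M.sort (fun i => F.exSort i.down) (ε' i) = F.exSort i := by
      intro i hi
      by_cases h : marks i = true
      · rw [hε']
        simp only [if_pos h]
        exact hsort i h
      · rw [hε']
        simp only [if_neg h]
        exact (FlatLit.good_ex_eq_ex.1 (hF.wf _ (hF.eq_rep_mem i hi))).1.symm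
  · exact sort_ex
  · set v : P ⊕ ℕ → (M.extend F.exSort g r).carrier :=
      Sum.elim (fun p => Sum.inl (ρ p)) ε' with hv
    have eval_val : ∀ a : Atm σ P, a.toTerm.eval (M.extend F.exSort g r) v = val a := by
      intro a
      cases a with
      | ex i => rfl
      | free t =>
        exact (Term.eval_lift (M.extend F.exSort g r) (fun p => Sum.inl (ρ p)) ε' t).trans
          (Model.extend_eval t ρ)
    have eval_map : ∀ as : List (Atm σ P),
        (as.map Atm.toTerm).map (Term.eval (M.extend F.exSort g r) v) = as.map val := by
      intro as
      rw [List.map_map]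
      exact List.map_congr_left fun a _ => eval_val a
    intro L hL
    by_cases hm : L.toQF.VarsIn (MarkedVar marks)
    · refine (QF.realize_congr hm (ρ' := fun x => Sum.inl (Sum.elim ρ ε x)) ?_).2
        ((Model.extend_realize hr' _ _).2 (hlit L hL hm))
      rintro (p | i) hx
      · rfl
      · exact if_pos (markedVar_inr.1 hx)
    have hcl := hclosed L hL
    rcases hF.normal L hL with ⟨i, rfl⟩ | hn
    -- By saturation a variable and its representative are marked together; here both are unmarked,
    -- with the same new element.
    · have hi : ¬ marks i = true := by
        intro h
        refine hm ⟨markedVar_inr.2 h, markedVar_inr.2 ?_⟩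
        rw [← markable_eq_ex_ex hcl, h]
      have hi' : ¬ marks (rep i) = true := by rwa [← markable_eq_ex_ex hcl]
      show ε' i = ε' (rep i)
      rw [hε']
      simp only [if_neg hi, if_neg hi', hF.rep_rep]
    · cases L with
      | eq a b =>
        -- A nontrivial normal equation has an `e`-free side, so saturation has marked the other
        -- one, against `hm`.
        obtain ⟨-, -, rfl | ⟨t, rfl⟩ | ⟨t, rfl⟩⟩ := hn
        · rfl
        · refine absurd ⟨Atm.marked_iff.1 rfl, ?_⟩ hm
          cases b with
          | ex j => exact markedVar_inr.2 (markable_eq_free_ex hcl)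
          | free t => exact Atm.marked_iff.1 rfl
        · refine absurd ⟨?_, Atm.marked_iff.1 rfl⟩ hm
          cases a with
          | ex j => exact markedVar_inr.2 (markable_eq_ex_free hcl)
          | free t => exact Atm.marked_iff.1 rfl
      | app f i a =>
        have hi : ¬ marks i = true := fun h =>
          hm ⟨markedVar_inr.2 h, Atm.marked_iff.1 (markable_app hcl h)⟩
        obtain ⟨-, -, h3, h4, h5⟩ := FlatLit.good_app.1 (hF.wf _ hL)
        show (M.extend F.exSort g r).fn f (ε' i) = a.toTerm.eval (M.extend F.exSort g r) v
        have hεi : ε' i = Sum.inr ⟨i⟩ := by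
          rw [hε']
          simp only [if_neg hi, hn.1]
        rw [eval_val, hεi]
        refine Model.extend_fn_inr ⟨a, hL, rfl⟩ ?_ ?_
        · rw [← h4]
          cases a with
          | ex k => exact sort_ex k (below_inr.1 h5)
          | free t =>
            show M.sort (t.eval M ρ) = t.lift.sortOf _
            rw [Term.sortOf_lift]
            exact Term.sort_eval ((Term.wellSorted_lift _ _ t).1 h3) (hρ _)
        · rintro y ⟨b, hb, rfl⟩
          rw [(hF.app_unique f i a b hL hb).1]
      | ne a b =>
        intro hab
        have hab' : a.toTerm.eval (M.extend F.exSort g r) v =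
          b.toTerm.eval (M.extend F.exSort g r) v := hab
        rw [eval_val, eval_val] at hab'
        rcases val_inj a b hn.1 hn.2 hab' with rfl | h
        · cases a with
          | ex i => exact hrefl i hL
          | free t => exact hm ⟨Atm.marked_iff.1 rfl, Atm.marked_iff.1 rfl⟩
        · exact hm ⟨h.1, h.2.1⟩
      | pos R as =>
        refine Or.inr ⟨as, hL, fun h => hm ?_, eval_map as⟩
        show ∀ t ∈ as.map Atm.toTerm, MarkedVar marks t.head
        simpa using h
      | neg R bs =>
        intro h
        have h' : (M.extend F.exSort g r).rel R (bs.map val) := eval_map bs ▸ h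
        rcases h' with ⟨ys, h1, -⟩ | ⟨as, h1, h2, h3⟩
        · refine hm ?_
          show ∀ t ∈ bs.map Atm.toTerm, MarkedVar marks t.head
          simp only [List.mem_map, forall_exists_index, and_imp, forall_apply_eq_imp_iff₂]
          intro b hb
          have : val b ∈ ys.map Sum.inl := h1 ▸ List.mem_map_of_mem hb
          obtain ⟨y, _, hy⟩ := List.mem_map.1 this
          exact marked_of_val b y hy.symm
        · have hna : FlatLit.Normal rep (.pos R as) := by
            rcases hF.normal _ h1 with ⟨i, hi⟩ | h
            · cases hi
            · exact h
          -- The violated literal and the added instance agree in value argument by argument, so `E`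
          -- succeeds with true constraints, contradicting the resolvent.
          have h4 : List.Forall₂ (fun a b => a = b ∨ a.marked marks = true ∧
              b.marked marks = true ∧
              a.toTerm.eval M (Sum.elim ρ ε) = b.toTerm.eval M (Sum.elim ρ ε)) as bs := by
            have hn1 : ∀ a ∈ as, a.norm rep = a := hna
            have hn2 : ∀ b ∈ bs, b.norm rep = b := hn
            replace h3 : bs.map val = as.map val := h3
            clear hn hna h1 h2 h hL hm hcl
            induction as generalizing bs with
            | nil =>
              cases bs with
              | nil => exact List.Forall₂.nil
              | cons b bs => simp at h3
            | cons a as ih =>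
              cases bs with
              | nil => simp at h3
              | cons b bs =>
                simp only [List.map_cons, List.cons.injEq] at h3
                refine List.Forall₂.cons ?_ (ih bs
                  (fun a ha => hn1 a (List.mem_cons_of_mem _ ha))
                  (fun b hb => hn2 b (List.mem_cons_of_mem _ hb)) h3.2)
                rcases val_inj a b (hn1 a List.mem_cons_self) (hn2 b List.mem_cons_self)
                  h3.1.symm with h | h
                · exact Or.inl h
                · exact Or.inr ⟨Atm.marked_iff.2 h.1, Atm.marked_iff.2 h.2.1, h.2.2⟩
          obtain ⟨C, h5, h6⟩ := exists_unifyE_eq_some (C := []) h4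
          obtain ⟨p, hp, hne⟩ := realize_writeClause.1 (hclause R as h1 h2 bs hL C h5)
          exact hne ((h6 p hp).resolve_left (by simp))

end Extension

/-! ### Unfolding of dag-format into quantifier-free formulas. -/

section Unfolding

variable {σ : Signature.{u}} {P : Type u}

/-! ### Unfolding acyclic definitions -/

/-- The variable is a parameter, or an existential variable which the equations `D` determine as the
value of a well-sorted term in the parameters. -/
def Definable (psort : P → σ.Srt) (s : ℕ → σ.Srt) (D : List (ℕ × FlatTerm σ P)) (x : P ⊕ ℕ) :
    Prop :=
  ∃ t : Term σ P, t.WellSorted psort ∧ t.sortOf psort = Sum.elim psort s x ∧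
    ∀ (M : Model σ) (ρ : P → M.carrier) (ε : ℕ → M.carrier),
      (∀ d ∈ D, ε d.1 = d.2.toTerm.eval M (Sum.elim ρ ε)) → Sum.elim ρ ε x = t.eval M ρ

variable {psort : P → σ.Srt} {s : ℕ → σ.Srt} {D : List (ℕ × FlatTerm σ P)}

theorem definable_inl (p : P) : Definable psort s D (Sum.inl p) :=
  ⟨.var p, trivial, rfl, fun _ _ _ _ => rfl⟩

theorem Definable.term {t : Term σ (P ⊕ ℕ)} (ht : Definable psort s D t.head)
    (hs : t.WellSorted (Sum.elim psort s)) :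
    ∃ t' : Term σ P, t'.WellSorted psort ∧ t'.sortOf psort = t.sortOf (Sum.elim psort s) ∧
      ∀ (M : Model σ) (ρ : P → M.carrier) (ε : ℕ → M.carrier),
        (∀ d ∈ D, ε d.1 = d.2.toTerm.eval M (Sum.elim ρ ε)) →
        t.eval M (Sum.elim ρ ε) = t'.eval M ρ := by
  induction t with
  | var x => exact ht
  | app f t ih =>
    obtain ⟨t', h1, h2, h3⟩ := ih ht hs.2
    exact ⟨.app f t', ⟨h2.trans hs.1, h1⟩, rfl, fun M ρ ε h => congrArg (M.fn f) (h3 M ρ ε h)⟩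

theorem Definable.qf {q : QF σ (P ⊕ ℕ)} (hq : q.VarsIn (Definable psort s D))
    (hs : q.WellSorted (Sum.elim psort s)) :
    ∃ ψ : QF σ P, ψ.WellSorted psort ∧
      ∀ (M : Model σ) (ρ : P → M.carrier) (ε : ℕ → M.carrier),
        (∀ d ∈ D, ε d.1 = d.2.toTerm.eval M (Sum.elim ρ ε)) →
        (q.Realize M (Sum.elim ρ ε) ↔ ψ.Realize M ρ) := by
  induction q with
  | bot => exact ⟨.bot, trivial, fun _ _ _ _ => Iff.rfl⟩
  | eq t t' =>
    obtain ⟨t₁, h1, h2, h3⟩ := hq.1.term hs.1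
    obtain ⟨t₂, h4, h5, h6⟩ := hq.2.term hs.2.1
    refine ⟨.eq t₁ t₂, ⟨h1, h4, by rw [h2, h5, hs.2.2]⟩, fun M ρ ε h => ?_⟩
    simp only [QF.Realize, h3 M ρ ε h, h6 M ρ ε h]
  | rel R ts =>
    have h : ∃ ts' : List (Term σ P), (∀ t ∈ ts', t.WellSorted psort) ∧
        ts'.map (Term.sortOf psort) = ts.map (Term.sortOf (Sum.elim psort s)) ∧
        ∀ (M : Model σ) (ρ : P → M.carrier) (ε : ℕ → M.carrier),
          (∀ d ∈ D, ε d.1 = d.2.toTerm.eval M (Sum.elim ρ ε)) →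
          ts.map (Term.eval M (Sum.elim ρ ε)) = ts'.map (Term.eval M ρ) := by
      obtain ⟨hs, -⟩ := hs
      induction ts with
      | nil => exact ⟨[], by simp, rfl, fun _ _ _ _ => rfl⟩
      | cons t ts ih =>
        obtain ⟨t', h1, h2, h3⟩ := (hq t List.mem_cons_self).term (hs t List.mem_cons_self)
        obtain ⟨ts', h4, h5, h6⟩ := ih (fun t ht => hq t (List.mem_cons_of_mem _ ht))
          fun t ht => hs t (List.mem_cons_of_mem _ ht)
        refine ⟨t' :: ts', by simpa using ⟨h1, h4⟩, by simp [h2, h5], fun M ρ ε h => ?_⟩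
        simp [h3 M ρ ε h, h6 M ρ ε h]
    obtain ⟨ts', h1, h2, h3⟩ := h
    refine ⟨.rel R ts', ⟨h1, h2.trans hs.2⟩, fun M ρ ε h => ?_⟩
    simp only [QF.Realize, h3 M ρ ε h]
  | neg q ih =>
    obtain ⟨ψ, h1, h2⟩ := ih hq hs
    exact ⟨.neg ψ, h1, fun M ρ ε h => not_congr (h2 M ρ ε h)⟩
  | and q q' ih ih' =>
    obtain ⟨ψ, h1, h2⟩ := ih hq.1 hs.1
    obtain ⟨ψ', h3, h4⟩ := ih' hq.2 hs.2
    exact ⟨.and ψ ψ', ⟨h1, h3⟩, fun M ρ ε h => and_congr (h2 M ρ ε h) (h4 M ρ ε h)⟩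
  | or q q' ih ih' =>
    obtain ⟨ψ, h1, h2⟩ := ih hq.1 hs.1
    obtain ⟨ψ', h3, h4⟩ := ih' hq.2 hs.2
    exact ⟨.or ψ ψ', ⟨h1, h3⟩, fun M ρ ε h => or_congr (h2 M ρ ε h) (h4 M ρ ε h)⟩

namespace DagFormula

/-- The list `D` of all definitions stays fixed while the induction descends along `ds`, so terms
obtained for earlier variables can be substituted into later definitions. -/
theorem Acyclic.definable {seen : List ℕ} {ds : List (ℕ × FlatTerm σ P)} (h : Acyclic seen ds)
    (hseen : ∀ i ∈ seen, Definable psort s D (Sum.inr i)) (hD : ∀ d ∈ ds, d ∈ D)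
    (hs : ∀ d ∈ ds, EqSorted (Sum.elim psort s) (.var (Sum.inr d.1)) d.2.toTerm) :
    ∀ i ∈ ds.map Prod.fst, Definable psort s D (Sum.inr i) := by
  induction ds generalizing seen with
  | nil => simp
  | cons d ds ih =>
    obtain ⟨x, t⟩ := d
    obtain ⟨-, h1, h2⟩ := h
    have h3 := hs _ List.mem_cons_self
    have ht : Definable psort s D t.toTerm.head := by
      cases hh : t.toTerm.head with
      | inl p => exact definable_inl p
      | inr i => exact hseen i (h1 i hh)
    have hx : Definable psort s D (Sum.inr x) := by
      obtain ⟨t', h4, h5, h6⟩ := ht.term h3.2.1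
      exact ⟨t', h4, h5.trans h3.2.2.symm, fun M ρ ε h =>
        (h _ (hD _ List.mem_cons_self)).trans (h6 M ρ ε h)⟩
    intro i hi
    rcases List.mem_cons.1 hi with rfl | hi
    · exact hx
    · refine ih h2 ?_ (fun d hd => hD d (List.mem_cons_of_mem _ hd))
        (fun d hd => hs d (List.mem_cons_of_mem _ hd)) i hi
      intro j hj
      rcases List.mem_cons.1 hj with rfl | hj
      · exact hx
      · exact hseen j hj

/-- The definitions are solved in order, by updates. Later updates concern variables not yet seen,
so they disturb neither the defined variables nor the values used before. -/
theorem Acyclic.exists_solution {seen : List ℕ} {ds : List (ℕ × FlatTerm σ P)}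
    (h : Acyclic seen ds) {M : Model σ} (ρ : P → M.carrier) (ε : ℕ → M.carrier) :
    ∃ ε', (∀ i ∈ seen, ε' i = ε i) ∧
      ∀ d ∈ ds, ε' d.1 = d.2.toTerm.eval M (Sum.elim ρ ε') := by
  induction ds generalizing seen ε with
  | nil => exact ⟨ε, fun _ _ => rfl, by simp⟩
  | cons d ds ih =>
    obtain ⟨x, t⟩ := d
    obtain ⟨h0, h1, h2⟩ := h
    obtain ⟨ε', h3, h4⟩ := ih h2 (Function.update ε x (t.toTerm.eval M (Sum.elim ρ ε)))
    have h5 : ∀ i ∈ seen, ε' i = ε i := by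
      intro i hi
      rw [h3 i (List.mem_cons_of_mem _ hi), Function.update_of_ne]
      rintro rfl
      exact h0 hi
    refine ⟨ε', h5, ?_⟩
    intro d hd
    rcases List.mem_cons.1 hd with rfl | hd
    · rw [h3 x List.mem_cons_self, Function.update_self]
      refine Term.eval_congr ?_
      cases hh : t.toTerm.head with
      | inl p => rfl
      | inr i => exact (h5 i (h1 i hh)).symm
    · exact h4 d hd

/-- A formula in dag-format is equivalent to a quantifier-free formula in the parameters. -/
theorem IsDag.exists_qf {F : DagFormula σ P} (h : F.IsDag psort) :
    ∃ ψ : QF σ P, ψ.WellSorted psort ∧ ∀ (M : Model σ) (ρ : P → M.carrier),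
      Respects psort M ρ → (F.Realize M ρ ↔ ψ.Realize M ρ) := by
  obtain ⟨h1, h2, h3, h4⟩ := h
  have h5 : ∀ i ∈ F.defs.map Prod.fst, Definable psort F.exSort F.defs (Sum.inr i) :=
    h1.definable (by simp) (fun _ h => h) h3
  obtain ⟨ψ, h6, h7⟩ := Definable.qf (D := F.defs) (h2.mono fun x hx => by
    cases x with
    | inl p => exact definable_inl p
    | inr i => exact h5 i (hx i rfl)) h4
  refine ⟨ψ, h6, fun M ρ hρ => ⟨?_, fun hψ => ?_⟩⟩
  · rintro ⟨ε, -, h8, h9⟩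
    exact (h7 M ρ ε h8).1 h9
  -- The starting assignment is an arbitrary default: defined variables are overwritten, and the
  -- others occur nowhere. The sorts come out right because each defined variable equals a
  -- well-sorted term in the parameters.
  · obtain ⟨ε, -, h8⟩ := h1.exists_solution ρ fun _ => (M.sort_surjective (F.exSort 0)).choose
    refine ⟨ε, fun d hd => ?_, h8, (h7 M ρ ε h8).2 hψ⟩
    obtain ⟨t, h9, h10, h11⟩ := h5 d.1 (List.mem_map_of_mem hd)
    have h12 : ε d.1 = t.eval M ρ := h11 M ρ ε h8
    rw [h12]
    exact (Term.sort_eval h9 (hρ _)).trans h10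

end DagFormula

end Unfolding

/-! ### Correctness and cost of the whole procedure. -/

section Cover

variable {σ : Signature.{u}} {P : Type u} [DecidableEq σ.Fn] [DecidableEq σ.Rel] [DecidableEq P]

/-! ### The procedure -/

/-- The quadratic coefficient is `5` for marking, `60` for writing the marked literals and `85` for
Resolution. -/
theorem coverOfClosed_cost {psort : P → σ.Srt} {F : FlatFormula σ P} {m : ℕ}
    (hF : F.WellFormed psort) (hm : F.Bounded m) :
    (coverOfClosed F).cost ≤ 150 * m ^ 2 + 25 * m + 3 := by
  have h0 : Marking.Inv F.lits ⟨fun _ => false, [], false⟩ := ⟨trivial, by simp, by simp⟩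
  obtain ⟨h1, -, h3⟩ := markLoop_spec (n := F.exNum) (fun L hL => (hF L hL).2) h0
    (Nat.le_add_left _ _)
  have h4 := (h1.length_le fun L hL => (hF L hL).2).1
  have h5 := reflexion_cost F.lits
  simp only [coverOfClosed, tick_cost, bind_cost]
  generalize markLoop F.lits F.exNum ⟨fun _ => false, [], false⟩ = k at *
  have h6 := conjoinMarked_cost k.val.marks .top hm.size
  have h7 := resolution_cost k.val.marks F.lits (conjoinMarked k.val.marks F.lits .top).val
    hm.length hm.relSize
  have h8 : F.exNum * (F.lits.length + 2) ≤ m * (5 * m + 2) :=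
    Nat.mul_le_mul hm.exNum (Nat.add_le_add_right hm.length 2)
  have h9 : F.lits.length * (4 * (3 * m) + 1) ≤ 5 * m * (4 * (3 * m) + 1) :=
    Nat.mul_le_mul_right _ hm.length
  have h10 := hm.exNum
  have h11 := hm.length
  cases (reflexion F.lits).val
  · simp only [Bool.false_eq_true, if_false, bind_cost, tick_cost, ret_cost]
    nlinarith
  · simp only [if_true, ret_cost]
    nlinarith

theorem isCoverInDagFormat_coverOfClosed {psort : P → σ.Srt} {φ : Primitive σ P}
    {F : FlatFormula σ P} {rep : ℕ → ℕ} (hF : F.Reduced psort rep)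
    (hφ : ∀ (M : Model σ) (ρ : P → M.carrier), φ.Realize M ρ ↔ ∃ ε, F.Sat M ρ ε) :
    IsCoverInDagFormat psort φ (coverOfClosed F).val := by
  have h0 : Marking.Inv F.lits ⟨fun _ => false, [], false⟩ := ⟨trivial, by simp, by simp⟩
  obtain ⟨h1, h2, -⟩ := markLoop_spec (n := F.exNum) (fun L hL => (hF.wf L hL).2) h0
    (Nat.le_add_left _ _)
  have hval : (coverOfClosed F).val = if (reflexion F.lits).val = true then ⟨F.exSort, [], .bot⟩
      else ⟨F.exSort, (markLoop F.lits F.exNum ⟨fun _ => false, [], false⟩).val.defs.reverse,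
        outputMatrix (markLoop F.lits F.exNum ⟨fun _ => false, [], false⟩).val.marks F.lits⟩ := by
    simp only [coverOfClosed, tick_val, bind_val]
    split_ifs <;> rfl
  generalize (markLoop F.lits F.exNum ⟨fun _ => false, [], false⟩).val = m at *
  by_cases hr : (reflexion F.lits).val = true
  · rw [hval, if_pos hr]
    obtain ⟨i, hi⟩ := (reflexion_val _).1 hr
    have hunsat : ∀ (M : Model σ) (ρ : P → M.carrier), ¬ φ.Realize M ρ := by
      intro M ρ h
      obtain ⟨ε, hε⟩ := (hφ M ρ).1 h
      exact hε.2 _ hi rfl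
    refine ⟨⟨trivial, trivial, by simp, trivial⟩, .bot, ⟨trivial, ?_, ?_⟩, fun M ρ _ => ?_⟩
    · exact fun M ρ _ h => hunsat M ρ h
    · exact fun Z zsort θ _ M ρ ζ _ _ h => h.elim
    · exact ⟨fun ⟨_, _, _, h⟩ => h.elim, fun h => h.elim⟩
  · rw [hval, if_neg hr]
    have hrefl : ∀ i, .ne (.ex i) (.ex i) ∉ F.lits := fun i hi =>
      hr ((reflexion_val _).2 ⟨i, hi⟩)
    have hmarks : ∀ i, m.marks i = true ↔ i ∈ m.defs.reverse.map Prod.fst := by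
      intro i
      rw [h1.marks_iff, List.map_reverse, List.mem_reverse]
    have hdag : DagFormula.IsDag psort
        ⟨F.exSort, m.defs.reverse, outputMatrix m.marks F.lits⟩ := by
      refine ⟨h1.acyclic, ?_, ?_, wellSorted_outputMatrix _ fun L hL => (hF.wf L hL).1⟩
      · exact (varsIn_outputMatrix m.marks F.lits).mono fun x hx i hi => (hmarks i).1 (hx i hi)
      · intro d hd
        obtain ⟨L, hL, hLd⟩ := h1.defines d (List.mem_reverse.1 hd)
        exact hLd.sorted _ (hF.wf L hL).1
    obtain ⟨ψ, h3, h4⟩ := hdag.exists_qf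
    refine ⟨hdag, ψ, ⟨h3, fun M ρ hρ h => ?_, ?_⟩, h4⟩
    · obtain ⟨ε, hε⟩ := (hφ M ρ).1 h
      refine (h4 M ρ hρ).1 ⟨ε, ?_, ?_, realize_outputMatrix _ hε.2⟩
      · intro d hd
        obtain ⟨L, hL, hLd⟩ := h1.defines d (List.mem_reverse.1 hd)
        exact hε.1 _ (below_inr.1 (hLd.varsIn _ (hF.wf L hL).2))
      · intro d hd
        obtain ⟨L, hL, hLd⟩ := h1.defines d (List.mem_reverse.1 hd)
        exact hLd.realize M _ (hε.2 L hL)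
    · intro Z zsort θ hθ M ρ ζ hρ hζ h
      -- The definitions can be dropped: the equations by which variables were marked contain only
      -- marked variables, so they are conjuncts of the matrix.
      obtain ⟨ε, h5, -, h6⟩ := (h4 M ρ hρ).2 h
      have h7 : ∀ i, m.marks i = true → M.sort (ε i) = F.exSort i := by
        intro i hi
        obtain ⟨d, hd, rfl⟩ := List.mem_map.1 ((hmarks i).1 hi)
        exact h5 d hd
      -- The values of the additional variables `z` are carried along `j`; the residue holds in `N`
      -- and is pulled back to `M`.
      obtain ⟨N, j, hj, hq, hsat⟩ := hF.exists_extension h2 hrefl hρ h7 h6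
      have h8 := hθ.2 N (fun p => j (ρ p)) (fun z => j (ζ z))
        (fun p => (hj _).trans (hρ p)) (fun z => (hj _).trans (hζ z)) ((hφ N _).2 hsat)
      refine (hq _ θ (Sum.elim ρ ζ)).1 ?_
      convert h8 using 1
      funext x
      cases x <;> rfl

end Cover

theorem mainTheorem5 :
    ∃ C : ℕ, ∀ (σ : Signature.{u}) [DecidableEq σ.Fn] [DecidableEq σ.Rel]
      (P : Type u) [DecidableEq P] (psort : P → σ.Srt) (φ : Primitive σ P),
      φ.WellFormed psort →
        RSClosed (preprocess φ).val.lits ∧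
        IsCoverInDagFormat psort φ (coverProcedure φ).val ∧
        (coverProcedure φ).cost ≤ C * φ.size ^ 2 := by
  -- With `m = 13 * φ.size`, the total is at most `22 * m ^ 2 + 150 * m ^ 2 + 25 * m + 3 ≤ 200 * m ^
  -- 2`, and `200 * 13 ^ 2 = 33800`.
  refine ⟨33800, ?_⟩
  intro σ _ _ P _ psort φ hφ
  obtain ⟨⟨rep, h1⟩, h2, h3, h4⟩ := preprocess_spec hφ
  refine ⟨h1.rsClosed, isCoverInDagFormat_coverOfClosed h1 h2, ?_⟩
  have h5 := coverOfClosed_cost h1.wf h3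
  have h6 : (coverProcedure φ).cost =
    (preprocess φ).cost + (coverOfClosed (preprocess φ).val).cost := rfl
  have h7 : 1 ≤ φ.size := Nat.le_add_left _ _
  have h8 : φ.size ≤ φ.size ^ 2 := Nat.le_self_pow two_ne_zero _
  rw [h6]
  nlinarith
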